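/- **Setup.** Let $\Gamma$ be a countable discrete group acting measurably and measure-preservingly on a standard probability space $(X,\mu)$, and let $A=L^\infty(X)$ with the action $(g\cdot a)(x)=a(g^{-1}x)$. Let $\pi\colon\Gamma\to O(H)$ be a mixing orthogonal representation on a real Hilbert space $H$ (i.e. $\langle\pi(g)\xi,\eta\rangle\to 0$ as $g\to\infty$ for all $\xi,\eta\in H$), and let $b\colon\Gamma\to H$ be a $1$-cocycle, i.e. $b(gh)=\pi(g)b(h)+b(g)$ for all $g,h\in\Gamma$. Fix an orthonormal basis $(e_i)_{i\in I}$ of $H$, let $(Z,\nu)=\prod_{i\in I}\bigl(\mathbb R,\tfrac1{\sqrt{2\pi}}e^{-x^2/2}dx\bigr)$, and for $\xi=\sum_i c_ie_i\in H$ let $\omega(\xi)\in\mathcal U(L^\infty(Z))$ be the function $(z_i)_i\mapsto\exp\bigl(\sqrt2\,i\sum_i c_iz_i\bigr)$, where the series converges in $L^2(Z)$. Let $D\subset L^\infty(Z)$ be the von Neumann algebra generated by $\{\omega(\xi):\xi\in H\}$, with the trace-preserving $\Gamma$-action determined by $g\cdot\omega(\xi)=\omega(\pi(g)\xi)$. Put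 $$M=A\rtimes\Gamma=(1\otimes A)\rtimes\Gamma\ \subset\ \tilde M=(D\,\bar\otimes\,A)\rtimes\Gamma ,$$ where $\Gamma$ acts diagonally on $D\,\bar\otimes\,A$. Let $(u_g)_{g\in\Gamma}$ be the canonical unitaries, $\tau$ the canonical trace on $\tilde M$, and $\|x\|_2=\tau(x^*x)^{1/2}$. For $t\in\mathbb R$ let $\alpha_t$ be the $*$-automorphism of $\tilde M$ that is conjugation, in the regular representation of $\tilde M$ on $\ell^2(\Gamma,L^2(Z\times X))$, by the unitary which multiplies in the fibre over $g$ by $\omega(t\,\pi(g)^{-1}b(g))\otimes1$; it satisfies $$\alpha_t|_{D\bar\otimes A}=\mathrm{id},\qquad \alpha_t(u_g)=(\omega(t\,b(g))\otimes 1)\,u_g\quad(g\in\Gamma).$$ For $x\in M$ and $g\in\Gamma$ let $(x)_g=E_A(xu_g^*)$ be the Fourier coefficient of $x$ at $g$, where $E_A\colon M\to A$ is the trace-preserving conditional expectation. **Theorem.** Let $B\subset M$ be an abelian von Neumann subalgebra (with the same unit), let $t>0$, and let $(v_n)_{n\in\mathbb N}$ be a sequence in the normalizer $\mathcal N_M(B)=\{u\in\mathcal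 U(M): u^*Bu=B\}$ such that (a) $\|\alpha_t(v_n)-v_n\|_2<\tfrac1{200}$ for all $n\in\mathbb N$; (b) for every $g\in\Gamma$, $\|(v_n)_g\|_2\to0$ as $n\to\infty$. Then there is a non-zero partial isometry $v\in\tilde M$ such that $\alpha_t(x)v=vx$ for all $x\in B$. -/

import Mathlib

open MeasureTheory ProbabilityTheory Filter Topology
open scoped ENNReal

noncomputable section

namespace GaussianDeformation

/-! ### Von Neumann algebras of operators -/

section VonNeumann

variable {𝓚 : Type*} [NormedAddCommGroup 𝓚] [InnerProductSpace ℂ 𝓚] [CompleteSpace 𝓚]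

instance : SMulMemClass (VonNeumannAlgebra 𝓚) ℂ (𝓚 →L[ℂ] 𝓚) where
  smul_mem {s} c x hx :=
    show c • x ∈ s.toStarSubalgebra from
      SMulMemClass.smul_mem c (show x ∈ s.toStarSubalgebra from hx)

/-- The von Neumann algebra generated by a set `S` of bounded operators: the double commutant of
`S ∪ S*`. -/
def vnGen (S : Set (𝓚 →L[ℂ] 𝓚)) : VonNeumannAlgebra 𝓚 where
  toStarSubalgebra := StarSubalgebra.centralizer ℂ
    (StarSubalgebra.centralizer ℂ S : Set (𝓚 →L[ℂ] 𝓚))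
  centralizer_centralizer' := by simp

theorem coe_vnGen (S : Set (𝓚 →L[ℂ] 𝓚)) :
    (vnGen S : Set (𝓚 →L[ℂ] 𝓚)) = Set.centralizer (Set.centralizer (S ∪ star S)) :=
  StarSubalgebra.coe_centralizer_centralizer ℂ S

theorem subset_vnGen (S : Set (𝓚 →L[ℂ] 𝓚)) : S ⊆ vnGen S := by
  rw [coe_vnGen]
  exact Set.subset_union_left.trans Set.subset_centralizer_centralizer

/-- The von Neumann algebra generated by `S` is the smallest one that contains `S`. -/
theorem vnGen_le {S : Set (𝓚 →L[ℂ] 𝓚)} {N : VonNeumannAlgebra 𝓚} (h : S ⊆ N) :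
    vnGen S ≤ N := by
  have h2 : S ∪ star S ⊆ N := by
    refine Set.union_subset h fun x hx => ?_
    have := h hx
    simpa using star_mem (this : star x ∈ N)
  rw [← SetLike.coe_subset_coe, coe_vnGen, ← N.centralizer_centralizer]
  exact Set.centralizer_subset (Set.centralizer_subset h2)

/-- Conjugation by a unitary `w` maps `vnGen S` into `N` as soon as it maps `S` into `N`. -/
theorem conj_mem_of_mem_vnGen {S : Set (𝓚 →L[ℂ] 𝓚)} {N : VonNeumannAlgebra 𝓚}
    {w : 𝓚 →L[ℂ] 𝓚} (h1 : star w * w = 1) (h2 : w * star w = 1)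
    (h : ∀ s ∈ S, w * s * star w ∈ N) {x : 𝓚 →L[ℂ] 𝓚} (hx : x ∈ vnGen S) :
    w * x * star w ∈ N := by
  have h' : ∀ s ∈ S ∪ star S, w * s * star w ∈ N := by
    rintro s (hs | hs)
    · exact h s hs
    · have := star_mem (h _ hs)
      simpa [mul_assoc] using this
  rw [← SetLike.mem_coe, coe_vnGen] at hx
  rw [← SetLike.mem_coe, ← N.centralizer_centralizer]
  intro y hy
  have key : star w * y * w ∈ Set.centralizer (S ∪ star S) := by
    intro s hs
    have h3 : w * s * star w * y = y * (w * s * star w) := hy _ (h' s hs)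
    calc s * (star w * y * w) = star w * (w * s * star w * y) * w := by
          simp only [← mul_assoc]; rw [h1, one_mul]
      _ = star w * y * w * s * (star w * w) := by rw [h3]; simp only [mul_assoc]
      _ = star w * y * w * s := by rw [h1, mul_one]
  have h4 : star w * y * w * x = x * (star w * y * w) := hx _ key
  calc y * (w * x * star w) = (w * star w) * y * w * x * star w := by
        rw [h2, one_mul]; simp only [mul_assoc]
    _ = w * (star w * y * w * x) * star w := by simp only [mul_assoc]
    _ = w * x * star w * y * (w * star w) := by rw [h4]; simp only [mul_assoc]
    _ = w * x * star w * y := by rw [h2, mul_one]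

/-- The normalizer `{u ∈ 𝒰(N) | u* B u = B}` of `B` in `N`. -/
def normalizer (N B : VonNeumannAlgebra 𝓚) : Set (𝓚 →L[ℂ] 𝓚) :=
  {u | u ∈ N ∧ u ∈ unitary (𝓚 →L[ℂ] 𝓚) ∧
    (fun x => star u * x * u) '' (B : Set (𝓚 →L[ℂ] 𝓚)) = B}

end VonNeumann

/-! ### The Gaussian functor -/

section Gaussian

/-- The Gaussian space `Z = ℝ^ι` with the product of standard Gaussian measures. -/
def gaussianMeasure (ι : Type*) : Measure (ι → ℝ) :=
  Measure.infinitePi fun _ : ι => gaussianReal 0 1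

instance (ι : Type*) : IsProbabilityMeasure (gaussianMeasure ι) := by
  unfold gaussianMeasure; infer_instance

variable {ι : Type*}

theorem memLp_coord (i : ι) : MemLp (fun z : ι → ℝ => z i) 2 (gaussianMeasure ι) :=
  (memLp_id_gaussianReal' (μ := 0) (v := 1) 2 (by simp)).comp_measurePreserving
    (measurePreserving_eval_infinitePi (fun _ : ι => gaussianReal 0 1) i)

/-- The coordinate function `z ↦ z i` in `L²(Z)`. -/
def coord (i : ι) : Lp ℝ 2 (gaussianMeasure ι) := (memLp_coord i).toLp _

theorem orthonormal_coord : Orthonormal ℝ (coord (ι := ι)) := by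
  classical
  rw [orthonormal_iff_ite]
  intro i j
  have hint : inner ℝ (coord i) (coord j) = ∫ z : ι → ℝ, z i * z j ∂(gaussianMeasure ι) := by
    rw [L2.inner_def]
    refine integral_congr_ae ?_
    filter_upwards [(memLp_coord (ι := ι) i).coeFn_toLp, (memLp_coord (ι := ι) j).coeFn_toLp]
      with z h1 h2
    simp only [coord]
    rw [h1, h2]
    simp [mul_comm]
  have hmp : ∀ k : ι, MeasurePreserving (fun z : ι → ℝ => z k) (gaussianMeasure ι)
      (gaussianReal 0 1) := fun k =>
    measurePreserving_eval_infinitePi (fun _ : ι => gaussianReal 0 1) k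
  rw [hint]
  split_ifs with hij
  · subst hij
    have hsq : ∫ z : ι → ℝ, z i * z i ∂(gaussianMeasure ι) =
        ∫ x : ℝ, x * x ∂(gaussianReal 0 1) := by
      rw [← (hmp i).map_eq, integral_map (measurable_pi_apply i).aemeasurable (by fun_prop)]
    have hv := variance_fun_id_gaussianReal (μ := 0) (v := 1)
    rw [variance_eq_integral (by fun_prop)] at hv
    simp only [integral_id_gaussianReal, sub_zero] at hv
    rw [hsq]
    simpa [pow_two] using hv
  · have hind : IndepFun (fun z : ι → ℝ => z i) (fun z : ι → ℝ => z j) (gaussianMeasure ι) :=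
      (iIndepFun_infinitePi (P := fun _ : ι => gaussianReal 0 1) (X := fun _ (x : ℝ) => x)
        (fun _ => measurable_id)).indepFun hij
    have h0 : ∫ z : ι → ℝ, z i ∂(gaussianMeasure ι) = 0 := by
      have := integral_id_gaussianReal (μ := 0) (v := 1)
      rw [← (hmp i).map_eq, integral_map (measurable_pi_apply i).aemeasurable (by fun_prop)] at this
      exact this
    have := hind.integral_mul_eq_mul_integral
      (measurable_pi_apply i).aestronglyMeasurable (measurable_pi_apply j).aestronglyMeasurable
    simp only [Pi.mul_apply] at this
    rw [h0, zero_mul] at this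
    exact this

variable {H : Type*} [NormedAddCommGroup H] [InnerProductSpace ℝ H]

/-- The isometry `H → L²(Z)`, `∑ cₙ eₙ ↦ ∑ cₙ zₙ` (the series converges in `L²`). -/
def field (e : HilbertBasis ι ℝ H) : H →ₗᵢ[ℝ] Lp ℝ 2 (gaussianMeasure ι) :=
  (orthonormal_coord (ι := ι)).orthogonalFamily.linearIsometry.comp e.repr.toLinearIsometry

theorem field_basis (e : HilbertBasis ι ℝ H) (i : ι) : field e (e i) = coord i := by
  classical
  change (orthonormal_coord (ι := ι)).orthogonalFamily.linearIsometry (e.repr (e i)) = _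
  rw [e.repr_self, OrthogonalFamily.linearIsometry_apply_single]
  simp

/-- The function `exp(√2 i ∑ cₙ zₙ)` on `Z`, where `ξ = ∑ cₙ eₙ`. -/
def omegaFun (e : HilbertBasis ι ℝ H) (ξ : H) (z : ι → ℝ) : ℂ :=
  Complex.exp (((Real.sqrt 2 * field e ξ z : ℝ) : ℂ) * Complex.I)

theorem norm_omegaFun (e : HilbertBasis ι ℝ H) (ξ : H) (z : ι → ℝ) : ‖omegaFun e ξ z‖ = 1 :=
  Complex.norm_exp_ofReal_mul_I _

theorem memLp_omegaFun (e : HilbertBasis ι ℝ H) (ξ : H) :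
    MemLp (omegaFun e ξ) ∞ (gaussianMeasure ι) := by
  refine memLp_top_of_bound ?_ 1 (.of_forall fun z => (norm_omegaFun e ξ z).le)
  have := (Lp.aestronglyMeasurable (field e ξ)).aemeasurable
  unfold omegaFun
  exact AEMeasurable.aestronglyMeasurable (by fun_prop)

/-- The unitary `ω(ξ) ∈ L^∞(Z)`. -/
def omega (e : HilbertBasis ι ℝ H) (ξ : H) : Lp ℂ ∞ (gaussianMeasure ι) :=
  (memLp_omegaFun e ξ).toLp _

theorem coeFn_omega (e : HilbertBasis ι ℝ H) (ξ : H) :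
    omega e ξ =ᵐ[gaussianMeasure ι] omegaFun e ξ :=
  (memLp_omegaFun e ξ).coeFn_toLp

theorem omegaFun_add (e : HilbertBasis ι ℝ H) (ξ η : H) :
    omegaFun e (ξ + η) =ᵐ[gaussianMeasure ι] fun z => omegaFun e ξ z * omegaFun e η z := by
  have h : field e (ξ + η) =ᵐ[gaussianMeasure ι] field e ξ + field e η := by
    rw [map_add]; exact Lp.coeFn_add _ _
  filter_upwards [h] with z hz
  rw [omegaFun, hz, omegaFun, omegaFun, ← Complex.exp_add]
  simp only [Pi.add_apply]
  push_cast
  ring_nf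

theorem omegaFun_zero (e : HilbertBasis ι ℝ H) :
    omegaFun e (0 : H) =ᵐ[gaussianMeasure ι] fun _ => 1 := by
  have h : field e (0 : H) =ᵐ[gaussianMeasure ι] 0 := by
    rw [map_zero]; exact Lp.coeFn_zero _ _ _
  filter_upwards [h] with z hz
  rw [omegaFun, hz]
  simp

theorem omegaFun_neg (e : HilbertBasis ι ℝ H) (ξ : H) :
    omegaFun e (-ξ) =ᵐ[gaussianMeasure ι] fun z => star (omegaFun e ξ z) := by
  have h : field e (-ξ) =ᵐ[gaussianMeasure ι] -field e ξ := by
    rw [map_neg]; exact Lp.coeFn_neg _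
  filter_upwards [h] with z hz
  rw [omegaFun, hz, omegaFun, Complex.star_def, ← Complex.exp_conj]
  simp

theorem norm_omega_le (e : HilbertBasis ι ℝ H) (ξ : H) : ‖omega e ξ‖ ≤ 1 := by
  refine Lp.norm_le_of_ae_bound zero_le_one ?_ |>.trans (by simp)
  filter_upwards [(memLp_omegaFun e ξ).coeFn_toLp] with z hz
  rw [omega, hz, norm_omegaFun]

end Gaussian

/-! ### Multiplication operators -/

/-- The operator on `L²` of multiplication by an element of `L^∞`. -/
def mulOp {S : Type*} [MeasurableSpace S] {m : Measure S} (a : Lp ℂ ∞ m) :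
    Lp ℂ 2 m →L[ℂ] Lp ℂ 2 m :=
  (ContinuousLinearMap.mul ℂ ℂ).holderL m ∞ 2 2 a

theorem coeFn_mulOp {S : Type*} [MeasurableSpace S] {m : Measure S} (a : Lp ℂ ∞ m)
    (f : Lp ℂ 2 m) : mulOp a f =ᵐ[m] fun s => a s * f s :=
  (ContinuousLinearMap.mul ℂ ℂ).coeFn_holder a f

theorem norm_mulOp_le {S : Type*} [MeasurableSpace S] {m : Measure S} (a : Lp ℂ ∞ m) :
    ‖mulOp a‖ ≤ ‖a‖ := by
  refine ((ContinuousLinearMap.mul ℂ ℂ).holderL m ∞ 2 2).le_opNorm a |>.trans ?_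
  have h1 := (ContinuousLinearMap.norm_holderL_le (μ := m) (p := ∞) (q := 2) (r := 2)
    (ContinuousLinearMap.mul ℂ ℂ)).trans (ContinuousLinearMap.opNorm_mul_le ℂ ℂ)
  exact mul_le_of_le_one_left (norm_nonneg _) h1

theorem mulOp_comm {S : Type*} [MeasurableSpace S] {m : Measure S} (a b : Lp ℂ ∞ m) :
    mulOp a * mulOp b = mulOp b * mulOp a := by
  ext1 f
  refine Lp.ext ?_
  filter_upwards [coeFn_mulOp a (mulOp b f), coeFn_mulOp b (mulOp a f), coeFn_mulOp a f,
    coeFn_mulOp b f] with s h1 h2 h3 h4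
  change mulOp a (mulOp b f) s = mulOp b (mulOp a f) s
  rw [h1, h2, h3, h4]
  ring

/-! ### The algebra `M̃ = (D ⊗̄ A) ⋊ Γ` -/

section Algebra

variable (Γ : Type*) {X : Type*} [MeasurableSpace X] (μ : Measure X) (ι : Type*)

/-- `L²(Z) ⊗ L²(X) = L²(Z × X)`. -/
abbrev Base : Type _ := Lp ℂ 2 ((gaussianMeasure ι).prod μ)

/-- The Hilbert space `L²(Z) ⊗ L²(X) ⊗ ℓ²(Γ)`, as the space of square summable functions from `Γ`
to `L²(Z × X)`. -/
abbrev Space : Type _ := lp (fun _ : Γ => Base μ ι) 2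

variable {Γ ι}

/-- The shift `f ↦ f(h⁻¹ ·)` in the variable of `Γ`. -/
def shift [Group Γ] (h : Γ) : Space Γ μ ι →ₗᵢ[ℂ] Space Γ μ ι where
  toFun f := ⟨fun g => f (h⁻¹ * g), by
    have h2 : 0 < (2 : ℝ≥0∞).toReal := by simp
    have := (memℓp_gen_iff h2).1 (lp.memℓp f)
    exact (memℓp_gen_iff h2).2 ((Equiv.mulLeft h⁻¹).summable_iff.2 this)⟩
  map_add' _ _ := rfl
  map_smul' _ _ := rfl
  norm_map' f := by
    have h2 : 0 < (2 : ℝ≥0∞).toReal := by simp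
    rw [lp.norm_eq_tsum_rpow h2, lp.norm_eq_tsum_rpow h2]
    congr 1
    exact (Equiv.mulLeft h⁻¹).tsum_eq fun g => ‖f g‖ ^ (2 : ℝ≥0∞).toReal

/-- The canonical unitary `u_h`. -/
def u [Group Γ] (h : Γ) : Space Γ μ ι →L[ℂ] Space Γ μ ι := (shift μ h).toContinuousLinearMap

theorem u_apply [Group Γ] (h : Γ) (f : Space Γ μ ι) (g : Γ) : u μ h f g = f (h⁻¹ * g) := rfl

variable [IsProbabilityMeasure μ]

/-- The unit vector `1 ⊗ 1 ⊗ δ_e`. -/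
def vacuum [Group Γ] : Space Γ μ ι :=
  open scoped Classical in lp.single 2 (1 : Γ) ((memLp_const (1 : ℂ)).toLp _)

/-- The canonical trace. -/
def trace [Group Γ] (x : Space Γ μ ι →L[ℂ] Space Γ μ ι) : ℂ :=
  inner ℂ (vacuum μ) (x (vacuum μ))

/-- The `2`-norm `‖x‖₂ = τ(x* x)^{1/2}`. -/
def norm2 [Group Γ] (x : Space Γ μ ι →L[ℂ] Space Γ μ ι) : ℝ :=
  Real.sqrt (trace μ (star x * x)).re

/-- The operator of multiplication by `a_g ∈ L^∞(Z × X)` in the fibre over `g`. -/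
def diag (a : Γ → Lp ℂ ∞ ((gaussianMeasure ι).prod μ)) (C : ℝ) (hC : 0 ≤ C)
    (ha : ∀ g, ‖a g‖ ≤ C) : Space Γ μ ι →L[ℂ] Space Γ μ ι :=
  lp.mapCLM 2 (fun g => mulOp (a g)) hC fun g => (norm_mulOp_le _).trans (ha g)

theorem diag_apply (a : Γ → Lp ℂ ∞ ((gaussianMeasure ι).prod μ)) (C : ℝ) (hC : 0 ≤ C)
    (ha : ∀ g, ‖a g‖ ≤ C) (f : Space Γ μ ι) (g : Γ) :
    diag μ a C hC ha f g = mulOp (a g) (f g) := rfl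

variable {H : Type*} [NormedAddCommGroup H] [InnerProductSpace ℝ H]

/-- The element `d ⊗ 1` of `L^∞(Z × X)`, for `d ∈ L^∞(Z)`. -/
def tensorOne (d : Lp ℂ ∞ (gaussianMeasure ι)) : Lp ℂ ∞ ((gaussianMeasure ι).prod μ) :=
  Lp.compMeasurePreserving Prod.fst measurePreserving_fst d

variable (ι) in
/-- The element `1 ⊗ a` of `L^∞(Z × X)`, for `a ∈ A = L^∞(X)`. -/
def oneTensor (a : Lp ℂ ∞ μ) : Lp ℂ ∞ ((gaussianMeasure ι).prod μ) :=
  Lp.compMeasurePreserving Prod.snd measurePreserving_snd a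

theorem norm_tensorOne (d : Lp ℂ ∞ (gaussianMeasure ι)) : ‖tensorOne μ d‖ = ‖d‖ :=
  Lp.norm_compMeasurePreserving d measurePreserving_fst

theorem norm_oneTensor (a : Lp ℂ ∞ μ) : ‖oneTensor μ ι a‖ = ‖a‖ :=
  Lp.norm_compMeasurePreserving a measurePreserving_snd

/-- The action of `Γ` on `A = L^∞(X)`, `(g · a)(x) = a(g⁻¹ x)`. -/
def translate [Group Γ] [MulAction Γ X] [MeasurableConstSMul Γ X] [SMulInvariantMeasure Γ X μ]
    (g : Γ) (a : Lp ℂ ∞ μ) : Lp ℂ ∞ μ :=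
  Lp.compMeasurePreserving (fun x => g⁻¹ • x) (measurePreserving_smul g⁻¹ μ) a

theorem norm_translate [Group Γ] [MulAction Γ X] [MeasurableConstSMul Γ X]
    [SMulInvariantMeasure Γ X μ] (g : Γ) (a : Lp ℂ ∞ μ) : ‖translate μ g a‖ = ‖a‖ :=
  Lp.norm_compMeasurePreserving a _

/-- The operator of multiplication by `ω(ξ_g) ⊗ 1` in the fibre over `g`. -/
def diagOmega (e : HilbertBasis ι ℝ H) (ξ : Γ → H) : Space Γ μ ι →L[ℂ] Space Γ μ ι :=
  diag μ (fun g => tensorOne μ (omega e (ξ g))) 1 zero_le_one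
    fun g => by rw [norm_tensorOne]; exact norm_omega_le e _

theorem diagOmega_apply (e : HilbertBasis ι ℝ H) (ξ : Γ → H) (f : Space Γ μ ι) (g : Γ) :
    diagOmega μ e ξ f g =ᵐ[(gaussianMeasure ι).prod μ] fun p => omegaFun e (ξ g) p.1 * f g p := by
  have h1 : tensorOne μ (omega e (ξ g)) =ᵐ[(gaussianMeasure ι).prod μ]
      fun p => omega e (ξ g) p.1 :=
    Lp.coeFn_compMeasurePreserving (omega e (ξ g)) measurePreserving_fst
  have h2 : ∀ᵐ p ∂(gaussianMeasure ι).prod μ, omega e (ξ g) p.1 = omegaFun e (ξ g) p.1 :=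
    Measure.quasiMeasurePreserving_fst.ae (coeFn_omega e (ξ g))
  filter_upwards [coeFn_mulOp (tensorOne μ (omega e (ξ g))) (f g), h1, h2] with p h3 h1 h2
  rw [← h2, ← h1, ← h3]
  rfl

theorem diagOmega_mul (e : HilbertBasis ι ℝ H) (ξ η : Γ → H) :
    diagOmega μ e ξ * diagOmega μ e η = diagOmega μ e (ξ + η) := by
  ext1 f
  ext1
  funext g
  refine Lp.ext ?_
  have h2 : ∀ᵐ p ∂(gaussianMeasure ι).prod μ, omegaFun e (ξ g + η g) p.1 =
      omegaFun e (ξ g) p.1 * omegaFun e (η g) p.1 :=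
    Measure.quasiMeasurePreserving_fst.ae (omegaFun_add e (ξ g) (η g))
  filter_upwards [diagOmega_apply μ e ξ (diagOmega μ e η f) g, diagOmega_apply μ e η f g,
    diagOmega_apply μ e (ξ + η) f g, h2] with p h3 h4 h5 h2
  rw [h5, Pi.add_apply, h2, mul_assoc, ← h4, ← h3]
  rfl

theorem diagOmega_zero (e : HilbertBasis ι ℝ H) : diagOmega (Γ := Γ) μ e 0 = 1 := by
  ext1 f
  ext1
  funext g
  refine Lp.ext ?_
  have h2 : ∀ᵐ p ∂(gaussianMeasure ι).prod μ, omegaFun e (0 : H) p.1 = 1 :=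
    Measure.quasiMeasurePreserving_fst.ae (omegaFun_zero e)
  filter_upwards [diagOmega_apply μ e 0 f g, h2] with p h3 h2
  rw [h3, Pi.zero_apply, h2, one_mul]
  rfl

theorem star_diagOmega (e : HilbertBasis ι ℝ H) (ξ : Γ → H) :
    star (diagOmega μ e ξ) = diagOmega μ e (-ξ) := by
  rw [ContinuousLinearMap.star_eq_adjoint, eq_comm, ContinuousLinearMap.eq_adjoint_iff]
  intro f k
  rw [lp.inner_eq_tsum, lp.inner_eq_tsum]
  congr 1
  funext g
  rw [L2.inner_def, L2.inner_def]
  refine integral_congr_ae ?_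
  have h2 : ∀ᵐ p ∂(gaussianMeasure ι).prod μ, omegaFun e (-ξ g) p.1 =
      star (omegaFun e (ξ g) p.1) :=
    Measure.quasiMeasurePreserving_fst.ae (omegaFun_neg e (ξ g))
  filter_upwards [diagOmega_apply μ e (-ξ) f g, diagOmega_apply μ e ξ k g, h2] with p h3 h4 h2
  rw [h3, h4, Pi.neg_apply, h2]
  simp only [RCLike.inner_apply, map_mul, Complex.star_def, Complex.conj_conj]
  ring

theorem diagOmega_comm_diag (e : HilbertBasis ι ℝ H) (ξ : Γ → H)
    (a : Γ → Lp ℂ ∞ ((gaussianMeasure ι).prod μ)) (C : ℝ) (hC : 0 ≤ C) (ha : ∀ g, ‖a g‖ ≤ C) :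
    diagOmega μ e ξ * diag μ a C hC ha = diag μ a C hC ha * diagOmega μ e ξ := by
  ext1 f
  ext1
  funext g
  exact congrArg (fun T => T (f g)) (mulOp_comm (tensorOne μ (omega e (ξ g))) (a g))

variable [Group Γ]

theorem u_mul_diagOmega (e : HilbertBasis ι ℝ H) (ξ : Γ → H) (h : Γ) :
    u μ h * diagOmega μ e ξ = diagOmega μ e (fun g => ξ (h⁻¹ * g)) * u μ h := rfl

/-- The operator on the crossed product space given by `ω(ξ) ⊗ 1`: in the fibre over `g` it is
multiplication by `g⁻¹ · ω(ξ) ⊗ 1 = ω(π(g)⁻¹ ξ) ⊗ 1`. -/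
def opD (e : HilbertBasis ι ℝ H) (π : Γ →* (H ≃ₗᵢ[ℝ] H)) (ξ : H) :
    Space Γ μ ι →L[ℂ] Space Γ μ ι :=
  diagOmega μ e fun g => π g⁻¹ ξ

theorem u_mul (g h : Γ) : u (ι := ι) μ g * u μ h = u μ (g * h) := by
  ext1 f
  ext1
  funext k
  change f (h⁻¹ * (g⁻¹ * k)) = f ((g * h)⁻¹ * k)
  rw [mul_inv_rev, mul_assoc]

theorem u_mul_opD (e : HilbertBasis ι ℝ H) (π : Γ →* (H ≃ₗᵢ[ℝ] H)) (g : Γ) (ξ : H) :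
    u μ g * opD μ e π ξ = opD μ e π (π g ξ) * u μ g := by
  rw [opD, u_mul_diagOmega, opD]
  congr 2
  funext k
  rw [mul_inv_rev, inv_inv, map_mul, LinearIsometryEquiv.coe_mul, Function.comp_apply]

/-! ### Cocycles and the implementing unitaries -/

/-- A 1-cocycle `b : Γ → H` for the representation `π`. -/
structure Cocycle (π : Γ →* (H ≃ₗᵢ[ℝ] H)) where
  /-- The underlying map. -/
  toFun : Γ → H
  map_mul : ∀ g h, toFun (g * h) = π g (toFun h) + toFun g

/-- The operator of multiplication by `ω(t π(g)⁻¹ b(g)) ⊗ 1` in the fibre over `g`. -/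
def implOp (e : HilbertBasis ι ℝ H) {π : Γ →* (H ≃ₗᵢ[ℝ] H)} (b : Cocycle π) (t : ℝ) :
    Space Γ μ ι →L[ℂ] Space Γ μ ι :=
  diagOmega μ e fun g => t • π g⁻¹ (b.toFun g)

variable (e : HilbertBasis ι ℝ H) {π : Γ →* (H ≃ₗᵢ[ℝ] H)} (b : Cocycle π)

theorem implOp_add (s t : ℝ) : implOp μ e b s * implOp μ e b t = implOp μ e b (s + t) := by
  rw [implOp, implOp, diagOmega_mul, implOp]
  congr 1
  funext g
  simp [add_smul]

theorem implOp_zero : implOp μ e b 0 = 1 := by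
  rw [implOp, ← diagOmega_zero μ e]
  congr 1
  funext g
  simp

theorem star_implOp (t : ℝ) : star (implOp μ e b t) = implOp μ e b (-t) := by
  rw [implOp, star_diagOmega, implOp]
  congr 1
  funext g
  simp

theorem implOp_neg_mul (t : ℝ) : implOp μ e b (-t) * implOp μ e b t = 1 := by
  rw [implOp_add, neg_add_cancel, implOp_zero]

theorem implOp_mul_neg (t : ℝ) : implOp μ e b t * implOp μ e b (-t) = 1 := by
  rw [implOp_add, add_neg_cancel, implOp_zero]

theorem implOp_mul_u (t : ℝ) (h : Γ) :
    implOp μ e b t * u μ h = opD μ e π (t • b.toFun h) * u μ h * implOp μ e b t := by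
  rw [mul_assoc, implOp, u_mul_diagOmega, ← mul_assoc, opD, diagOmega_mul]
  congr 2
  funext g
  have hb : b.toFun g = π h (b.toFun (h⁻¹ * g)) + b.toFun h := by
    rw [← b.map_mul, mul_inv_cancel_left]
  rw [Pi.add_apply, mul_inv_rev, inv_inv, map_mul, LinearIsometryEquiv.coe_mul,
    Function.comp_apply, hb, map_add, map_smul, smul_add, add_comm]

theorem implOp_conj_u (t : ℝ) (h : Γ) :
    implOp μ e b t * u μ h * star (implOp μ e b t) = opD μ e π (t • b.toFun h) * u μ h := by
  rw [implOp_mul_u, mul_assoc, star_implOp, implOp_mul_neg, mul_one]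

variable [MulAction Γ X] [MeasurableConstSMul Γ X] [SMulInvariantMeasure Γ X μ]

/-- The operator on the crossed product space given by `1 ⊗ a`, `a ∈ A`: in the fibre over `g` it is
multiplication by `1 ⊗ g⁻¹ · a`. -/
def opA (a : Lp ℂ ∞ μ) : Space Γ μ ι →L[ℂ] Space Γ μ ι :=
  diag μ (fun g : Γ => oneTensor μ ι (translate μ g⁻¹ a)) ‖a‖ (norm_nonneg a)
    fun g => by rw [norm_oneTensor, norm_translate]

theorem u_mul_opA (g : Γ) (a : Lp ℂ ∞ μ) :
    u (ι := ι) μ g * opA μ a = opA μ (translate μ g a) * u μ g := by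
  ext1 f
  ext1
  funext k
  have h : translate μ (g⁻¹ * k)⁻¹ a = translate μ k⁻¹ (translate μ g a) := by
    have h1 : (fun x : X => ((g⁻¹ * k)⁻¹)⁻¹ • x) =
        (fun x : X => g⁻¹ • x) ∘ fun x : X => (k⁻¹)⁻¹ • x := by
      funext x
      simp [mul_smul]
    unfold translate
    rw [← Lp.compMeasurePreserving_comp_apply]
    congr 2
  change mulOp (oneTensor μ ι (translate μ (g⁻¹ * k)⁻¹ a)) (f (g⁻¹ * k)) =
    mulOp (oneTensor μ ι (translate μ k⁻¹ (translate μ g a))) (f (g⁻¹ * k))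
  rw [h]

/-- The copy of `D ⊗̄ A` in the crossed product; `D` is generated by the unitaries `ω(ξ)`. -/
def algDA (e : HilbertBasis ι ℝ H) (π : Γ →* (H ≃ₗᵢ[ℝ] H)) : VonNeumannAlgebra (Space Γ μ ι) :=
  vnGen (Set.range (opD μ e π) ∪ Set.range (opA μ))

/-- The crossed product `M̃ = (D ⊗̄ A) ⋊ Γ`. -/
def algMtilde (e : HilbertBasis ι ℝ H) (π : Γ →* (H ≃ₗᵢ[ℝ] H)) :
    VonNeumannAlgebra (Space Γ μ ι) :=
  vnGen (algDA μ e π ∪ Set.range (u μ))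

variable (Γ ι) in
/-- The crossed product `M = A ⋊ Γ`, as the subalgebra `(1 ⊗ A) ⋊ Γ` of `M̃`. -/
def algM : VonNeumannAlgebra (Space Γ μ ι) :=
  vnGen (Set.range (opA (Γ := Γ) μ) ∪ Set.range (u μ))

variable (Γ ι) in
/-- `L²(A)` inside `L²(M)`: the `2`-norm closure of `1 ⊗ A`. -/
def L2A : Submodule ℂ (Space Γ μ ι) :=
  (Submodule.span ℂ (Set.range fun a : Lp ℂ ∞ μ =>
    opA (Γ := Γ) (ι := ι) μ a (vacuum μ))).topologicalClosure

instance : (L2A Γ μ ι).HasOrthogonalProjection := by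
  unfold L2A; infer_instance

/-- The Fourier coefficient `(x)_g = E_A(x u_g*)` of `x` with respect to `M = A ⋊ Γ`, as a vector of
`L²(A)`: the conditional expectation `E_A` is the restriction to `M` of the orthogonal projection of
`L²(M)` onto `L²(A)`. -/
def fourierCoefficient (x : Space Γ μ ι →L[ℂ] Space Γ μ ι) (g : Γ) : Space Γ μ ι :=
  (L2A Γ μ ι).starProjection ((x * star (u (ι := ι) μ g)) (vacuum μ))

/-! ### The deformation -/

/-- `Ad w` for `w = implOp μ e b t`, which fixes `D ⊗̄ A` pointwise. -/
theorem implOp_conj_of_mem_algDA (t : ℝ) {x : Space Γ μ ι →L[ℂ] Space Γ μ ι}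
    (hx : x ∈ algDA μ e π) : implOp μ e b t * x * star (implOp μ e b t) = x := by
  have hx' := hx
  rw [algDA, ← SetLike.mem_coe, coe_vnGen] at hx'
  have hgen : ∀ (s : ℝ), ∀ y ∈ Set.range (opD μ e π) ∪ Set.range (opA μ),
      y * implOp μ e b s = implOp μ e b s * y := by
    rintro s y (⟨ξ, rfl⟩ | ⟨a, rfl⟩)
    · unfold implOp opD
      conv_lhs => enter [1]; unfold diagOmega
      conv_rhs => enter [2]; unfold diagOmega
      rw [diagOmega_comm_diag]
    · unfold implOp opA
      rw [diagOmega_comm_diag]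
  have hw : implOp μ e b t ∈
      Set.centralizer (Set.range (opD μ e π) ∪ Set.range (opA (Γ := Γ) μ) ∪
        star (Set.range (opD μ e π) ∪ Set.range (opA μ))) := by
    rintro y (hy | hy)
    · exact hgen t y hy
    · have := congrArg star (hgen (-t) _ hy)
      rw [star_mul, star_mul, star_star, star_implOp, neg_neg] at this
      exact this.symm
  have h : implOp μ e b t * x = x * implOp μ e b t := hx' _ hw
  rw [h, mul_assoc, star_implOp, implOp_mul_neg, mul_one]

theorem opD_mem_algDA (ξ : H) : opD μ e π ξ ∈ algDA μ e π :=
  subset_vnGen _ (Or.inl ⟨ξ, rfl⟩)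

theorem opA_mem_algDA (a : Lp ℂ ∞ μ) : opA μ a ∈ algDA μ e π :=
  subset_vnGen _ (Or.inr ⟨a, rfl⟩)

theorem algDA_le : algDA μ e π ≤ algMtilde μ e π :=
  fun _ hx => subset_vnGen _ (Or.inl hx)

theorem u_mem (h : Γ) : u μ h ∈ algMtilde μ e π :=
  subset_vnGen _ (Or.inr ⟨h, rfl⟩)

theorem algM_le : algM Γ μ ι ≤ algMtilde μ e π := by
  refine vnGen_le ?_
  rintro _ (⟨a, rfl⟩ | ⟨h, rfl⟩)
  · exact algDA_le μ e (opA_mem_algDA μ e a)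
  · exact u_mem μ e h

theorem implOp_conj_mem (t : ℝ) {x : Space Γ μ ι →L[ℂ] Space Γ μ ι} (hx : x ∈ algMtilde μ e π) :
    implOp μ e b t * x * star (implOp μ e b t) ∈ algMtilde μ e π := by
  refine conj_mem_of_mem_vnGen ?_ ?_ ?_ hx
  · rw [star_implOp, implOp_neg_mul]
  · rw [star_implOp, implOp_mul_neg]
  · rintro s (hs | ⟨h, rfl⟩)
    · rw [implOp_conj_of_mem_algDA μ e b t hs]
      exact algDA_le μ e hs
    · rw [implOp_conj_u]
      exact mul_mem (algDA_le μ e (opD_mem_algDA μ e _)) (u_mem μ e h)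

/-- The automorphism `α_t` of `M̃`: it is the identity on `D ⊗̄ A`
(see `deformation_of_mem_algDA`) and maps `u_g` to `(ω(t b(g)) ⊗ 1) u_g` (see `deformation_u`). -/
def deformation (t : ℝ) : algMtilde μ e π ≃⋆ₐ[ℂ] algMtilde μ e π where
  toFun x := ⟨implOp μ e b t * x * star (implOp μ e b t), implOp_conj_mem μ e b t x.2⟩
  invFun x := ⟨implOp μ e b (-t) * x * star (implOp μ e b (-t)), implOp_conj_mem μ e b (-t) x.2⟩
  left_inv x := by
    ext1
    simp only [star_implOp, neg_neg]
    calc implOp μ e b (-t) * (implOp μ e b t * x * implOp μ e b (-t)) * implOp μ e b t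
        = (implOp μ e b (-t) * implOp μ e b t) * x * (implOp μ e b (-t) * implOp μ e b t) := by
          simp only [mul_assoc]
      _ = x := by rw [implOp_neg_mul, one_mul, mul_one]
  right_inv x := by
    ext1
    simp only [star_implOp, neg_neg]
    calc implOp μ e b t * (implOp μ e b (-t) * x * implOp μ e b t) * implOp μ e b (-t)
        = (implOp μ e b t * implOp μ e b (-t)) * x * (implOp μ e b t * implOp μ e b (-t)) := by
          simp only [mul_assoc]
      _ = x := by rw [implOp_mul_neg, one_mul, mul_one]
  map_mul' x y := by
    ext1
    change implOp μ e b t * (x * y) * star (implOp μ e b t) =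
      implOp μ e b t * x * star (implOp μ e b t) * (implOp μ e b t * y * star (implOp μ e b t))
    rw [star_implOp]
    calc implOp μ e b t * (x * y) * implOp μ e b (-t)
        = implOp μ e b t * x * 1 * y * implOp μ e b (-t) := by simp only [mul_assoc, one_mul]
      _ = _ := by rw [← implOp_neg_mul μ e b t]; simp only [mul_assoc]
  map_add' x y := by
    ext1
    change implOp μ e b t * (x + y) * star (implOp μ e b t) =
      implOp μ e b t * x * star (implOp μ e b t) + implOp μ e b t * y * star (implOp μ e b t)
    rw [mul_add, add_mul]
  map_star' x := by
    ext1
    change implOp μ e b t * star (x : Space Γ μ ι →L[ℂ] Space Γ μ ι) * star (implOp μ e b t) =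
      star (implOp μ e b t * x * star (implOp μ e b t))
    rw [star_mul, star_mul, star_star, mul_assoc]
  map_smul' c x := by
    ext1
    change implOp μ e b t * (c • (x : Space Γ μ ι →L[ℂ] Space Γ μ ι)) * star (implOp μ e b t) =
      c • (implOp μ e b t * x * star (implOp μ e b t))
    rw [mul_smul_comm, smul_mul_assoc]

theorem deformation_of_mem_algDA (t : ℝ) (x : algMtilde μ e π)
    (hx : (x : Space Γ μ ι →L[ℂ] Space Γ μ ι) ∈ algDA μ e π) : deformation μ e b t x = x :=
  Subtype.ext (implOp_conj_of_mem_algDA μ e b t hx)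

theorem deformation_u (t : ℝ) (h : Γ) :
    (deformation μ e b t ⟨u μ h, u_mem μ e h⟩ : Space Γ μ ι →L[ℂ] Space Γ μ ι) =
      opD μ e π (t • b.toFun h) * u μ h :=
  implOp_conj_u μ e b t h

end Algebra

end GaussianDeformation

end

open GaussianDeformation

/-!
Let `Ω` be the vacuum and `W` the unitary implementing `α_t`, so that `W Ω = Ω`. If
`Re ⟨x Ω, W x Ω⟩ ≥ δ > 0` for all unitaries `x = exp(ih)` with `h = h* ∈ B`, then the element of
minimal norm in the closed convex hull of the operators `α_t(x) x*` is non-zero and intertwines `x`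
with `α_t(x)`, and so does the partial isometry in its polar decomposition.

Suppose that a unitary `x ∈ B` violates this bound. On the vectors of `L²(M)` the quadratic form of
`W` is the multiplier by `exp(-‖t b(g)‖²)`, so this multiplier nearly kills `x Ω`; as
`α_t(v_n) ≈ v_n`, it nearly kills `v_n x v_n* Ω` as well, and `η = v_n α_t(x) v_n*` has little mass
over a given finite subset of `Γ`. Because the Fourier coefficients of `v_n` tend to zero and `π` is
mixing, for large `n` the vector `η Ω` is close to the space `L` of the vectors that do not involve
the directions of a given finite-dimensional subspace of `H`. Compressed to `L`, the operator
`α_t(x)` is again given by the Gaussian multiplier, so that `α_t(x) η Ω` is nearly orthogonal to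
`L`. Right multiplication by `α_t(x)`, on the other hand, nearly preserves `L` away from a finite
subset of `Γ`, once more by mixing, so that `η α_t(x) Ω` is close to `L`. Both vectors are close to
the same unit vector, since `x` commutes with `v_n x v_n* ∈ B` and `α_t(v_n) ≈ v_n`.
-/

noncomputable section

namespace GaussianDeformation

section Density

variable {𝕜 E κ : Type*} [RCLike 𝕜] [NormedAddCommGroup E] [InnerProductSpace 𝕜 E]

theorem starProjection_commute_of_invariant [CompleteSpace E] {N : Submodule 𝕜 E}
    [N.HasOrthogonalProjection] {T : E →L[𝕜] E} (h : ∀ f ∈ N, T f ∈ N)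
    (h_star : ∀ f ∈ N, star T f ∈ N) :
    Commute N.starProjection T := by
  refine (ContinuousLinearMap.IsIdempotentElem.commute_iff
    (isStarProjection_starProjection (U := N)).isIdempotentElem).2 ?_
  rw [Submodule.range_starProjection, Submodule.ker_starProjection]
  exact ⟨h, ContinuousLinearMap.orthogonal_mem_invtSubmodule h_star⟩

variable (κ) in
/-- The amplification `T ↦ T ⊗ 1` of operators on `E` to operators on `E ⊗ ℓ²(κ)`, which is
encoded as the Hilbert space of families `κ → E`. -/
def amplification (T : E →L[𝕜] E) :
    PiLp 2 (fun _ : κ => E) →L[𝕜] PiLp 2 (fun _ : κ => E) :=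
  (PiLp.continuousLinearEquiv 2 𝕜 fun _ : κ => E).symm.toContinuousLinearMap ∘L
    (ContinuousLinearMap.pi fun i => T ∘L PiLp.proj 2 (fun _ : κ => E) i)

@[simp]
theorem amplification_apply (T : E →L[𝕜] E) (f : PiLp 2 (fun _ : κ => E)) (i : κ) :
    amplification κ T f i = T (f i) := rfl

theorem amplification_mem_bicommutant [Finite κ] {𝒮 : Set (E →L[𝕜] E)} {x : E →L[𝕜] E}
    (hx : x ∈ Set.centralizer (Set.centralizer 𝒮)) :
    amplification κ x ∈ Set.centralizer (Set.centralizer (amplification κ '' 𝒮)) := by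
  classical
  cases nonempty_fintype κ
  intro P hP
  let incl (j : κ) : E →L[𝕜] PiLp 2 fun _ : κ => E :=
    (PiLp.continuousLinearEquiv 2 𝕜 fun _ : κ => E).symm.toContinuousLinearMap ∘L
      ContinuousLinearMap.single 𝕜 (fun _ : κ => E) j
  have amplification_incl (T : E →L[𝕜] E) (j : κ) (k : E) :
      amplification κ T (incl j k) = incl j (T k) := by
    ext i
    exact (Pi.apply_single (fun _ => T) (fun _ => map_zero T) j k i)
  -- the matrix entries of an operator commuting with `𝒮 ⊗ 1` commute with `𝒮`
  have entry_mem (i j : κ) :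
      PiLp.proj 2 (fun _ : κ => E) i ∘L P ∘L incl j ∈ Set.centralizer 𝒮 := by
    intro a ha
    ext k
    have comm := congr($(hP _ ⟨a, ha, rfl⟩) (incl j k) i)
    change a (P (incl j k) i) = P (amplification κ a (incl j k)) i at comm
    rwa [amplification_incl] at comm
  have eq_sum (f : PiLp 2 fun _ : κ => E) : f = ∑ j, incl j (f j) := by
    ext i
    rw [WithLp.ofLp_sum]
    exact congrFun (Finset.univ_sum_single (WithLp.ofLp f)).symm i
  have comm_incl (j : κ) (k : E) :
      (P * amplification κ x) (incl j k) = (amplification κ x * P) (incl j k) := by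
    ext i
    have comm := congr($(hx _ (entry_mem i j)) k)
    change P (amplification κ x (incl j k)) i = x (P (incl j k) i)
    rw [amplification_incl]
    exact comm
  ext1 f
  rw [eq_sum f, map_sum, map_sum]
  exact Finset.sum_congr rfl fun j _ => comm_incl j (f j)

variable [CompleteSpace E]

theorem star_amplification [Fintype κ] (T : E →L[𝕜] E) :
    star (amplification κ T) = amplification κ (star T) := by
  rw [ContinuousLinearMap.star_eq_adjoint, eq_comm, ContinuousLinearMap.eq_adjoint_iff]
  intro f g
  simp only [PiLp.inner_apply, amplification_apply, ContinuousLinearMap.star_eq_adjoint,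
    ContinuousLinearMap.adjoint_inner_left]

theorem exists_forall_norm_sub_lt_of_mem_bicommutant [Finite κ] (𝒜 : StarSubalgebra 𝕜 (E →L[𝕜] E))
    {x : E →L[𝕜] E} (hx : x ∈ Set.centralizer (Set.centralizer (𝒜 : Set (E →L[𝕜] E))))
    (f : κ → E) {ε : ℝ} (hε : 0 < ε) : ∃ a ∈ 𝒜, ∀ i, ‖x (f i) - a (f i)‖ < ε := by
  cases nonempty_fintype κ
  let F : PiLp 2 (fun _ : κ => E) := WithLp.toLp 2 f
  let orbit : Submodule 𝕜 (PiLp 2 fun _ : κ => E) :=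
    { carrier := {g | ∃ a ∈ 𝒜, amplification κ a F = g}
      add_mem' := by
        rintro _ _ ⟨a, ha, rfl⟩ ⟨b, hb, rfl⟩
        exact ⟨a + b, add_mem ha hb, rfl⟩
      zero_mem' := ⟨0, zero_mem 𝒜, rfl⟩
      smul_mem' := by
        rintro c _ ⟨a, ha, rfl⟩
        exact ⟨c • a, SMulMemClass.smul_mem c ha, rfl⟩ }
  let N := orbit.topologicalClosure
  have invariant {a : E →L[𝕜] E} (ha : a ∈ 𝒜) : ∀ g ∈ N, amplification κ a g ∈ N := by
    intro g hg
    refine map_mem_closure (amplification κ a).continuous hg ?_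
    rintro _ ⟨b, hb, rfl⟩
    exact ⟨a * b, mul_mem ha hb, rfl⟩
  have projection_mem : N.starProjection ∈
      Set.centralizer (amplification κ '' (𝒜 : Set (E →L[𝕜] E))) := by
    rintro _ ⟨a, ha, rfl⟩
    refine (starProjection_commute_of_invariant (invariant ha) ?_).eq.symm
    rw [star_amplification]
    exact invariant (star_mem ha)
  have F_mem : F ∈ N := subset_closure ⟨1, one_mem 𝒜, rfl⟩
  have xF_mem : amplification κ x F ∈ N := by
    have comm := congr($(amplification_mem_bicommutant hx _ projection_mem) F)
    simp only [mul_apply_eq_comp, Submodule.starProjection_eq_self_iff.2 F_mem] at comm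
    exact comm ▸ N.starProjection_apply_mem _
  obtain ⟨_, ⟨a, ha, rfl⟩, h_dist⟩ := Metric.mem_closure_iff.1 xF_mem ε hε
  refine ⟨a, ha, fun i => lt_of_le_of_lt ?_ h_dist⟩
  rw [dist_eq_norm]
  exact PiLp.norm_apply_le (amplification κ x F - amplification κ a F) i

end Density

section PolarDecomposition

variable {E : Type*} [NormedAddCommGroup E] [InnerProductSpace ℂ E] [CompleteSpace E]

theorem norm_abs_apply (w : E →L[ℂ] E) (f : E) : ‖CFC.abs w f‖ = ‖w f‖ := by
  have abs_selfAdjoint : star (CFC.abs w) = CFC.abs w := (CFC.abs_nonneg w).isSelfAdjoint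
  have h_inner : inner ℂ (CFC.abs w f) (CFC.abs w f) = inner ℂ (w f) (w f) := by
    rw [← ContinuousLinearMap.adjoint_inner_right, ← ContinuousLinearMap.adjoint_inner_right w,
      ← ContinuousLinearMap.star_eq_adjoint, ← ContinuousLinearMap.star_eq_adjoint,
      abs_selfAdjoint]
    exact congr(inner ℂ f ($(CFC.abs_mul_abs w) f))
  rw [norm_eq_sqrt_re_inner (𝕜 := ℂ), h_inner, ← norm_eq_sqrt_re_inner]

/-- The closure of the range of `|w|`, i.e. the orthogonal complement of the kernel of `w`. -/
def initialSpace (w : E →L[ℂ] E) : Submodule ℂ E :=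
  (CFC.abs w).range.topologicalClosure

instance (w : E →L[ℂ] E) : (initialSpace w).HasOrthogonalProjection := by
  unfold initialSpace; infer_instance

theorem abs_apply_mem_initialSpace (w : E →L[ℂ] E) (f : E) : CFC.abs w f ∈ initialSpace w :=
  subset_closure ⟨f, rfl⟩

theorem denseRange_abs_codRestrict (w : E →L[ℂ] E) :
    DenseRange ((CFC.abs w).toLinearMap.codRestrict _ (abs_apply_mem_initialSpace w)) := by
  intro r
  rw [closure_subtype]
  refine closure_mono ?_ r.2
  rintro _ ⟨f, rfl⟩
  exact ⟨_, ⟨f, rfl⟩, rfl⟩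

/-- The partial isometry `v` of the polar decomposition `w = v |w|`. It vanishes on the kernel
of `w`. -/
def polarPart (w : E →L[ℂ] E) : E →L[ℂ] E :=
  w.toLinearMap.extendOfNorm
      ((CFC.abs w).toLinearMap.codRestrict _ (abs_apply_mem_initialSpace w)) ∘L
    (initialSpace w).orthogonalProjectionOnto

theorem polarPart_abs_apply (w : E →L[ℂ] E) (f : E) : polarPart w (CFC.abs w f) = w f := by
  have h_proj := Submodule.orthogonalProjectionOnto_mem_subspace_eq_self
    (⟨_, abs_apply_mem_initialSpace w f⟩ : initialSpace w)
  rw [polarPart, ContinuousLinearMap.comp_apply, h_proj]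
  refine LinearMap.extendOfNorm_eq (denseRange_abs_codRestrict w) ⟨1, fun k => ?_⟩ f
  rw [one_mul]
  exact (norm_abs_apply w k).ge

theorem polarPart_starProjection (w : E →L[ℂ] E) (f : E) :
    polarPart w ((initialSpace w).starProjection f) = polarPart w f := by
  simp only [polarPart, Submodule.starProjection_apply, ContinuousLinearMap.comp_apply,
    Submodule.orthogonalProjectionOnto_mem_subspace_eq_self]

theorem norm_polarPart_apply (w : E →L[ℂ] E) (f : E) :
    ‖polarPart w f‖ = ‖(initialSpace w).starProjection f‖ := by
  rw [← polarPart_starProjection]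
  refine closure_minimal (t := {r | ‖polarPart w r‖ = ‖r‖}) ?_
    (isClosed_eq (by fun_prop) (by fun_prop)) ((initialSpace w).starProjection_apply_mem f)
  rintro _ ⟨k, rfl⟩
  exact (congrArg norm (polarPart_abs_apply w k)).trans (norm_abs_apply w k).symm

theorem star_polarPart_mul_self (w : E →L[ℂ] E) :
    star (polarPart w) * polarPart w = (initialSpace w).starProjection := by
  refine ContinuousLinearMap.coe_injective ((ext_inner_map _ _).1 fun f => ?_)
  change inner ℂ (star (polarPart w) (polarPart w f)) f = inner ℂ (Submodule.starProjection _ f) f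
  rw [ContinuousLinearMap.star_eq_adjoint, ContinuousLinearMap.adjoint_inner_left,
    inner_self_eq_norm_sq_to_K, norm_polarPart_apply, ← inner_self_eq_norm_sq_to_K (𝕜 := ℂ),
    ← Submodule.inner_starProjection_left_eq_right,
    Submodule.starProjection_eq_self_iff.2 (Submodule.starProjection_apply_mem _ f)]

theorem isStarProjection_star_polarPart_mul_self (w : E →L[ℂ] E) :
    IsStarProjection (star (polarPart w) * polarPart w) :=
  star_polarPart_mul_self w ▸ isStarProjection_starProjection

theorem polarPart_ne_zero {w : E →L[ℂ] E} (hw : w ≠ 0) : polarPart w ≠ 0 := by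
  intro h
  refine hw (ContinuousLinearMap.ext fun f => ?_)
  rw [← polarPart_abs_apply, h]
  rfl

theorem apply_mem_initialSpace_of_commute {w z : E →L[ℂ] E} (h : Commute (CFC.abs w) z) :
    ∀ r ∈ initialSpace w, z r ∈ initialSpace w := by
  intro r hr
  refine map_mem_closure z.continuous hr ?_
  rintro _ ⟨f, rfl⟩
  exact ⟨z f, congr($h.eq f)⟩

theorem polarPart_intertwines {w x y : E →L[ℂ] E} (h : y * w = w * x)
    (h_star : star y * w = w * star x) : y * polarPart w = polarPart w * x := by
  have h_starMul : star w * y = x * star w := by simpa using congrArg star h_star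
  have abs_comm : Commute (CFC.abs w) x := by
    have h_comm : Commute (star w * w) x := by
      rw [Commute, SemiconjBy, mul_assoc, ← h, ← mul_assoc, h_starMul, mul_assoc]
    rw [CFC.abs, CFC.sqrt]
    exact h_comm.cfcₙ_nnreal _
  have abs_comm_star : Commute (CFC.abs w) (star x) := by
    have := abs_comm.star_star
    rwa [(CFC.abs_nonneg w).isSelfAdjoint.star_eq] at this
  have proj_comm (f : E) : (initialSpace w).starProjection (x f) =
      x ((initialSpace w).starProjection f) :=
    congr($(starProjection_commute_of_invariant (apply_mem_initialSpace_of_commute abs_comm)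
      (apply_mem_initialSpace_of_commute abs_comm_star)) f)
  have h_initial : ∀ r ∈ initialSpace w, y (polarPart w r) = polarPart w (x r) := by
    intro r hr
    refine closure_minimal (t := {r | y (polarPart w r) = polarPart w (x r)}) ?_
      (isClosed_eq (by fun_prop) (by fun_prop)) hr
    rintro _ ⟨f, rfl⟩
    have h_abs : x (CFC.abs w f) = CFC.abs w (x f) := congr($abs_comm.symm.eq f)
    change y (polarPart w (CFC.abs w f)) = polarPart w (x (CFC.abs w f))
    rw [h_abs, polarPart_abs_apply, polarPart_abs_apply]
    exact congr($h f)
  ext1 f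
  change y (polarPart w f) = polarPart w (x f)
  rw [← polarPart_starProjection w f, ← polarPart_starProjection w (x f), proj_comm,
    h_initial _ (Submodule.starProjection_apply_mem _ f)]

theorem mem_iff_commute_commutant {N : VonNeumannAlgebra E} {x : E →L[ℂ] E} :
    x ∈ N ↔ ∀ z ∈ N.commutant, z * x = x * z := by
  rw [← VonNeumannAlgebra.mem_commutant_iff, VonNeumannAlgebra.commutant_commutant]

theorem polarPart_mem {N : VonNeumannAlgebra E} {w : E →L[ℂ] E} (hw : w ∈ N) :
    polarPart w ∈ N := by
  rw [mem_iff_commute_commutant] at hw ⊢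
  exact fun z hz => polarPart_intertwines (hw z hz) (hw _ (star_mem hz))

end PolarDecomposition

section GaussianIntegral

variable {ι : Type*}

theorem map_const_mul_coord (c : ℝ) (i : ι) :
    (gaussianMeasure ι).map (fun z => c * z i) =
      gaussianReal 0 (NNReal.mk (c ^ 2) (sq_nonneg c)) := by
  have map_coord : (gaussianMeasure ι).map (fun z => z i) = gaussianReal 0 1 :=
    (measurePreserving_eval_infinitePi (fun _ : ι => gaussianReal 0 1) i).map_eq
  have map_const_mul : (gaussianReal 0 1).map (fun x => c * x) = _ := gaussianReal_map_const_mul c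
  rwa [← map_coord, Measure.map_map (by fun_prop) (by fun_prop), mul_zero, mul_one]
    at map_const_mul

theorem charFun_map_sum_const_mul_coord (c : ι → ℝ) (s : Finset ι) (r : ℝ) :
    charFun ((gaussianMeasure ι).map (∑ i ∈ s, fun z : ι → ℝ => c i * z i)) r =
      (Real.exp (-(r ^ 2 / 2) * ∑ i ∈ s, c i ^ 2) : ℂ) := by
  have indep : iIndepFun (fun (i : ι) (z : ι → ℝ) => c i * z i) (gaussianMeasure ι) :=
    iIndepFun_infinitePi (P := fun _ : ι => gaussianReal 0 1) (X := fun i (x : ℝ) => c i * x)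
      (fun i => by fun_prop)
  have charFun_eq := iIndepFun.charFun_map_finsetSum_eq_prod (s := s) (P := gaussianMeasure ι)
    (X := fun (i : ι) (z : ι → ℝ) => c i * z i)
    (fun i _ => (by fun_prop : Measurable fun z : ι → ℝ => c i * z i).aemeasurable)
    (indep.precomp (g := ((↑) : s → ι)) Subtype.val_injective)
  rw [charFun_eq, Finset.prod_apply, Finset.mul_sum, Real.exp_sum, Complex.ofReal_prod]
  refine Finset.prod_congr rfl fun i _ => ?_
  rw [map_const_mul_coord, charFun_gaussianReal, Complex.ofReal_exp]
  congr 1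
  simp only [Complex.ofReal_zero, mul_zero, zero_mul, zero_sub, NNReal.coe_mk]
  push_cast
  ring

variable {H : Type*} [NormedAddCommGroup H] [InnerProductSpace ℝ H] (e : HilbertBasis ι ℝ H)

theorem coeFn_field_sum (c : ι → ℝ) (s : Finset ι) :
    field e (∑ i ∈ s, c i • e i) =ᵐ[gaussianMeasure ι] fun z => ∑ i ∈ s, c i * z i := by
  have coeFn_sum : ⇑(∑ i ∈ s, field e (c i • e i)) =ᵐ[gaussianMeasure ι]
      ∑ i ∈ s, ⇑(field e (c i • e i)) := Lp.coeFn_finsetSum _ _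
  have coeFn_summand : ∀ᵐ z ∂gaussianMeasure ι, ∀ i ∈ s, field e (c i • e i) z = c i * z i := by
    rw [s.eventually_all]
    intro i _
    rw [map_smul, field_basis]
    filter_upwards [Lp.coeFn_smul (c i) (coord i), (memLp_coord i).coeFn_toLp] with z h_smul h_coord
    rw [h_smul, Pi.smul_apply, coord, h_coord, smul_eq_mul]
  rw [map_sum]
  filter_upwards [coeFn_sum, coeFn_summand] with z h_sum h_summand
  rw [h_sum, Finset.sum_apply]
  exact Finset.sum_congr rfl h_summand

theorem integral_omegaFun_sum (c : ι → ℝ) (s : Finset ι) :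
    ∫ z, omegaFun e (∑ i ∈ s, c i • e i) z ∂gaussianMeasure ι =
      (Real.exp (-‖∑ i ∈ s, c i • e i‖ ^ 2) : ℂ) := by
  have norm_sq : ‖∑ i ∈ s, c i • e i‖ ^ 2 = ∑ i ∈ s, c i ^ 2 := by
    rw [← real_inner_self_eq_norm_sq, e.orthonormal.inner_sum]
    simp [pow_two]
  calc ∫ z, omegaFun e (∑ i ∈ s, c i • e i) z ∂gaussianMeasure ι
      = charFun ((gaussianMeasure ι).map (∑ i ∈ s, fun z : ι → ℝ => c i * z i)) √2 := by
        rw [charFun_apply_real, integral_map (by fun_prop) (by fun_prop)]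
        refine integral_congr_ae ?_
        filter_upwards [coeFn_field_sum e c s] with z hz
        rw [omegaFun, hz]
        simp
    _ = _ := by
        rw [charFun_map_sum_const_mul_coord, Real.sq_sqrt zero_le_two, norm_sq]
        norm_num

theorem norm_omegaFun_sub_le (ξ η : H) :
    ∀ᵐ z ∂gaussianMeasure ι,
      ‖omegaFun e ξ z - omegaFun e η z‖ ≤ √2 * ‖field e (ξ - η) z‖ := by
  rw [map_sub]
  filter_upwards [Lp.coeFn_sub (field e ξ) (field e η)] with z hz
  have factor : omegaFun e ξ z - omegaFun e η z = omegaFun e η z *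
      (Complex.exp (Complex.I * ((√2 * (field e ξ z - field e η z) : ℝ) : ℂ)) - 1) := by
    rw [mul_sub, mul_one, omegaFun, omegaFun, ← Complex.exp_add]
    congr 2
    push_cast
    ring
  rw [hz, Pi.sub_apply, factor, norm_mul, norm_omegaFun, one_mul]
  refine Real.norm_exp_I_mul_ofReal_sub_one_le.trans_eq ?_
  rw [norm_mul, Real.norm_of_nonneg (Real.sqrt_nonneg 2)]

theorem norm_integral_omegaFun_sub_le (ξ η : H) :
    ‖(∫ z, omegaFun e ξ z ∂gaussianMeasure ι) - ∫ z, omegaFun e η z ∂gaussianMeasure ι‖ ≤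
      √2 * ‖ξ - η‖ := by
  have integrable_omegaFun (ζ : H) : Integrable (omegaFun e ζ) (gaussianMeasure ι) :=
    (memLp_omegaFun e ζ).integrable le_top
  have integrable_field : Integrable (field e (ξ - η)) (gaussianMeasure ι) :=
    (Lp.memLp (field e (ξ - η))).integrable one_le_two
  rw [← integral_sub (integrable_omegaFun ξ) (integrable_omegaFun η)]
  calc _ ≤ ∫ z, ‖omegaFun e ξ z - omegaFun e η z‖ ∂gaussianMeasure ι :=
        norm_integral_le_integral_norm _
    _ ≤ ∫ z, √2 * ‖field e (ξ - η) z‖ ∂gaussianMeasure ι :=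
        integral_mono_ae ((integrable_omegaFun ξ).sub (integrable_omegaFun η)).norm
          (integrable_field.norm.const_mul _) (norm_omegaFun_sub_le e ξ η)
    _ = √2 * ∫ z, ‖field e (ξ - η) z‖ ∂gaussianMeasure ι := integral_const_mul _ _
    _ ≤ √2 * ‖ξ - η‖ := by
        gcongr
        rw [← (field e).norm_map (ξ - η), Lp.norm_def,
          integral_norm_eq_lintegral_enorm integrable_field.aestronglyMeasurable,
          ← eLpNorm_one_eq_lintegral_enorm]
        exact ENNReal.toReal_mono (Lp.eLpNorm_ne_top _)
          (eLpNorm_le_eLpNorm_of_exponent_le one_le_two integrable_field.aestronglyMeasurable)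

theorem integral_omegaFun (ξ : H) :
    ∫ z, omegaFun e ξ z ∂gaussianMeasure ι = (Real.exp (-‖ξ‖ ^ 2) : ℂ) := by
  have continuous_integral : Continuous fun η => ∫ z, omegaFun e η z ∂gaussianMeasure ι := by
    refine (LipschitzWith.of_dist_le_mul (K := (√2).toNNReal) fun ξ η => ?_).continuous
    rw [dist_eq_norm, dist_eq_norm, Real.coe_toNNReal _ (Real.sqrt_nonneg 2)]
    exact norm_integral_omegaFun_sub_le e ξ η
  have continuous_exp : Continuous fun η : H => (Real.exp (-‖η‖ ^ 2) : ℂ) := by fun_prop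
  have h_sum : Tendsto (fun s : Finset ι => ∑ i ∈ s, e.repr ξ i • e i) atTop (𝓝 ξ) :=
    e.hasSum_repr ξ
  exact tendsto_nhds_unique ((continuous_integral.tendsto ξ).comp h_sum)
    (((continuous_exp.tendsto ξ).comp h_sum).congr fun s => (integral_omegaFun_sum e _ s).symm)

theorem integral_star_omegaFun_mul (ξ η : H) :
    ∫ z, star (omegaFun e ξ z) * omegaFun e η z ∂gaussianMeasure ι =
      (Real.exp (-‖ξ - η‖ ^ 2) : ℂ) := by
  rw [norm_sub_rev, ← integral_omegaFun e (η - ξ)]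
  refine integral_congr_ae ?_
  filter_upwards [omegaFun_add e (-ξ) η, omegaFun_neg e ξ] with z h_add h_neg
  rw [sub_eq_neg_add, h_add, h_neg]

end GaussianIntegral

section MultiplicationOperators

variable {S : Type*} [MeasurableSpace S] {m : Measure S}

/-- The product of two elements of `L^∞`. -/
def mulLinf (a b : Lp ℂ ∞ m) : Lp ℂ ∞ m := (ContinuousLinearMap.mul ℂ ℂ).holder ∞ a b

theorem coeFn_mulLinf (a b : Lp ℂ ∞ m) : mulLinf a b =ᵐ[m] fun s => a s * b s :=
  (ContinuousLinearMap.mul ℂ ℂ).coeFn_holder a b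

theorem mulOp_mul (a b : Lp ℂ ∞ m) : mulOp a * mulOp b = mulOp (mulLinf a b) := by
  ext1 f
  refine Lp.ext ?_
  filter_upwards [coeFn_mulOp a (mulOp b f), coeFn_mulOp b f, coeFn_mulOp (mulLinf a b) f,
    coeFn_mulLinf a b] with s h_abf h_bf h_mulf h_mul
  change mulOp a (mulOp b f) s = _
  rw [h_abf, h_bf, h_mulf, h_mul, mul_assoc]

theorem norm_star_Linf (a : Lp ℂ ∞ m) : ‖star a‖ = ‖a‖ := by
  have norm_ae_eq : ∀ᵐ s ∂m, ‖star a s‖ = ‖a s‖ := by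
    filter_upwards [Lp.coeFn_star a] with s hs
    rw [hs, Pi.star_apply, norm_star]
  exact le_antisymm (Lp.norm_le_norm_of_ae_le (norm_ae_eq.mono fun _ hs => hs.le))
    (Lp.norm_le_norm_of_ae_le (norm_ae_eq.mono fun _ hs => hs.ge))

theorem star_mulOp (a : Lp ℂ ∞ m) : star (mulOp a) = mulOp (star a) := by
  rw [ContinuousLinearMap.star_eq_adjoint, eq_comm, ContinuousLinearMap.eq_adjoint_iff]
  intro f k
  rw [L2.inner_def, L2.inner_def]
  refine integral_congr_ae ?_
  filter_upwards [coeFn_mulOp (star a) f, coeFn_mulOp a k, Lp.coeFn_star a] with s h_f h_k h_star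
  rw [h_f, h_k, h_star]
  simp only [RCLike.inner_apply, map_mul, Pi.star_apply, Complex.star_def, Complex.conj_conj]
  ring

/-- The constant function `1` in `L^∞`. -/
def oneLinf (m : Measure S) [IsFiniteMeasure m] : Lp ℂ ∞ m := (memLp_const (1 : ℂ)).toLp _

theorem coeFn_oneLinf [IsFiniteMeasure m] : oneLinf m =ᵐ[m] fun _ => 1 :=
  (memLp_const (1 : ℂ)).coeFn_toLp

theorem mulOp_one [IsFiniteMeasure m] : mulOp (oneLinf m) = 1 := by
  ext1 f
  refine Lp.ext ?_
  filter_upwards [coeFn_mulOp (oneLinf m) f, coeFn_oneLinf (m := m)] with s h_mul h_one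
  change mulOp (oneLinf m) f s = f s
  rw [h_mul, h_one, one_mul]

variable {S' : Type*} [MeasurableSpace S'] {m' : Measure S'} {φ : S → S'}

theorem compMeasurePreserving_mulLinf (hφ : MeasurePreserving φ m m') (a b : Lp ℂ ∞ m') :
    Lp.compMeasurePreserving φ hφ (mulLinf a b) =
      mulLinf (Lp.compMeasurePreserving φ hφ a) (Lp.compMeasurePreserving φ hφ b) := by
  refine Lp.ext ?_
  filter_upwards [Lp.coeFn_compMeasurePreserving (mulLinf a b) hφ,
    Lp.coeFn_compMeasurePreserving a hφ, Lp.coeFn_compMeasurePreserving b hφ,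
    coeFn_mulLinf (Lp.compMeasurePreserving φ hφ a) (Lp.compMeasurePreserving φ hφ b),
    hφ.quasiMeasurePreserving.ae (coeFn_mulLinf a b)] with s h_left h_a h_b h_right h_mul
  rw [h_left, h_right, h_a, h_b]
  exact h_mul

theorem compMeasurePreserving_star (hφ : MeasurePreserving φ m m') (a : Lp ℂ ∞ m') :
    Lp.compMeasurePreserving φ hφ (star a) = star (Lp.compMeasurePreserving φ hφ a) := by
  refine Lp.ext ?_
  filter_upwards [Lp.coeFn_compMeasurePreserving (star a) hφ,
    Lp.coeFn_compMeasurePreserving a hφ, Lp.coeFn_star (Lp.compMeasurePreserving φ hφ a),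
    hφ.quasiMeasurePreserving.ae (Lp.coeFn_star a)] with s h_left h_a h_right h_star
  rw [h_left, h_right, Pi.star_apply, h_a]
  exact h_star

theorem compMeasurePreserving_one [IsFiniteMeasure m] [IsFiniteMeasure m']
    (hφ : MeasurePreserving φ m m') :
    Lp.compMeasurePreserving φ hφ (oneLinf m') = oneLinf m := by
  refine Lp.ext ?_
  filter_upwards [Lp.coeFn_compMeasurePreserving (oneLinf m') hφ, coeFn_oneLinf (m := m),
    hφ.quasiMeasurePreserving.ae (coeFn_oneLinf (m := m'))] with s h_left h_right h_one
  rw [h_left, h_right]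
  exact h_one

end MultiplicationOperators

section CanonicalOperators

variable {Γ X ι H : Type*} [MeasurableSpace X] (μ : Measure X)

section CanonicalUnitaries

variable [Group Γ]

theorem u_one : u (Γ := Γ) (ι := ι) μ 1 = 1 := by
  ext f g : 3
  change f (1⁻¹ * g) = f g
  rw [inv_one, one_mul]

theorem star_u [IsProbabilityMeasure μ] (h : Γ) : star (u (ι := ι) μ h) = u μ h⁻¹ := by
  have isometry : star (u (ι := ι) μ h) * u μ h = 1 := by
    ext1 f
    refine ext_inner_left ℂ fun k => ?_
    change inner ℂ k (star (u μ h) (u μ h f)) = inner ℂ k f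
    rw [ContinuousLinearMap.star_eq_adjoint, ContinuousLinearMap.adjoint_inner_right]
    exact (shift μ h).inner_map_map k f
  calc star (u (ι := ι) μ h) = star (u μ h) * (u μ h * u μ h⁻¹) := by
        rw [u_mul, mul_inv_cancel, u_one, mul_one]
    _ = u μ h⁻¹ := by rw [← mul_assoc, isometry, one_mul]

variable [MulAction Γ X] [MeasurableConstSMul Γ X] [SMulInvariantMeasure Γ X μ]

theorem coeFn_translate (g : Γ) (a : Lp ℂ ∞ μ) : translate μ g a =ᵐ[μ] fun x => a (g⁻¹ • x) :=
  Lp.coeFn_compMeasurePreserving a (measurePreserving_smul g⁻¹ μ)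

theorem integral_star_translate_mul_translate (g : Γ) (a b : Lp ℂ ∞ μ) :
    ∫ x, star (translate μ g a x) * translate μ g b x ∂μ = ∫ x, star (a x) * b x ∂μ := by
  rw [← integral_smul_eq_self (fun x => star (a x) * b x) (g := g⁻¹)]
  refine integral_congr_ae ?_
  filter_upwards [coeFn_translate μ g a, coeFn_translate μ g b] with x ha hb
  rw [ha, hb]

end CanonicalUnitaries

variable [IsProbabilityMeasure μ]

theorem star_diag (a : Γ → Lp ℂ ∞ ((gaussianMeasure ι).prod μ)) (C : ℝ) (hC : 0 ≤ C)
    (ha : ∀ g, ‖a g‖ ≤ C) :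
    star (diag μ a C hC ha) =
      diag μ (fun g => star (a g)) C hC (fun g => (norm_star_Linf (a g)).trans_le (ha g)) := by
  rw [ContinuousLinearMap.star_eq_adjoint, eq_comm, ContinuousLinearMap.eq_adjoint_iff]
  intro f k
  rw [lp.inner_eq_tsum, lp.inner_eq_tsum]
  congr 1
  funext g
  rw [diag_apply, diag_apply, ← star_mulOp, ContinuousLinearMap.star_eq_adjoint,
    ContinuousLinearMap.adjoint_inner_left]

open scoped Classical in
theorem diag_single (a : Γ → Lp ℂ ∞ ((gaussianMeasure ι).prod μ)) (C : ℝ) (hC : 0 ≤ C)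
    (ha : ∀ g, ‖a g‖ ≤ C) (g : Γ) (f : Base μ ι) :
    diag μ a C hC ha (lp.single 2 g f) = lp.single 2 g (mulOp (a g) f) := by
  ext1
  funext k
  rw [diag_apply]
  by_cases h : k = g
  · subst h
    rw [lp.single_apply_self, lp.single_apply_self]
  · rw [lp.single_apply_ne _ _ _ h, lp.single_apply_ne _ _ _ h, map_zero]

/-- The constant function `1` as a vector of `L²(Z × X)`. -/
def oneVec (ι : Type*) : Base μ ι := (memLp_const (1 : ℂ)).toLp _

theorem coeFn_oneVec : oneVec μ ι =ᵐ[(gaussianMeasure ι).prod μ] fun _ => 1 :=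
  (memLp_const (1 : ℂ)).coeFn_toLp

open scoped Classical in
theorem u_vacuum [Group Γ] (g : Γ) : u μ g (vacuum μ) = lp.single 2 g (oneVec μ ι) := by
  ext1
  funext k
  change (lp.single (E := fun _ : Γ => Base μ ι) 2 (1 : Γ) (oneVec μ ι)) (g⁻¹ * k) = _
  by_cases h : k = g
  · subst h
    rw [inv_mul_cancel, lp.single_apply_self, lp.single_apply_self]
  · rw [lp.single_apply_ne _ _ _ h, lp.single_apply_ne]
    rwa [Ne, inv_mul_eq_one, eq_comm]

variable [NormedAddCommGroup H] [InnerProductSpace ℝ H] (e : HilbertBasis ι ℝ H)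

/-- The vector `ω(ζ) ⊗ c` of `L²(Z × X)`. -/
def baseVec (ζ : H) (c : Lp ℂ ∞ μ) : Base μ ι :=
  mulOp (tensorOne μ (omega e ζ)) (mulOp (oneTensor μ ι c) (oneVec μ ι))

theorem coeFn_tensorOne_omega (ζ : H) :
    tensorOne μ (omega e ζ) =ᵐ[(gaussianMeasure ι).prod μ] fun p => omegaFun e ζ p.1 :=
  (Lp.coeFn_compMeasurePreserving (omega e ζ) measurePreserving_fst).trans
    (Measure.quasiMeasurePreserving_fst.ae_eq_comp (coeFn_omega e ζ))

theorem coeFn_baseVec (ζ : H) (c : Lp ℂ ∞ μ) :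
    baseVec μ e ζ c =ᵐ[(gaussianMeasure ι).prod μ] fun p => omegaFun e ζ p.1 * c p.2 := by
  filter_upwards [coeFn_mulOp (tensorOne μ (omega e ζ)) (mulOp (oneTensor μ ι c) (oneVec μ ι)),
    coeFn_mulOp (oneTensor μ ι c) (oneVec μ ι), coeFn_oneVec μ (ι := ι),
    coeFn_tensorOne_omega μ e ζ, Lp.coeFn_compMeasurePreserving c
      (measurePreserving_snd (μ := gaussianMeasure ι) (ν := μ))]
    with p h_omega h_c h_one h_fst h_snd
  rw [baseVec, h_omega, h_c, h_one, h_fst, mul_one]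
  exact congrArg (_ * ·) h_snd

theorem inner_baseVec (ζ ζ' : H) (c c' : Lp ℂ ∞ μ) :
    inner ℂ (baseVec μ e ζ c) (baseVec μ e ζ' c') =
      (Real.exp (-‖ζ - ζ'‖ ^ 2) : ℂ) * ∫ x, star (c x) * c' x ∂μ := by
  rw [L2.inner_def, ← integral_star_omegaFun_mul e, ← integral_prod_mul]
  refine integral_congr_ae ?_
  filter_upwards [coeFn_baseVec μ e ζ c, coeFn_baseVec μ e ζ' c'] with p hp hp'
  rw [hp, hp']
  simp only [RCLike.inner_apply, map_mul, Complex.star_def]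
  ring

variable [Group Γ] (π : Γ →* (H ≃ₗᵢ[ℝ] H))

theorem opD_zero : opD μ e π 0 = 1 := by
  rw [opD, ← diagOmega_zero μ e]
  simp only [map_zero]
  rfl

theorem opD_mul (ξ η : H) : opD μ e π ξ * opD μ e π η = opD μ e π (ξ + η) := by
  rw [opD, opD, diagOmega_mul, opD]
  simp only [map_add]
  rfl

theorem star_opD (ξ : H) : star (opD μ e π ξ) = opD μ e π (-ξ) := by
  rw [opD, star_diagOmega, opD]
  simp only [map_neg]
  rfl

theorem apply_inv_apply (g : Γ) (ξ : H) : π g (π g⁻¹ ξ) = ξ := by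
  rw [← Function.comp_apply (f := π g) (g := π g⁻¹), ← LinearIsometryEquiv.coe_mul, ← map_mul,
    mul_inv_cancel, map_one]
  rfl

theorem inv_apply_apply (g : Γ) (ξ : H) : π g⁻¹ (π g ξ) = ξ := by
  simpa only [inv_inv] using apply_inv_apply π g⁻¹ ξ

variable [MulAction Γ X] [MeasurableConstSMul Γ X] [SMulInvariantMeasure Γ X μ]

theorem opA_apply (a : Lp ℂ ∞ μ) (f : Space Γ μ ι) (g : Γ) :
    opA μ a f g = mulOp (oneTensor μ ι (translate μ g⁻¹ a)) (f g) := rfl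

theorem opA_mul (a b : Lp ℂ ∞ μ) :
    opA (Γ := Γ) (ι := ι) μ a * opA μ b = opA μ (mulLinf a b) := by
  ext f g : 3
  change opA μ a (opA μ b f) g = opA μ (mulLinf a b) f g
  simp only [opA_apply, translate, oneTensor, compMeasurePreserving_mulLinf, ← mulOp_mul]
  rfl

theorem star_opA (a : Lp ℂ ∞ μ) : star (opA (Γ := Γ) (ι := ι) μ a) = opA μ (star a) := by
  rw [opA, star_diag]
  ext f g : 3
  simp only [diag_apply, opA_apply, translate, oneTensor, compMeasurePreserving_star]

theorem opA_one : opA (Γ := Γ) (ι := ι) μ (oneLinf μ) = 1 := by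
  ext f g : 3
  simp only [opA_apply, translate, oneTensor, compMeasurePreserving_one, mulOp_one]
  rfl

theorem opD_comm_opA (ξ : H) (a : Lp ℂ ∞ μ) :
    opD μ e π ξ * opA μ a = opA μ a * opD μ e π ξ :=
  diagOmega_comm_diag μ e _ _ _ _ _

/-- The elementary operators `(ω(ξ) ⊗ a) u_g`. -/
def gen (ξ : H) (a : Lp ℂ ∞ μ) (g : Γ) : Space Γ μ ι →L[ℂ] Space Γ μ ι :=
  opD μ e π ξ * opA μ a * u μ g

theorem gen_mul (ξ ξ' : H) (a a' : Lp ℂ ∞ μ) (g g' : Γ) :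
    gen μ e π ξ a g * gen μ e π ξ' a' g' =
      gen μ e π (ξ + π g ξ') (mulLinf a (translate μ g a')) (g * g') := by
  unfold gen
  calc opD μ e π ξ * opA μ a * u μ g * (opD μ e π ξ' * opA μ a' * u μ g')
      = opD μ e π ξ * opA μ a * (u μ g * opD μ e π ξ') * opA μ a' * u μ g' := by
        simp only [mul_assoc]
    _ = opD μ e π ξ * (opA μ a * opD μ e π (π g ξ')) * (u μ g * opA μ a') * u μ g' := by
        rw [u_mul_opD]; simp only [mul_assoc]
    _ = (opD μ e π ξ * opD μ e π (π g ξ')) * (opA μ a * opA μ (translate μ g a')) *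
          (u μ g * u μ g') := by
        rw [u_mul_opA, ← opD_comm_opA]; simp only [mul_assoc]
    _ = _ := by rw [opD_mul, opA_mul, u_mul]

theorem star_gen (ξ : H) (a : Lp ℂ ∞ μ) (g : Γ) :
    star (gen μ e π ξ a g) = gen μ e π (-(π g⁻¹ ξ)) (translate μ g⁻¹ (star a)) g⁻¹ := by
  unfold gen
  rw [star_mul, star_mul, star_u, star_opA, star_opD, ← opD_comm_opA, ← mul_assoc, u_mul_opD,
    mul_assoc, u_mul_opA, ← mul_assoc, map_neg]

theorem gen_one : gen μ e π 0 (oneLinf μ) 1 = 1 := by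
  rw [gen, opD_zero, opA_one, u_one, mul_one, mul_one]

open scoped Classical in
theorem gen_vacuum (ξ : H) (a : Lp ℂ ∞ μ) (g : Γ) :
    gen μ e π ξ a g (vacuum μ) =
      lp.single 2 g (baseVec μ e (π g⁻¹ ξ) (translate μ g⁻¹ a)) := by
  change opD μ e π ξ (opA μ a (u μ g (vacuum μ))) = _
  rw [u_vacuum, opA, diag_single, opD, diagOmega, diag_single, baseVec]

theorem inner_gen_of_ne (ξ ξ' : H) (a a' : Lp ℂ ∞ μ) {g g' : Γ} (h : g ≠ g') :
    inner ℂ (gen μ e π ξ a g (vacuum μ)) (gen μ e π ξ' a' g' (vacuum μ)) = 0 := by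
  classical
  rw [gen_vacuum, gen_vacuum, lp.inner_single_left, lp.single_apply_ne _ _ _ h, inner_zero_right]

theorem inner_gen_same (ξ ξ' : H) (a a' : Lp ℂ ∞ μ) (g : Γ) :
    inner ℂ (gen μ e π ξ a g (vacuum μ)) (gen μ e π ξ' a' g (vacuum μ)) =
      (Real.exp (-‖ξ - ξ'‖ ^ 2) : ℂ) * ∫ x, star (a x) * a' x ∂μ := by
  classical
  rw [gen_vacuum, gen_vacuum, lp.inner_single_left, lp.single_apply_self, inner_baseVec,
    integral_star_translate_mul_translate, ← map_sub, LinearIsometryEquiv.norm_map]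

end CanonicalOperators

section TraceVector

variable {E : Type*} [NormedAddCommGroup E] [InnerProductSpace ℂ E]

theorem norm_apply_of_star_mul_self_eq_one [CompleteSpace E] {x : E →L[ℂ] E} (hx : star x * x = 1)
    (f : E) : ‖x f‖ = ‖f‖ := by
  have h_inner : inner ℂ (x f) (x f) = inner ℂ f f := by
    rw [← ContinuousLinearMap.adjoint_inner_right, ← ContinuousLinearMap.star_eq_adjoint]
    exact congrArg (inner ℂ f) congr($hx f)
  rw [norm_eq_sqrt_re_inner (𝕜 := ℂ), h_inner, ← norm_eq_sqrt_re_inner]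

theorem inner_mul_comm_of_forall_exists_approx {Ω : E} {x y : E →L[ℂ] E}
    (h : ∀ ε > 0, ∃ a : E →L[ℂ] E, inner ℂ Ω (a (y Ω)) = inner ℂ Ω (y (a Ω)) ∧
      ‖x (y Ω) - a (y Ω)‖ < ε ∧ ‖x Ω - a Ω‖ < ε) :
    inner ℂ Ω (x (y Ω)) = inner ℂ Ω (y (x Ω)) := by
  rw [← sub_eq_zero, ← norm_le_zero_iff]
  set K := ‖Ω‖ * (1 + ‖y‖) with hK
  refine le_of_forall_pos_le_add fun ε hε => ?_
  obtain ⟨a, h_comm, h_left, h_right⟩ := h (ε / (K + 1)) (by positivity)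
  have h_split : inner ℂ Ω (x (y Ω)) - inner ℂ Ω (y (x Ω)) =
      inner ℂ Ω (x (y Ω) - a (y Ω)) - inner ℂ Ω (y (x Ω - a Ω)) := by
    rw [inner_sub_right, map_sub, inner_sub_right, h_comm]
    ring
  calc ‖inner ℂ Ω (x (y Ω)) - inner ℂ Ω (y (x Ω))‖
      ≤ ‖Ω‖ * ‖x (y Ω) - a (y Ω)‖ + ‖Ω‖ * (‖y‖ * ‖x Ω - a Ω‖) := by
        rw [h_split]
        refine (norm_sub_le _ _).trans (add_le_add (norm_inner_le_norm _ _)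
          ((norm_inner_le_norm _ _).trans ?_))
        gcongr
        exact y.le_opNorm _
    _ ≤ ‖Ω‖ * (ε / (K + 1)) + ‖Ω‖ * (‖y‖ * (ε / (K + 1))) := by gcongr
    _ = ε * (K / (K + 1)) := by rw [hK]; ring
    _ ≤ 0 + ε := by
      rw [zero_add]
      exact mul_le_of_le_one_right hε.le (div_le_one_of_le₀ (by linarith) (by positivity))

variable [CompleteSpace E]

theorem inner_mul_comm_of_mem_bicommutant {Ω : E} (𝒜 : StarSubalgebra ℂ (E →L[ℂ] E))
    (h𝒜 : ∀ a ∈ 𝒜, ∀ b ∈ 𝒜, inner ℂ Ω (a (b Ω)) = inner ℂ Ω (b (a Ω))) {x y : E →L[ℂ] E}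
    (hx : x ∈ Set.centralizer (Set.centralizer (𝒜 : Set (E →L[ℂ] E))))
    (hy : y ∈ Set.centralizer (Set.centralizer (𝒜 : Set (E →L[ℂ] E)))) :
    inner ℂ Ω (x (y Ω)) = inner ℂ Ω (y (x Ω)) := by
  refine inner_mul_comm_of_forall_exists_approx fun ε hε => ?_
  obtain ⟨a, ha, h_approx⟩ := exists_forall_norm_sub_lt_of_mem_bicommutant 𝒜 hx ![y Ω, Ω] hε
  refine ⟨a, ?_, h_approx 0, h_approx 1⟩
  refine (inner_mul_comm_of_forall_exists_approx fun δ hδ => ?_).symm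
  obtain ⟨b, hb, h_approx⟩ := exists_forall_norm_sub_lt_of_mem_bicommutant 𝒜 hy ![a Ω, Ω] hδ
  exact ⟨b, h𝒜 b hb a ha, h_approx 0, h_approx 1⟩

/-- The vector functional of `Ω` is a trace on `N`, and the vectors `z y Ω` with `z ∈ N'` and
`y ∈ N` are total. The second condition says that the projection onto the closure of `N Ω` has
central support `1`; it makes the trace faithful. -/
structure IsTraceVector (N : VonNeumannAlgebra E) (Ω : E) : Prop where
  inner_mul_comm : ∀ x ∈ N, ∀ y ∈ N, inner ℂ Ω (x (y Ω)) = inner ℂ Ω (y (x Ω))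
  total : ∀ L : Submodule ℂ E, IsClosed (L : Set E) →
    (∀ z ∈ N.commutant, ∀ y ∈ N, z (y Ω) ∈ L) → ∀ f, f ∈ L

namespace IsTraceVector

variable {N : VonNeumannAlgebra E} {Ω : E} (hΩ : IsTraceVector N Ω)
include hΩ

theorem norm_star_apply {x : E →L[ℂ] E} (hx : x ∈ N) : ‖star x Ω‖ = ‖x Ω‖ := by
  rw [ContinuousLinearMap.apply_norm_eq_sqrt_inner_adjoint_right,
    ContinuousLinearMap.apply_norm_eq_sqrt_inner_adjoint_right,
    ← ContinuousLinearMap.star_eq_adjoint, ← ContinuousLinearMap.star_eq_adjoint, star_star,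
    ContinuousLinearMap.comp_apply, ContinuousLinearMap.comp_apply,
    hΩ.inner_mul_comm x hx (star x) (star_mem hx)]

theorem inner_apply_apply {c x y : E →L[ℂ] E} (hc : c ∈ N) (hx : x ∈ N) (hy : y ∈ N) :
    inner ℂ (c (y Ω)) (x Ω) = inner ℂ (c Ω) (x (star y Ω)) :=
  calc inner ℂ (c (y Ω)) (x Ω) = inner ℂ Ω (star y ((star c * x) Ω)) := by
        rw [mul_apply_eq_comp, ContinuousLinearMap.star_eq_adjoint,
          ContinuousLinearMap.star_eq_adjoint, ContinuousLinearMap.adjoint_inner_right,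
          ContinuousLinearMap.adjoint_inner_right]
    _ = inner ℂ Ω ((star c * x) (star y Ω)) :=
        hΩ.inner_mul_comm _ (star_mem hy) _ (mul_mem (star_mem hc) hx)
    _ = inner ℂ (c Ω) (x (star y Ω)) := by
        rw [mul_apply_eq_comp, ContinuousLinearMap.star_eq_adjoint c,
          ContinuousLinearMap.adjoint_inner_right]

theorem norm_apply_apply_le {x y : E →L[ℂ] E} (hx : x ∈ N) (hy : y ∈ N) :
    ‖x (y Ω)‖ ≤ ‖y‖ * ‖x Ω‖ :=
  calc ‖x (y Ω)‖ = ‖star y (star x Ω)‖ := by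
        rw [← mul_apply_eq_comp, ← hΩ.norm_star_apply (mul_mem hx hy), star_mul]; rfl
    _ ≤ ‖star y‖ * ‖star x Ω‖ := (star y).le_opNorm _
    _ = ‖y‖ * ‖x Ω‖ := by rw [norm_star, hΩ.norm_star_apply hx]

theorem norm_apply_apply_of_mul_star_self {x y : E →L[ℂ] E} (hx : x ∈ N) (hy : y ∈ N)
    (hy_unitary : y * star y = 1) : ‖x (y Ω)‖ = ‖x Ω‖ :=
  calc ‖x (y Ω)‖ = ‖star y (star x Ω)‖ := by
        rw [← mul_apply_eq_comp, ← hΩ.norm_star_apply (mul_mem hx hy), star_mul]; rfl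
    _ = ‖x Ω‖ := by
        rw [norm_apply_of_star_mul_self_eq_one (by rwa [star_star]), hΩ.norm_star_apply hx]

theorem eq_zero_of_apply_eq_zero {x : E →L[ℂ] E} (hx : x ∈ N) (h : x Ω = 0) : x = 0 := by
  ext1 f
  refine hΩ.total (LinearMap.ker x.toLinearMap) x.isClosed_ker (fun z hz y hy => ?_) f
  have h_apply : x (y Ω) = 0 := by
    rw [← norm_le_zero_iff]
    simpa only [h, norm_zero, mul_zero] using hΩ.norm_apply_apply_le hx hy
  have h_comm : z (x (y Ω)) = x (z (y Ω)) := congr($(mem_iff_commute_commutant.1 hx z hz) (y Ω))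
  change x (z (y Ω)) = 0
  rw [← h_comm, h_apply, map_zero]

end IsTraceVector

section RightMultiplication

/-- The linear map `N → E`, `x ↦ x f`. -/
def orbitMap (N : VonNeumannAlgebra E) (f : E) : N.toStarSubalgebra →ₗ[ℂ] E where
  toFun x := x.1 f
  map_add' _ _ := rfl
  map_smul' _ _ := rfl

/-- The closure of `N Ω`. -/
def cyclicSpace (N : VonNeumannAlgebra E) (Ω : E) : Submodule ℂ E :=
  (LinearMap.range (orbitMap N Ω)).topologicalClosure

instance (N : VonNeumannAlgebra E) (Ω : E) : (cyclicSpace N Ω).HasOrthogonalProjection := by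
  unfold cyclicSpace; infer_instance

theorem orbitMap_mem_cyclicSpace (N : VonNeumannAlgebra E) (Ω : E) (x : N.toStarSubalgebra) :
    orbitMap N Ω x ∈ cyclicSpace N Ω :=
  subset_closure ⟨x, rfl⟩

theorem denseRange_orbitMap_codRestrict (N : VonNeumannAlgebra E) (Ω : E) :
    DenseRange ((orbitMap N Ω).codRestrict _ (orbitMap_mem_cyclicSpace N Ω)) := by
  intro r
  rw [closure_subtype]
  refine closure_mono ?_ r.2
  rintro _ ⟨x, rfl⟩
  exact ⟨_, ⟨x, rfl⟩, rfl⟩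

/-- Right multiplication `x Ω ↦ x T Ω` by `T ∈ N`, extended by continuity to the closure of `N Ω`
and by zero to its orthogonal complement. -/
def rightMul (N : VonNeumannAlgebra E) (Ω : E) (T : E →L[ℂ] E) : E →L[ℂ] E :=
  (orbitMap N (T Ω)).extendOfNorm
      ((orbitMap N Ω).codRestrict _ (orbitMap_mem_cyclicSpace N Ω)) ∘L
    (cyclicSpace N Ω).orthogonalProjectionOnto

theorem rightMul_apply_of_mem_orthogonal {N : VonNeumannAlgebra E} {Ω f : E} {T : E →L[ℂ] E}
    (hf : f ∈ (cyclicSpace N Ω)ᗮ) : rightMul N Ω T f = 0 := by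
  rw [rightMul, ContinuousLinearMap.comp_apply,
    Submodule.orthogonalProjectionOnto_eq_zero_iff.2 hf, map_zero]

end RightMultiplication

namespace IsTraceVector

variable {N : VonNeumannAlgebra E} {Ω : E} (hΩ : IsTraceVector N Ω)
include hΩ

theorem rightMul_apply {x T : E →L[ℂ] E} (hx : x ∈ N) (hT : T ∈ N) :
    rightMul N Ω T (x Ω) = x (T Ω) := by
  have h_proj := Submodule.orthogonalProjectionOnto_mem_subspace_eq_self
    (⟨_, orbitMap_mem_cyclicSpace N Ω ⟨x, hx⟩⟩ : cyclicSpace N Ω)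
  change LinearMap.extendOfNorm _ _ (Submodule.orthogonalProjectionOnto _
    (orbitMap N Ω ⟨x, hx⟩)) = _
  rw [h_proj]
  exact LinearMap.extendOfNorm_eq (denseRange_orbitMap_codRestrict N Ω)
    ⟨‖T‖, fun z => hΩ.norm_apply_apply_le z.2 hT⟩ ⟨x, hx⟩

theorem norm_rightMul_apply_le {T : E →L[ℂ] E} (hT : T ∈ N) (f : E) :
    ‖rightMul N Ω T f‖ ≤ ‖T‖ * ‖f‖ := by
  refine (LinearMap.norm_extendOfNorm_apply_le (denseRange_orbitMap_codRestrict N Ω) ‖T‖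
    (fun z => hΩ.norm_apply_apply_le z.2 hT) _).trans ?_
  gcongr
  exact Submodule.norm_orthogonalProjectionOnto_apply_le _ f

theorem norm_rightMul_apply_of_mul_star_self {T : E →L[ℂ] E} (hT : T ∈ N)
    (hT_unitary : T * star T = 1) {f : E} (hf : f ∈ cyclicSpace N Ω) :
    ‖rightMul N Ω T f‖ = ‖f‖ := by
  refine closure_minimal (t := {f | ‖rightMul N Ω T f‖ = ‖f‖}) ?_
    (isClosed_eq (by fun_prop) (by fun_prop)) hf
  rintro _ ⟨x, rfl⟩
  exact congr(‖$(hΩ.rightMul_apply x.2 hT)‖).trans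
    (hΩ.norm_apply_apply_of_mul_star_self x.2 hT hT_unitary)

theorem rightMul_eq {T A : E →L[ℂ] E} (hT : T ∈ N) (h : ∀ x ∈ N, A (x Ω) = x (T Ω))
    (h_orthogonal : ∀ f ∈ (cyclicSpace N Ω)ᗮ, A f = 0) : rightMul N Ω T = A := by
  have h_closure : ∀ f ∈ cyclicSpace N Ω, rightMul N Ω T f = A f := by
    intro f hf
    refine closure_minimal (t := {f | rightMul N Ω T f = A f}) ?_
      (isClosed_eq (by fun_prop) (by fun_prop)) hf
    rintro _ ⟨x, rfl⟩
    exact (hΩ.rightMul_apply x.2 hT).trans (h x x.2).symm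
  ext1 f
  obtain ⟨g, hg, k, hk, rfl⟩ := (cyclicSpace N Ω).exists_add_mem_mem_orthogonal f
  rw [map_add, map_add, h_closure g hg, h_orthogonal k hk, rightMul_apply_of_mem_orthogonal hk]

theorem rightMul_add {S T : E →L[ℂ] E} (hS : S ∈ N) (hT : T ∈ N) :
    rightMul N Ω (S + T) = rightMul N Ω S + rightMul N Ω T := by
  refine hΩ.rightMul_eq (add_mem hS hT) (fun x hx => ?_) fun f hf => ?_
  · rw [add_apply, add_apply, hΩ.rightMul_apply hx hS,
      hΩ.rightMul_apply hx hT, map_add]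
  · rw [add_apply, rightMul_apply_of_mem_orthogonal hf,
      rightMul_apply_of_mem_orthogonal hf, add_zero]

theorem rightMul_smul (r : ℂ) {T : E →L[ℂ] E} (hT : T ∈ N) :
    rightMul N Ω (r • T) = r • rightMul N Ω T := by
  refine hΩ.rightMul_eq (N.toStarSubalgebra.smul_mem hT r) (fun x hx => ?_) fun f hf => ?_
  · rw [smul_apply, smul_apply, hΩ.rightMul_apply hx hT,
      map_smul]
  · rw [smul_apply, rightMul_apply_of_mem_orthogonal hf, smul_zero]

theorem rightMul_mul {S T : E →L[ℂ] E} (hS : S ∈ N) (hT : T ∈ N) :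
    rightMul N Ω (S * T) = rightMul N Ω T * rightMul N Ω S := by
  refine hΩ.rightMul_eq (mul_mem hS hT) (fun x hx => ?_) fun f hf => ?_
  · rw [mul_apply_eq_comp, hΩ.rightMul_apply hx hS]
    exact hΩ.rightMul_apply (mul_mem hx hS) hT
  · rw [mul_apply_eq_comp, rightMul_apply_of_mem_orthogonal hf, map_zero]

end IsTraceVector

omit [CompleteSpace E] in
theorem isClosed_setOf_cauchySeq_apply {z : ℕ → E →L[ℂ] E} {C : ℝ} (hC : ∀ n, ‖z n‖ ≤ C) :
    IsClosed {f | CauchySeq fun n => z n f} := by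
  refine isSeqClosed_iff_isClosed.1 fun f g hf hfg => Metric.cauchySeq_iff.2 fun ε hε => ?_
  have hC₀ : 0 ≤ C := (norm_nonneg _).trans (hC 0)
  obtain ⟨k, hk⟩ := Metric.tendsto_atTop.1 hfg (ε / (3 * (C + 1))) (by positivity)
  obtain ⟨n₀, hn₀⟩ := Metric.cauchySeq_iff.1 (hf k) (ε / 3) (by positivity)
  have h_dist : ∀ n, dist (z n g) (z n (f k)) ≤ ε / 3 := fun n => by
    rw [dist_eq_norm, ← map_sub]
    calc ‖z n (g - f k)‖ ≤ C * dist (f k) g := by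
          rw [dist_comm, dist_eq_norm]; exact (z n).le_of_opNorm_le (hC n) _
      _ ≤ (C + 1) * (ε / (3 * (C + 1))) := by gcongr; exacts [by linarith, (hk k le_rfl).le]
      _ = ε / 3 := by field_simp
  refine ⟨n₀, fun m hm n hn => ?_⟩
  have h_tri := dist_triangle4 (z m g) (z m (f k)) (z n (f k)) (z n g)
  rw [dist_comm (z n (f k))] at h_tri
  linarith [hn₀ m hm n hn, h_dist m, h_dist n]

theorem IsTraceVector.exists_strong_limit {N : VonNeumannAlgebra E} {Ω : E}
    (hΩ : IsTraceVector N Ω) {z : ℕ → E →L[ℂ] E} {C : ℝ} (hz : ∀ n, z n ∈ N)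
    (hC : ∀ n, ‖z n‖ ≤ C) (h_cauchy : CauchySeq fun n => z n Ω) :
    ∃ w ∈ N, ∀ f, Tendsto (fun n => z n f) atTop (𝓝 (w f)) := by
  let L : Submodule ℂ E :=
    { carrier := {f | CauchySeq fun n => z n f}
      add_mem' := fun hf hg => by
        simp only [Set.mem_ofPred_eq, map_add]
        exact CauchySeq.add hf hg
      zero_mem' := by
        simp only [Set.mem_ofPred_eq, map_zero]
        exact cauchySeq_const 0
      smul_mem' := fun r f hf => by
        simp only [Set.mem_ofPred_eq, map_smul]
        exact (uniformContinuous_const_smul r).comp_cauchySeq hf }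
  have h_all : ∀ f, CauchySeq fun n => z n f := by
    refine hΩ.total L (isClosed_setOf_cauchySeq_apply hC) fun y hy x hx => ?_
    have h_comm : ∀ n, z n (y (x Ω)) = y (z n (x Ω)) := fun n =>
      congr($(mem_iff_commute_commutant.1 (hz n) y hy) (x Ω)).symm
    change CauchySeq fun n => z n (y (x Ω))
    simp only [h_comm]
    refine y.uniformContinuous.comp_cauchySeq ?_
    rw [cauchySeq_iff_tendsto_dist_atTop_0] at h_cauchy ⊢
    refine squeeze_zero (fun _ => dist_nonneg) (fun n => ?_)
      (by simpa only [mul_zero] using h_cauchy.const_mul ‖x‖)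
    rw [dist_eq_norm, dist_eq_norm]
    exact hΩ.norm_apply_apply_le (sub_mem (hz n.1) (hz n.2)) hx
  choose F hF using fun f => cauchySeq_tendsto_of_complete (h_all f)
  refine ⟨continuousLinearMapOfTendsto z (tendsto_pi_nhds.2 hF), ?_, hF⟩
  refine mem_iff_commute_commutant.2 fun y hy => ?_
  ext1 f
  refine tendsto_nhds_unique ((y.continuous.tendsto _).comp (hF f)) ((hF (y f)).congr fun n => ?_)
  exact congr($(mem_iff_commute_commutant.1 (hz n) y hy) f).symm

end TraceVector

section VonNeumannGeneration

variable {E : Type*} [NormedAddCommGroup E] [InnerProductSpace ℂ E] [CompleteSpace E]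
  {S : Set (E →L[ℂ] E)}

theorem mem_bicommutant_of_mem_vnGen {𝒜 : StarSubalgebra ℂ (E →L[ℂ] E)} (h : S ⊆ 𝒜)
    {x : E →L[ℂ] E} (hx : x ∈ vnGen S) :
    x ∈ Set.centralizer (Set.centralizer (𝒜 : Set (E →L[ℂ] E))) := by
  rw [← SetLike.mem_coe, coe_vnGen] at hx
  refine Set.centralizer_subset (Set.centralizer_subset (Set.union_subset h fun y hy => ?_)) hx
  have := star_mem (h hy : star y ∈ 𝒜)
  rwa [star_star] at this

theorem mem_commutant_of_le_vnGen {N : VonNeumannAlgebra E} (hN : N ≤ vnGen S) {z : E →L[ℂ] E}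
    (hz : ∀ x ∈ S, x * z = z * x) (hz_star : ∀ x ∈ S, x * star z = star z * x) :
    z ∈ N.commutant := by
  refine VonNeumannAlgebra.mem_commutant_iff.2 fun y hy => ?_
  have hy : y ∈ Set.centralizer (Set.centralizer (S ∪ star S)) := by
    rw [← coe_vnGen]; exact hN hy
  refine (hy z ?_).symm
  rintro x (hx | hx)
  · exact hz x hx
  · simpa only [star_mul, star_star] using congr(star $(hz_star _ hx)).symm

end VonNeumannGeneration

section Trace

theorem mem_of_forall_mulOp_mem {S : Type*} [MeasurableSpace S] {m : Measure S}
    {k : Lp ℂ 2 m} (hk : k =ᵐ[m] fun _ => 1) (L : Submodule ℂ (Lp ℂ 2 m))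
    (hL : IsClosed (L : Set (Lp ℂ 2 m))) (h : ∀ c : Lp ℂ ∞ m, mulOp c k ∈ L) (f : Lp ℂ 2 m) :
    f ∈ L := by
  refine Lp.induction (by norm_num) (motive := fun f => f ∈ L) (fun c s hs hμs => ?_)
    (fun _ _ _ _ _ => L.add_mem) hL f
  rw [Lp.simpleFunc.coe_indicatorConst]
  have h_ind : indicatorConstLp 2 hs hμs.ne c = mulOp (indicatorConstLp ∞ hs hμs.ne c) k := by
    refine Lp.ext ?_
    filter_upwards [indicatorConstLp_coeFn (p := 2) (hs := hs) (hμs := hμs.ne) (c := c),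
      indicatorConstLp_coeFn (p := ∞) (hs := hs) (hμs := hμs.ne) (c := c),
      coeFn_mulOp (indicatorConstLp ∞ hs hμs.ne c) k, hk] with x h₂ h_top h_mul h_one
    rw [h₂, h_mul, h_top, h_one, mul_one]
  rw [h_ind]
  exact h _

variable {Γ X ι H : Type*} [MeasurableSpace X] (μ : Measure X) [IsProbabilityMeasure μ]

theorem norm_vacuum [Group Γ] : ‖(vacuum μ : Space Γ μ ι)‖ = 1 := by
  have h_one : ‖oneVec μ ι‖ = 1 := by
    rw [oneVec, Lp.norm_toLp, eLpNorm_const _ (by norm_num) (IsProbabilityMeasure.ne_zero _)]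
    simp
  classical
  rw [vacuum, lp.norm_single (by norm_num)]
  exact h_one

theorem norm2_eq [Group Γ] (x : Space Γ μ ι →L[ℂ] Space Γ μ ι) :
    norm2 μ x = ‖x (vacuum μ)‖ := by
  rw [ContinuousLinearMap.apply_norm_eq_sqrt_inner_adjoint_right]
  rfl

theorem mem_of_forall_diag_const_mem [Group Γ] (L : Submodule ℂ (Space Γ μ ι))
    (hL : IsClosed (L : Set (Space Γ μ ι)))
    (h : ∀ (c : Lp ℂ ∞ ((gaussianMeasure ι).prod μ)) (g : Γ),
      diag μ (fun _ => c) ‖c‖ (norm_nonneg c) (fun _ => le_rfl) (u μ g (vacuum μ)) ∈ L)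
    (f : Space Γ μ ι) : f ∈ L := by
  classical
  have h_single : ∀ (g : Γ) (k : Base μ ι), lp.single (E := fun _ : Γ => Base μ ι) 2 g k ∈ L := by
    intro g k
    let single := lp.singleContinuousLinearMap (p := 2) ℂ (fun _ : Γ => Base μ ι) g
    refine mem_of_forall_mulOp_mem (coeFn_oneVec μ (ι := ι)) (L.comap single.toLinearMap)
      (hL.preimage single.continuous) (fun c => ?_) k
    have h_mem := h c g
    rwa [u_vacuum, diag_single] at h_mem
  exact hL.mem_of_tendsto (lp.hasSum_single (by norm_num) f)
    (Eventually.of_forall fun s => L.sum_mem fun g _ => h_single g _)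

variable [NormedAddCommGroup H] [InnerProductSpace ℝ H] [Group Γ]
  [MulAction Γ X] [MeasurableConstSMul Γ X] [SMulInvariantMeasure Γ X μ]
  (e : HilbertBasis ι ℝ H) (π : Γ →* (H ≃ₗᵢ[ℝ] H))

/-- The span of the elementary operators `(ω(ξ) ⊗ a) u_g` with `ξ ∈ V`. -/
def genSpan (V : Submodule ℝ H) : Submodule ℂ (Space Γ μ ι →L[ℂ] Space Γ μ ι) :=
  Submodule.span ℂ {x | ∃ ξ ∈ V, ∃ a g, x = gen μ e π ξ a g}

variable {π} in
theorem gen_mem_genSpan {V : Submodule ℝ H} {ξ : H} (hξ : ξ ∈ V) (a : Lp ℂ ∞ μ) (g : Γ) :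
    gen μ e π ξ a g ∈ genSpan μ e π V :=
  Submodule.subset_span ⟨ξ, hξ, a, g, rfl⟩

variable {π} in
theorem genSpan_le {V : Submodule ℝ H} {L : Submodule ℂ (Space Γ μ ι →L[ℂ] Space Γ μ ι)}
    (h : ∀ ξ ∈ V, ∀ a g, gen μ e π ξ a g ∈ L) : genSpan μ e π V ≤ L :=
  Submodule.span_le.2 <| by rintro _ ⟨ξ, hξ, a, g, rfl⟩; exact h ξ hξ a g

theorem mul_mem_genSpan {V W : Submodule ℝ H} (hW : W ≤ V) (hW_inv : ∀ g, ∀ ξ ∈ W, π g ξ ∈ W)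
    {x y : Space Γ μ ι →L[ℂ] Space Γ μ ι} (hx : x ∈ genSpan μ e π V) (hy : y ∈ genSpan μ e π W) :
    x * y ∈ genSpan μ e π V := by
  have h_le : genSpan μ e π V * genSpan μ e π W ≤ genSpan μ e π V := by
    rw [genSpan, genSpan, Submodule.span_mul_span, Submodule.span_le]
    rintro _ ⟨_, ⟨ξ, hξ, a, g, rfl⟩, _, ⟨η, hη, c, h, rfl⟩, rfl⟩
    change gen μ e π ξ a g * gen μ e π η c h ∈ _
    rw [gen_mul]
    exact gen_mem_genSpan μ e (V.add_mem hξ (hW (hW_inv g _ hη))) _ _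
  exact h_le (Submodule.mul_mem_mul hx hy)

theorem star_mem_genSpan {V : Submodule ℝ H} (hV : ∀ g, ∀ ξ ∈ V, π g ξ ∈ V)
    {x : Space Γ μ ι →L[ℂ] Space Γ μ ι} (hx : x ∈ genSpan μ e π V) :
    star x ∈ genSpan μ e π V := by
  refine Submodule.span_induction ?_ ?_ ?_ ?_ hx
  · rintro _ ⟨ξ, hξ, a, g, rfl⟩
    rw [star_gen]
    exact gen_mem_genSpan μ e (V.neg_mem (hV _ _ hξ)) _ _
  · rw [star_zero]; exact zero_mem _
  · intro x y _ _ hx hy; rw [star_add]; exact add_mem hx hy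
  · intro r x _ hx; rw [star_smul]; exact Submodule.smul_mem _ _ hx

/-- The `*`-algebra structure on `genSpan` for an invariant subspace `V`. -/
def genAlg (V : Submodule ℝ H) (hV : ∀ g, ∀ ξ ∈ V, π g ξ ∈ V) :
    StarSubalgebra ℂ (Space Γ μ ι →L[ℂ] Space Γ μ ι) where
  carrier := genSpan μ e π V
  mul_mem' := mul_mem_genSpan μ e π le_rfl hV
  add_mem' := add_mem
  algebraMap_mem' r := by
    rw [Algebra.algebraMap_eq_smul_one, ← gen_one μ e π]
    exact Submodule.smul_mem _ _ (gen_mem_genSpan μ e V.zero_mem _ _)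
  star_mem' := star_mem_genSpan μ e π hV

theorem map_mem_bot (g : Γ) (ξ : H) (hξ : ξ ∈ (⊥ : Submodule ℝ H)) :
    π g ξ ∈ (⊥ : Submodule ℝ H) := by
  rw [Submodule.mem_bot] at hξ ⊢
  rw [hξ, map_zero]

theorem opD_eq_gen (ξ : H) : opD μ e π ξ = gen μ e π ξ (oneLinf μ) 1 := by
  rw [gen, opA_one, u_one, mul_one, mul_one]

theorem opA_eq_gen (a : Lp ℂ ∞ μ) : opA μ a = gen μ e π 0 a 1 := by
  rw [gen, opD_zero, u_one, mul_one, one_mul]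

theorem u_eq_gen (g : Γ) : u μ g = gen μ e π 0 (oneLinf μ) g := by
  rw [gen, opD_zero, opA_one, one_mul, one_mul]

theorem mem_bicommutant_of_mem_algM {x : Space Γ μ ι →L[ℂ] Space Γ μ ι} (hx : x ∈ algM Γ μ ι) :
    x ∈ Set.centralizer (Set.centralizer
      (genAlg μ e π ⊥ (map_mem_bot π) : Set (Space Γ μ ι →L[ℂ] Space Γ μ ι))) := by
  refine mem_bicommutant_of_mem_vnGen ?_ hx
  rintro _ (⟨a, rfl⟩ | ⟨g, rfl⟩)
  · rw [opA_eq_gen μ e π]; exact gen_mem_genSpan μ e (zero_mem _) _ _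
  · rw [u_eq_gen μ e π]; exact gen_mem_genSpan μ e (zero_mem _) _ _

theorem algMtilde_le_vnGen :
    algMtilde μ e π ≤ vnGen (Set.range (opD μ e π) ∪ Set.range (opA μ) ∪ Set.range (u μ)) := by
  refine vnGen_le ?_
  rintro x (hx | hx)
  · refine (vnGen_le ?_ : algDA μ e π ≤ _) hx
    exact Set.subset_union_left.trans (subset_vnGen _)
  · exact subset_vnGen _ (Or.inr hx)

theorem mem_bicommutant_of_mem_algMtilde {x : Space Γ μ ι →L[ℂ] Space Γ μ ι}
    (hx : x ∈ algMtilde μ e π) :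
    x ∈ Set.centralizer (Set.centralizer
      (genAlg μ e π ⊤ (fun _ _ _ => trivial) : Set (Space Γ μ ι →L[ℂ] Space Γ μ ι))) := by
  refine mem_bicommutant_of_mem_vnGen ?_ (algMtilde_le_vnGen μ e π hx)
  rintro _ ((⟨ξ, rfl⟩ | ⟨a, rfl⟩) | ⟨g, rfl⟩)
  · rw [opD_eq_gen]; exact gen_mem_genSpan μ e (Submodule.mem_top (R := ℝ)) _ _
  · rw [opA_eq_gen μ e π]; exact gen_mem_genSpan μ e (Submodule.mem_top (R := ℝ)) _ _
  · rw [u_eq_gen μ e π]; exact gen_mem_genSpan μ e (Submodule.mem_top (R := ℝ)) _ _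

variable {π} in
theorem gen_mem_algMtilde (ξ : H) (a : Lp ℂ ∞ μ) (g : Γ) :
    gen μ e π ξ a g ∈ algMtilde μ e π :=
  mul_mem (mul_mem (algDA_le μ e (opD_mem_algDA μ e ξ)) (algDA_le μ e (opA_mem_algDA μ e a)))
    (u_mem μ e g)

theorem mem_algMtilde_of_mem_genSpan {V : Submodule ℝ H} {x : Space Γ μ ι →L[ℂ] Space Γ μ ι}
    (hx : x ∈ genSpan μ e π V) : x ∈ algMtilde μ e π :=
  genSpan_le (L := Subalgebra.toSubmodule (algMtilde μ e π).toSubalgebra) μ e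
    (fun ξ _ a g => gen_mem_algMtilde μ e ξ a g) hx

theorem trace_eq_inner_gen (x : Space Γ μ ι →L[ℂ] Space Γ μ ι) :
    trace μ x = inner ℂ (gen μ e π 0 (oneLinf μ) 1 (vacuum μ)) (x (vacuum μ)) := by
  rw [gen_one]; rfl

theorem trace_gen_of_ne (ξ : H) (a : Lp ℂ ∞ μ) {g : Γ} (hg : g ≠ 1) :
    trace μ (gen μ e π ξ a g) = 0 := by
  rw [trace_eq_inner_gen μ e π, inner_gen_of_ne μ e π _ _ _ _ hg.symm]

theorem trace_gen_one (ξ : H) (a : Lp ℂ ∞ μ) :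
    trace μ (gen μ e π ξ a 1) = (Real.exp (-‖ξ‖ ^ 2) : ℂ) * ∫ x, a x ∂μ := by
  rw [trace_eq_inner_gen μ e π, inner_gen_same, zero_sub, norm_neg]
  congr 1
  refine integral_congr_ae ?_
  filter_upwards [coeFn_oneLinf (m := μ)] with x hx
  rw [hx, star_one, one_mul]

theorem trace_gen_mul_comm (ξ ξ' : H) (a a' : Lp ℂ ∞ μ) (g g' : Γ) :
    trace μ (gen μ e π ξ a g * gen μ e π ξ' a' g') =
      trace μ (gen μ e π ξ' a' g' * gen μ e π ξ a g) := by
  rw [gen_mul, gen_mul]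
  by_cases h : g * g' = 1
  · obtain rfl : g' = g⁻¹ := (inv_eq_of_mul_eq_one_right h).symm
    rw [h, inv_mul_cancel, trace_gen_one, trace_gen_one]
    congr 1
    · have h_norm : ξ + π g ξ' = π g (ξ' + π g⁻¹ ξ) := by
        rw [map_add, apply_inv_apply, add_comm]
      rw [h_norm, LinearIsometryEquiv.norm_map]
    · rw [← integral_smul_eq_self (fun x => mulLinf a (translate μ g a') x) (g := g)]
      refine integral_congr_ae ?_
      have hg := (measurePreserving_smul g μ).quasiMeasurePreserving
      filter_upwards [hg.ae (coeFn_mulLinf a (translate μ g a')), hg.ae (coeFn_translate μ g a'),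
        coeFn_mulLinf a' (translate μ g⁻¹ a), coeFn_translate μ g⁻¹ a] with x h_left ha' h_right ha
      rw [h_left, ha', h_right, ha, inv_smul_smul, inv_inv, mul_comm]
  · rw [trace_gen_of_ne μ e π _ _ h, trace_gen_of_ne μ e π _ _ (mt mul_eq_one_comm.1 h)]

theorem trace_mul_comm_of_mem_genSpan {V : Submodule ℝ H}
    {x y : Space Γ μ ι →L[ℂ] Space Γ μ ι} (hx : x ∈ genSpan μ e π V)
    (hy : y ∈ genSpan μ e π V) : trace μ (x * y) = trace μ (y * x) := by
  have trace_add : ∀ x y : Space Γ μ ι →L[ℂ] Space Γ μ ι,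
      trace μ (x + y) = trace μ x + trace μ y := fun _ _ => inner_add_right _ _ _
  have trace_smul : ∀ (r : ℂ) (x : Space Γ μ ι →L[ℂ] Space Γ μ ι),
      trace μ (r • x) = r * trace μ x := fun _ _ => inner_smul_right _ _ _
  induction hx, hy using Submodule.span_induction₂ with
  | mem_mem x y hx hy =>
    obtain ⟨ξ, _, a, g, rfl⟩ := hx
    obtain ⟨ξ', _, a', g', rfl⟩ := hy
    exact trace_gen_mul_comm μ e π ξ ξ' a a' g g'
  | zero_left | zero_right => rw [zero_mul, mul_zero]
  | add_left x y z _ _ _ hx hy | add_right x y z _ _ _ hx hy =>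
    rw [add_mul, mul_add, trace_add, trace_add, hx, hy]
  | smul_left r x y _ _ h | smul_right r x y _ _ h =>
    rw [smul_mul_assoc, mul_smul_comm, trace_smul, trace_smul, h]

theorem diag_const_mem_commutant (c : Lp ℂ ∞ ((gaussianMeasure ι).prod μ)) (C : ℝ) (hC : 0 ≤ C)
    (hc : ∀ _ : Γ, ‖c‖ ≤ C) : diag μ (fun _ => c) C hC hc ∈ (algMtilde μ e π).commutant := by
  have h_comm : ∀ (c : Lp ℂ ∞ ((gaussianMeasure ι).prod μ)) (hc : ∀ _ : Γ, ‖c‖ ≤ C),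
      ∀ x ∈ Set.range (opD μ e π) ∪ Set.range (opA μ) ∪ Set.range (u (Γ := Γ) μ),
        x * diag μ (fun _ => c) C hC hc = diag μ (fun _ => c) C hC hc * x := by
    rintro c hc _ ((⟨ξ, rfl⟩ | ⟨a, rfl⟩) | ⟨g, rfl⟩)
    · rw [opD, diagOmega_comm_diag]
    · ext f g : 3
      exact congr($(mulOp_comm (oneTensor μ ι (translate μ g⁻¹ a)) c) (f g))
    · rfl
  refine mem_commutant_of_le_vnGen (algMtilde_le_vnGen μ e π) (h_comm c hc) ?_
  rw [star_diag]
  exact h_comm (star c) _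

theorem isTraceVector_vacuum : IsTraceVector (algMtilde μ e π) (vacuum μ) where
  inner_mul_comm _ hx _ hy :=
    inner_mul_comm_of_mem_bicommutant _ (fun _ ha _ hb => trace_mul_comm_of_mem_genSpan μ e π ha hb)
      (mem_bicommutant_of_mem_algMtilde μ e π hx) (mem_bicommutant_of_mem_algMtilde μ e π hy)
  total L hL h :=
    mem_of_forall_diag_const_mem μ L hL fun c g =>
      h _ (diag_const_mem_commutant μ e π c ‖c‖ _ _) _ (u_mem μ e g)

end Trace

section Multiplier

variable {Γ E : Type*} [NormedAddCommGroup E] [InnerProductSpace ℂ E]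

/-- The operator on `ℓ²(Γ, E)` of multiplication by a function `κ : Γ → [0, 1]`. -/
def multiplier (κ : Γ → unitInterval) : lp (fun _ : Γ => E) 2 →L[ℂ] lp (fun _ : Γ => E) 2 :=
  lp.mapCLM 2 (fun g => ((κ g : ℝ) : ℂ) • ContinuousLinearMap.id ℂ E) zero_le_one fun g => by
    refine (norm_smul_le _ _).trans (mul_le_one₀ ?_ (norm_nonneg _)
      ContinuousLinearMap.norm_id_le)
    rw [Complex.norm_of_nonneg (κ g).2.1]
    exact (κ g).2.2

theorem multiplier_apply (κ : Γ → unitInterval) (f : lp (fun _ : Γ => E) 2) (g : Γ) :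
    multiplier κ f g = ((κ g : ℝ) : ℂ) • f g := rfl

theorem inner_multiplier_left (κ : Γ → unitInterval) (f k : lp (fun _ : Γ => E) 2) :
    inner ℂ (multiplier κ f) k = inner ℂ f (multiplier κ k) := by
  rw [lp.inner_eq_tsum, lp.inner_eq_tsum]
  simp only [multiplier_apply, inner_smul_left, inner_smul_right, Complex.conj_ofReal]

omit [InnerProductSpace ℂ E] in
theorem hasSum_norm_sq (f : lp (fun _ : Γ => E) 2) : HasSum (fun g => ‖f g‖ ^ 2) (‖f‖ ^ 2) := by
  simpa using lp.hasSum_norm (by norm_num) f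

theorem hasSum_re_inner_multiplier (κ : Γ → unitInterval) (f : lp (fun _ : Γ => E) 2) :
    HasSum (fun g => κ g * ‖f g‖ ^ 2) (inner ℂ f (multiplier κ f)).re := by
  convert! Complex.hasSum_re (lp.hasSum_inner f (multiplier κ f)) using 2 with g
  rw [multiplier_apply, inner_smul_right, inner_self_eq_norm_sq_to_K, Complex.re_ofReal_mul]
  norm_cast

theorem norm_multiplier_apply_sq_le (κ : Γ → unitInterval) (f : lp (fun _ : Γ => E) 2) :
    ‖multiplier κ f‖ ^ 2 ≤ (inner ℂ f (multiplier κ f)).re := by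
  refine hasSum_le (fun g => ?_) (hasSum_norm_sq _) (hasSum_re_inner_multiplier κ f)
  rw [multiplier_apply, norm_smul, Complex.norm_of_nonneg (κ g).2.1, mul_pow]
  gcongr
  exact pow_le_of_le_one (κ g).2.1 (κ g).2.2 two_ne_zero

theorem re_inner_multiplier_le {κ : Γ → unitInterval} {f : lp (fun _ : Γ => E) 2} {ρ : ℝ}
    (h : ∀ g, f g ≠ 0 → κ g ≤ ρ) : (inner ℂ f (multiplier κ f)).re ≤ ρ * ‖f‖ ^ 2 := by
  refine hasSum_le (fun g => ?_) (hasSum_re_inner_multiplier κ f) ((hasSum_norm_sq f).mul_left ρ)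
  by_cases hg : f g = 0
  · simp [hg]
  · gcongr
    exact h g hg

theorem le_re_inner_multiplier {κ : Γ → unitInterval} {f : lp (fun _ : Γ => E) 2} {ρ : ℝ}
    (h : ∀ g, f g ≠ 0 → ρ ≤ κ g) : ρ * ‖f‖ ^ 2 ≤ (inner ℂ f (multiplier κ f)).re := by
  refine hasSum_le (fun g => ?_) ((hasSum_norm_sq f).mul_left ρ) (hasSum_re_inner_multiplier κ f)
  by_cases hg : f g = 0
  · simp [hg]
  · gcongr
    exact h g hg

theorem norm_multiplier_apply_le (κ : Γ → unitInterval) (f : lp (fun _ : Γ => E) 2) :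
    ‖multiplier κ f‖ ≤ ‖f‖ := by
  refine le_of_sq_le_sq ((norm_multiplier_apply_sq_le κ f).trans ?_) (norm_nonneg f)
  simpa using re_inner_multiplier_le (ρ := 1) fun g _ => (κ g).2.2

theorem norm_multiplier_apply_le_norm_starProjection {κ : Γ → unitInterval}
    {L : Submodule ℂ (lp (fun _ : Γ => E) 2)} [L.HasOrthogonalProjection]
    {f : lp (fun _ : Γ => E) 2} (h : multiplier κ f ∈ L) :
    ‖multiplier κ f‖ ≤ ‖L.starProjection f‖ := by
  rcases (norm_nonneg (multiplier κ f)).eq_or_lt with h_zero | h_pos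
  · exact h_zero ▸ norm_nonneg _
  refine le_of_mul_le_mul_left ?_ h_pos
  calc ‖multiplier κ f‖ * ‖multiplier κ f‖
      ≤ (inner ℂ (multiplier κ f) f).re := by
        rw [← sq, inner_multiplier_left]
        exact norm_multiplier_apply_sq_le κ f
    _ = (inner ℂ (multiplier κ f) (L.starProjection f)).re := by
        rw [← Submodule.inner_starProjection_left_eq_right,
          Submodule.starProjection_eq_self_iff.2 h]
    _ ≤ _ := re_inner_le_norm (𝕜 := ℂ) _ _

/-- The restriction of an element of `ℓ²(Γ, E)` to a subset of `Γ`. -/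
def fibreRestrict (F : Set Γ) : lp (fun _ : Γ => E) 2 →L[ℂ] lp (fun _ : Γ => E) 2 :=
  multiplier (F.indicator 1)

theorem fibreRestrict_apply_of_mem {F : Set Γ} (f : lp (fun _ : Γ => E) 2) {g : Γ} (hg : g ∈ F) :
    fibreRestrict F f g = f g := by
  simp [fibreRestrict, multiplier_apply, hg]

theorem fibreRestrict_apply_of_notMem {F : Set Γ} (f : lp (fun _ : Γ => E) 2) {g : Γ}
    (hg : g ∉ F) : fibreRestrict F f g = 0 := by
  simp [fibreRestrict, multiplier_apply, hg]

theorem fibreRestrict_add_fibreRestrict_compl (F : Set Γ) (f : lp (fun _ : Γ => E) 2) :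
    fibreRestrict F f + fibreRestrict Fᶜ f = f := by
  ext g
  rw [lp.coeFn_add, Pi.add_apply]
  by_cases hg : g ∈ F
  · rw [fibreRestrict_apply_of_mem f hg, fibreRestrict_apply_of_notMem f (by simpa), add_zero]
  · rw [fibreRestrict_apply_of_notMem f hg, fibreRestrict_apply_of_mem f (by simpa), zero_add]

theorem norm_fibreRestrict_sq (F : Finset Γ) (f : lp (fun _ : Γ => E) 2) :
    ‖fibreRestrict F f‖ ^ 2 = ∑ g ∈ F, ‖f g‖ ^ 2 := by
  have h_sum : ∑ g ∈ F, ‖fibreRestrict F f g‖ ^ 2 = ∑ g ∈ F, ‖f g‖ ^ 2 :=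
    Finset.sum_congr rfl fun g hg => by rw [fibreRestrict_apply_of_mem f hg]
  rw [← h_sum]
  refine (hasSum_norm_sq _).unique (hasSum_sum_of_ne_finset_zero fun g hg => ?_)
  rw [fibreRestrict_apply_of_notMem f hg, norm_zero, zero_pow two_ne_zero]

theorem tendsto_norm_fibreRestrict {α : Type*} {l : Filter α} {f : α → lp (fun _ : Γ => E) 2}
    (hf : ∀ g, Tendsto (fun n => ‖f n g‖) l (𝓝 0)) (F : Finset Γ) :
    Tendsto (fun n => ‖fibreRestrict F (f n)‖) l (𝓝 0) := by
  have h_sq : Tendsto (fun n => ‖fibreRestrict F (f n)‖ ^ 2) l (𝓝 0) := by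
    simp only [norm_fibreRestrict_sq]
    simpa using tendsto_finsetSum F fun g _ => (hf g).pow 2
  simpa only [Real.sqrt_sq (norm_nonneg _), Real.sqrt_zero] using h_sq.sqrt

end Multiplier

section VecSpan

variable {Γ X ι H : Type*} [MeasurableSpace X] (μ : Measure X) [IsProbabilityMeasure μ]
  [NormedAddCommGroup H] [InnerProductSpace ℝ H] [Group Γ]
  [MulAction Γ X] [MeasurableConstSMul Γ X] [SMulInvariantMeasure Γ X μ]
  (e : HilbertBasis ι ℝ H) (π : Γ →* (H ≃ₗᵢ[ℝ] H))

theorem multiplier_gen (κ : Γ → unitInterval) (ξ : H) (a : Lp ℂ ∞ μ) (g : Γ) :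
    multiplier κ (gen μ e π ξ a g (vacuum μ)) =
      ((κ g : ℝ) : ℂ) • gen μ e π ξ a g (vacuum μ) := by
  classical
  rw [gen_vacuum]
  ext1
  funext k
  rw [multiplier_apply, lp.coeFn_smul, Pi.smul_apply]
  by_cases h : k = g
  · rw [h]
  · rw [lp.single_apply_ne _ _ _ h, smul_zero, smul_zero]

theorem diagOmega_gen (θ : Γ → H) (ξ : H) (a : Lp ℂ ∞ μ) (g : Γ) :
    diagOmega μ e θ (gen μ e π ξ a g (vacuum μ)) =
      gen μ e π (π g (θ g) + ξ) a g (vacuum μ) := by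
  have h_opD : gen μ e π (π g (θ g) + ξ) a g = opD μ e π (π g (θ g)) * gen μ e π ξ a g := by
    rw [gen, gen, ← opD_mul]
    simp only [mul_assoc]
  rw [h_opD, mul_apply_eq_comp]
  classical
  rw [gen_vacuum, opD, diagOmega, diagOmega, diag_single, diag_single, inv_apply_apply]

theorem gen_mul_opD (ξ ζ : H) (a : Lp ℂ ∞ μ) (g : Γ) :
    gen μ e π ξ a g * opD μ e π ζ = gen μ e π (π g ζ + ξ) a g := by
  calc opD μ e π ξ * opA μ a * u μ g * opD μ e π ζ
      = opD μ e π ξ * (opA μ a * opD μ e π (π g ζ)) * u μ g := by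
        rw [mul_assoc, u_mul_opD]; simp only [mul_assoc]
    _ = opD μ e π (π g ζ + ξ) * opA μ a * u μ g := by
        rw [← opD_comm_opA, ← mul_assoc, opD_mul, add_comm]

theorem gen_mul_u (ξ : H) (a : Lp ℂ ∞ μ) (g h : Γ) :
    gen μ e π ξ a g * u μ h = gen μ e π ξ a (g * h) := by
  rw [gen, gen, mul_assoc, u_mul]

/-- The closed span of the vectors `(ω(ξ) ⊗ a) u_g Ω` with `ξ ∈ V`, where `Ω` is the vacuum. -/
def vecSpan (V : Submodule ℝ H) : Submodule ℂ (Space Γ μ ι) :=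
  ((genSpan μ e π V).map
    (ContinuousLinearMap.apply ℂ (Space Γ μ ι) (vacuum μ)).toLinearMap).topologicalClosure

theorem isClosed_vecSpan (V : Submodule ℝ H) : IsClosed (vecSpan μ e π V : Set (Space Γ μ ι)) :=
  Submodule.isClosed_topologicalClosure _

instance (V : Submodule ℝ H) : (vecSpan μ e π V).HasOrthogonalProjection := by
  unfold vecSpan; infer_instance

variable {π} {V : Submodule ℝ H}

theorem apply_vacuum_mem_vecSpan {y : Space Γ μ ι →L[ℂ] Space Γ μ ι}
    (hy : y ∈ genSpan μ e π V) : y (vacuum μ) ∈ vecSpan μ e π V :=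
  subset_closure ⟨y, hy, rfl⟩

theorem gen_vacuum_mem_vecSpan {ξ : H} (hξ : ξ ∈ V) (a : Lp ℂ ∞ μ) (g : Γ) :
    gen μ e π ξ a g (vacuum μ) ∈ vecSpan μ e π V :=
  apply_vacuum_mem_vecSpan μ e (gen_mem_genSpan μ e hξ a g)

theorem vecSpan_le {L : Submodule ℂ (Space Γ μ ι)} (hL : IsClosed (L : Set (Space Γ μ ι)))
    (h : ∀ ξ ∈ V, ∀ a g, gen μ e π ξ a g (vacuum μ) ∈ L) : vecSpan μ e π V ≤ L :=
  Submodule.topologicalClosure_minimal _ (Submodule.map_le_iff_le_comap.2 (genSpan_le μ e h)) hL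

theorem vecSpan_mono {V' : Submodule ℝ H} (h : V ≤ V') : vecSpan μ e π V ≤ vecSpan μ e π V' :=
  vecSpan_le μ e (isClosed_vecSpan μ e π V') fun _ hξ => gen_vacuum_mem_vecSpan μ e (h hξ)

theorem apply_mem_of_gen {L : Submodule ℂ (Space Γ μ ι)} (hL : IsClosed (L : Set (Space Γ μ ι)))
    (T : Space Γ μ ι →L[ℂ] Space Γ μ ι)
    (h : ∀ ξ ∈ V, ∀ a g, T (gen μ e π ξ a g (vacuum μ)) ∈ L) {f : Space Γ μ ι}
    (hf : f ∈ vecSpan μ e π V) : T f ∈ L :=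
  vecSpan_le μ e (L := L.comap T.toLinearMap) (hL.preimage T.continuous) h hf

theorem apply_eq_of_gen {S T : Space Γ μ ι →L[ℂ] Space Γ μ ι}
    (h : ∀ ξ ∈ V, ∀ a g, S (gen μ e π ξ a g (vacuum μ)) = T (gen μ e π ξ a g (vacuum μ)))
    {f : Space Γ μ ι} (hf : f ∈ vecSpan μ e π V) : S f = T f := by
  have h_mem := apply_mem_of_gen μ e (L := ⊥) isClosed_singleton (S - T)
    (fun ξ hξ a g => by simp [h ξ hξ a g]) hf
  exact sub_eq_zero.1 h_mem

theorem inner_eq_of_gen {V' : Submodule ℝ H} {S T : Space Γ μ ι →L[ℂ] Space Γ μ ι}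
    (h : ∀ ξ ∈ V, ∀ a g, ∀ ξ' ∈ V', ∀ a' g',
      inner ℂ (gen μ e π ξ a g (vacuum μ)) (S (gen μ e π ξ' a' g' (vacuum μ))) =
        inner ℂ (gen μ e π ξ a g (vacuum μ)) (T (gen μ e π ξ' a' g' (vacuum μ))))
    {f f' : Space Γ μ ι} (hf : f ∈ vecSpan μ e π V) (hf' : f' ∈ vecSpan μ e π V') :
    inner ℂ f (S f') = inner ℂ f (T f') := by
  have h_orthogonal : (S - T) f' ∈ (vecSpan μ e π V)ᗮ := by
    refine apply_mem_of_gen μ e (Submodule.isClosed_orthogonal _) (S - T)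
      (fun ξ' hξ' a' g' => ?_) hf'
    rw [Submodule.mem_orthogonal']
    intro k hk
    have h_le : vecSpan μ e π V ≤ (ℂ ∙ (S - T) (gen μ e π ξ' a' g' (vacuum μ)))ᗮ := by
      refine vecSpan_le μ e (Submodule.isClosed_orthogonal _) fun ξ hξ a g => ?_
      rw [Submodule.mem_orthogonal_singleton_iff_inner_left, sub_apply, inner_sub_right,
        h ξ hξ a g ξ' hξ' a' g', sub_self]
    exact Submodule.mem_orthogonal_singleton_iff_inner_right.1 (h_le hk)
  simpa [inner_sub_right, sub_eq_zero] using h_orthogonal f hf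

theorem multiplier_mem_vecSpan (κ : Γ → unitInterval) {f : Space Γ μ ι}
    (hf : f ∈ vecSpan μ e π V) : multiplier κ f ∈ vecSpan μ e π V := by
  refine apply_mem_of_gen μ e (isClosed_vecSpan μ e π V) (multiplier κ) (fun ξ hξ a g => ?_) hf
  rw [multiplier_gen]
  exact Submodule.smul_mem _ _ (gen_vacuum_mem_vecSpan μ e hξ a g)

theorem fibreRestrict_mem_vecSpan (F : Set Γ) {f : Space Γ μ ι}
    (hf : f ∈ vecSpan μ e π V) : fibreRestrict F f ∈ vecSpan μ e π V :=
  multiplier_mem_vecSpan μ e _ hf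

theorem diagOmega_mem_vecSpan {θ : Γ → H} (hθ : ∀ g, π g (θ g) ∈ V) {f : Space Γ μ ι}
    (hf : f ∈ vecSpan μ e π V) : diagOmega μ e θ f ∈ vecSpan μ e π V := by
  refine apply_mem_of_gen μ e (isClosed_vecSpan μ e π V) _ (fun ξ hξ a g => ?_) hf
  rw [diagOmega_gen]
  exact gen_vacuum_mem_vecSpan μ e (V.add_mem (hθ g) hξ) a g

theorem genSpan_apply_mem_vecSpan {y : Space Γ μ ι →L[ℂ] Space Γ μ ι}
    (hy : y ∈ genSpan μ e π V) {f : Space Γ μ ι} (hf : f ∈ vecSpan μ e π ⊥) :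
    y f ∈ vecSpan μ e π V := by
  refine apply_mem_of_gen μ e (isClosed_vecSpan μ e π V) y (fun ξ hξ a g => ?_) hf
  exact apply_vacuum_mem_vecSpan μ e (mul_mem_genSpan μ e π bot_le (map_mem_bot π) hy
    (gen_mem_genSpan μ e hξ a g))

/-- The weight `g ↦ exp(-‖θ g‖²)`; since `ω(ζ)` has mean `exp(-‖ζ‖²)`, it is the compression of
`diagOmega μ e θ` to vectors that do not involve the directions `π g (θ g)`. -/
def gaussWeight (θ : Γ → H) (g : Γ) : unitInterval :=
  ⟨Real.exp (-‖θ g‖ ^ 2), (Real.exp_pos _).le, Real.exp_le_one_iff.2 (by simp)⟩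

theorem coe_gaussWeight {Γ H : Type*} [NormedAddCommGroup H] (θ : Γ → H) (g : Γ) :
    (gaussWeight θ g : ℝ) = Real.exp (-‖θ g‖ ^ 2) := rfl

theorem inner_gen_diagOmega_gen {θ : Γ → H} {ξ ξ' : H} {g' : Γ}
    (h : inner ℝ (π g' (θ g')) (ξ - ξ') = 0) (a a' : Lp ℂ ∞ μ) (g : Γ) :
    inner ℂ (gen μ e π ξ a g (vacuum μ)) (diagOmega μ e θ (gen μ e π ξ' a' g' (vacuum μ))) =
      inner ℂ (gen μ e π ξ a g (vacuum μ))
        (multiplier (gaussWeight θ) (gen μ e π ξ' a' g' (vacuum μ))) := by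
  rw [diagOmega_gen, multiplier_gen, inner_smul_right]
  rcases eq_or_ne g g' with rfl | hg
  · have h_norm : ‖ξ - (π g (θ g) + ξ')‖ ^ 2 = ‖θ g‖ ^ 2 + ‖ξ - ξ'‖ ^ 2 := by
      rw [add_comm, ← sub_sub, norm_sub_sq_real, real_inner_comm, h, LinearIsometryEquiv.norm_map]
      ring
    rw [inner_gen_same, inner_gen_same, h_norm, gaussWeight, neg_add, Real.exp_add]
    push_cast
    ring
  · rw [inner_gen_of_ne _ _ _ _ _ _ _ hg, inner_gen_of_ne _ _ _ _ _ _ _ hg, mul_zero]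

theorem inner_fibreRestrict_diagOmega {θ : Γ → H} {F : Set Γ}
    (h : ∀ g ∈ F, ∀ ξ ∈ V, inner ℝ (π g (θ g)) ξ = 0) {f f' : Space Γ μ ι}
    (hf : f ∈ vecSpan μ e π V) (hf' : f' ∈ vecSpan μ e π V) :
    inner ℂ (fibreRestrict F f) (diagOmega μ e θ f') =
      inner ℂ (fibreRestrict F f) (multiplier (gaussWeight θ) f') := by
  rw [fibreRestrict, inner_multiplier_left, inner_multiplier_left]
  refine inner_eq_of_gen μ e (S := multiplier (F.indicator 1) ∘L diagOmega μ e θ)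
    (T := multiplier (F.indicator 1) ∘L multiplier (gaussWeight θ))
    (fun ξ hξ a g ξ' hξ' a' g' => ?_) hf hf'
  rw [ContinuousLinearMap.comp_apply, ContinuousLinearMap.comp_apply, diagOmega_gen,
    multiplier_gen μ e π (gaussWeight θ), map_smul, multiplier_gen, multiplier_gen, smul_comm,
    ← diagOmega_gen, ← multiplier_gen μ e π (gaussWeight θ), inner_smul_right, inner_smul_right]
  by_cases hg : g' ∈ F
  · rw [inner_gen_diagOmega_gen μ e (h g' hg _ (V.sub_mem hξ hξ'))]
  · simp [hg]

theorem inner_diagOmega {θ : Γ → H} (h : ∀ g, ∀ ξ ∈ V, inner ℝ (π g (θ g)) ξ = 0)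
    {f f' : Space Γ μ ι} (hf : f ∈ vecSpan μ e π V) (hf' : f' ∈ vecSpan μ e π V) :
    inner ℂ f (diagOmega μ e θ f') = inner ℂ f (multiplier (gaussWeight θ) f') :=
  inner_eq_of_gen μ e (fun _ hξ a g _ hξ' a' g' =>
    inner_gen_diagOmega_gen μ e (h g' _ (V.sub_mem hξ hξ')) a a' g) hf hf'

end VecSpan

section RightMultiplicationVecSpan

variable {Γ X ι H : Type*} [MeasurableSpace X] (μ : Measure X) [IsProbabilityMeasure μ]
  [NormedAddCommGroup H] [InnerProductSpace ℝ H] [Group Γ]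
  [MulAction Γ X] [MeasurableConstSMul Γ X] [SMulInvariantMeasure Γ X μ]
  (e : HilbertBasis ι ℝ H) (π : Γ →* (H ≃ₗᵢ[ℝ] H))

theorem vecSpan_le_cyclicSpace (V : Submodule ℝ H) :
    vecSpan μ e π V ≤ cyclicSpace (algMtilde μ e π) (vacuum μ) :=
  vecSpan_le μ e (Submodule.isClosed_topologicalClosure _) fun ξ _ a g =>
    orbitMap_mem_cyclicSpace _ _ ⟨_, gen_mem_algMtilde μ e ξ a g⟩

theorem apply_vacuum_mem_vecSpan_of_mem_bicommutant {V : Submodule ℝ H}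
    {hV : ∀ g, ∀ ξ ∈ V, π g ξ ∈ V} {x : Space Γ μ ι →L[ℂ] Space Γ μ ι}
    (hx : x ∈ Set.centralizer (Set.centralizer
      (genAlg μ e π V hV : Set (Space Γ μ ι →L[ℂ] Space Γ μ ι)))) :
    x (vacuum μ) ∈ vecSpan μ e π V := by
  refine Metric.mem_closure_iff.2 fun ε hε => ?_
  obtain ⟨y, hy, h⟩ := exists_forall_norm_sub_lt_of_mem_bicommutant _ hx ![vacuum μ] hε
  exact ⟨y (vacuum μ), ⟨y, hy, rfl⟩, by simpa [dist_eq_norm] using h 0⟩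

theorem apply_vacuum_mem_vecSpan_bot {x : Space Γ μ ι →L[ℂ] Space Γ μ ι} (hx : x ∈ algM Γ μ ι) :
    x (vacuum μ) ∈ vecSpan μ e π ⊥ :=
  apply_vacuum_mem_vecSpan_of_mem_bicommutant μ e π (mem_bicommutant_of_mem_algM μ e π hx)

variable {π}

theorem rightMul_gen {T : Space Γ μ ι →L[ℂ] Space Γ μ ι} (hT : T ∈ algMtilde μ e π)
    (ξ : H) (a : Lp ℂ ∞ μ) (g : Γ) :
    rightMul (algMtilde μ e π) (vacuum μ) T (gen μ e π ξ a g (vacuum μ)) =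
      (gen μ e π ξ a g * T) (vacuum μ) :=
  (isTraceVector_vacuum μ e π).rightMul_apply (gen_mem_algMtilde μ e ξ a g) hT

theorem opD_mem_algMtilde (ζ : H) : opD μ e π ζ ∈ algMtilde μ e π :=
  algDA_le μ e (opD_mem_algDA μ e ζ)

theorem rightMul_opD_apply (ζ : H) {f : Space Γ μ ι} (hf : f ∈ vecSpan μ e π ⊤) :
    rightMul (algMtilde μ e π) (vacuum μ) (opD μ e π ζ) f = diagOmega μ e (fun _ => ζ) f := by
  refine apply_eq_of_gen μ e (fun ξ _ a g => ?_) hf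
  rw [rightMul_gen μ e (opD_mem_algMtilde μ e ζ), gen_mul_opD, diagOmega_gen]

theorem rightMul_mem_vecSpan {Q : Space Γ μ ι →L[ℂ] Space Γ μ ι} (hQ : Q ∈ algM Γ μ ι)
    {V : Submodule ℝ H} {f : Space Γ μ ι} (hf : f ∈ vecSpan μ e π V) :
    rightMul (algMtilde μ e π) (vacuum μ) Q f ∈ vecSpan μ e π V := by
  refine apply_mem_of_gen μ e (isClosed_vecSpan μ e π V) _ (fun ξ hξ a g => ?_) hf
  rw [rightMul_gen μ e (algM_le μ e hQ)]
  exact genSpan_apply_mem_vecSpan μ e (gen_mem_genSpan μ e hξ a g)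
    (apply_vacuum_mem_vecSpan_bot μ e π hQ)

theorem fibreRestrict_one_rightMul_star_u (g : Γ) {f : Space Γ μ ι}
    (hf : f ∈ vecSpan μ e π ⊥) :
    fibreRestrict {1} (rightMul (algMtilde μ e π) (vacuum μ) (star (u μ g)) f) =
      rightMul (algMtilde μ e π) (vacuum μ) (star (u μ g)) (fibreRestrict {g} f) := by
  refine apply_eq_of_gen μ e
    (S := fibreRestrict {1} ∘L rightMul (algMtilde μ e π) (vacuum μ) (star (u μ g)))
    (T := rightMul (algMtilde μ e π) (vacuum μ) (star (u μ g)) ∘L fibreRestrict {g})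
    (fun ξ _ a h => ?_) hf
  have h_weight : ({1} : Set Γ).indicator (1 : Γ → unitInterval) (h * g⁻¹) =
      ({g} : Set Γ).indicator 1 h := by
    classical
    simp only [Set.indicator_apply, Set.mem_singleton_iff, mul_inv_eq_one, Pi.one_apply]
  rw [ContinuousLinearMap.comp_apply, ContinuousLinearMap.comp_apply, fibreRestrict,
    fibreRestrict, multiplier_gen, map_smul, rightMul_gen μ e (star_mem (u_mem μ e g)), star_u,
    gen_mul_u, multiplier_gen, h_weight]

theorem fibreRestrict_one_mem_L2A {f : Space Γ μ ι} (hf : f ∈ vecSpan μ e π ⊥) :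
    fibreRestrict {1} f ∈ L2A Γ μ ι := by
  refine apply_mem_of_gen μ e (Submodule.isClosed_topologicalClosure _) _ (fun ξ hξ a g => ?_) hf
  rw [fibreRestrict, multiplier_gen]
  by_cases hg : g = 1
  · rw [(Submodule.mem_bot ℝ).1 hξ, hg, ← opA_eq_gen]
    exact Submodule.smul_mem _ _ (subset_closure (Submodule.subset_span ⟨a, rfl⟩))
  · simp [hg]

variable (π) in
include e π in
theorem norm_apply_le_norm_fourierCoefficient {x : Space Γ μ ι →L[ℂ] Space Γ μ ι}
    (hx : x ∈ algM Γ μ ι) (g : Γ) : ‖x (vacuum μ) g‖ ≤ ‖fourierCoefficient μ x g‖ := by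
  have hΩ := isTraceVector_vacuum μ e π
  have hx_vec := apply_vacuum_mem_vecSpan_bot μ e π hx
  have hu : star (u (ι := ι) μ g) ∈ algMtilde μ e π := star_mem (u_mem μ e g)
  set y := (x * star (u (ι := ι) μ g)) (vacuum μ)
  have hy_vec : y ∈ vecSpan μ e π ⊥ :=
    apply_vacuum_mem_vecSpan_bot μ e π
      (mul_mem hx (star_mem (subset_vnGen _ (Or.inr ⟨g, rfl⟩))))
  have hy : rightMul (algMtilde μ e π) (vacuum μ) (star (u μ g)) (x (vacuum μ)) = y :=
    hΩ.rightMul_apply (algM_le μ e hx) hu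
  have hu_unitary : star (u μ g) * star (star (u (ι := ι) μ g)) = 1 := by
    rw [star_star, star_u, u_mul, inv_mul_cancel, u_one]
  have h_norm : ‖fibreRestrict {g} (x (vacuum μ))‖ = ‖fibreRestrict {1} y‖ := by
    rw [← hy, fibreRestrict_one_rightMul_star_u μ e g hx_vec,
      hΩ.norm_rightMul_apply_of_mul_star_self hu hu_unitary
        (vecSpan_le_cyclicSpace μ e π ⊥ (fibreRestrict_mem_vecSpan μ e _ hx_vec))]
  have h_le : ‖fibreRestrict {1} y‖ ≤ ‖fourierCoefficient μ x g‖ :=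
    norm_multiplier_apply_le_norm_starProjection (fibreRestrict_one_mem_L2A μ e hy_vec)
  have h_single := norm_fibreRestrict_sq {g} (x (vacuum μ))
  rw [Finset.coe_singleton, Finset.sum_singleton] at h_single
  rw [← (sq_eq_sq₀ (norm_nonneg _) (norm_nonneg _)).1 h_single, h_norm]
  exact h_le

end RightMultiplicationVecSpan

theorem norm_starProjection_orthogonal_map_le {E : Type*} [NormedAddCommGroup E]
    [InnerProductSpace ℂ E] {L : Submodule ℂ E} [L.HasOrthogonalProjection] {T : E →L[ℂ] E} {C : ℝ}
    (hT : ∀ f ∈ L, T f ∈ L) (hC : ∀ f, ‖T f‖ ≤ C * ‖f‖) (f : E) :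
    ‖Lᗮ.starProjection (T f)‖ ≤ C * ‖Lᗮ.starProjection f‖ := by
  have h_zero : Lᗮ.starProjection (T (L.starProjection f)) = 0 :=
    (Submodule.starProjection_apply_eq_zero_iff _).2
      (Submodule.le_orthogonal_orthogonal L (hT _ (Submodule.starProjection_apply_mem L f)))
  calc ‖Lᗮ.starProjection (T f)‖
      = ‖Lᗮ.starProjection (T (Lᗮ.starProjection f))‖ := by
        conv_lhs => rw [← L.starProjection_add_starProjection_orthogonal f]
        rw [map_add, map_add, h_zero, zero_add]
    _ ≤ ‖T (Lᗮ.starProjection f)‖ := Submodule.norm_starProjection_apply_le _ _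
    _ ≤ C * ‖Lᗮ.starProjection f‖ := hC _

theorem norm_diagOmega_apply {Γ X H ι : Type*} [MeasurableSpace X] (μ : Measure X)
    [IsProbabilityMeasure μ] [NormedAddCommGroup H] [InnerProductSpace ℝ H] (e : HilbertBasis ι ℝ H)
    (θ : Γ → H) (f : Space Γ μ ι) : ‖diagOmega μ e θ f‖ = ‖f‖ :=
  norm_apply_of_star_mul_self_eq_one
    (by rw [star_diagOmega, diagOmega_mul, neg_add_cancel, diagOmega_zero]) f

section Mixing

variable {Γ H : Type*} [NormedAddCommGroup H] [InnerProductSpace ℝ H] [Group Γ]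
  (π : Γ →* (H ≃ₗᵢ[ℝ] H)) (K : Submodule ℝ H) [FiniteDimensional ℝ K] (ζ : H)

/-- The vector field `g ↦ π g⁻¹ (P_K (π g ζ))`: the part of `ζ` that `π g` moves into `K`. -/
def projField (g : Γ) : H := π g⁻¹ (K.starProjection (π g ζ))

variable {π}

theorem tendsto_norm_projField
    (hπ : ∀ ξ η : H, Tendsto (fun g : Γ => inner ℝ (π g ξ) η) cofinite (𝓝 0)) :
    Tendsto (fun g => ‖projField π K ζ g‖) cofinite (𝓝 0) := by
  let b := stdOrthonormalBasis ℝ K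
  have h_expand : ∀ g, projField π K ζ g = π g⁻¹ (∑ i, inner ℝ (π g ζ) (b i) • (b i : H)) := by
    intro g
    rw [projField]
    congr 1
    simpa [real_inner_comm] using
      congrArg Subtype.val (b.sum_repr' (K.orthogonalProjectionOnto (π g ζ))).symm
  have h_sum : Tendsto (fun g => ∑ i, inner ℝ (π g ζ) (b i : H) • (b i : H)) cofinite (𝓝 0) := by
    simpa using tendsto_finsetSum Finset.univ fun i _ => (hπ ζ (b i)).smul_const (b i : H)
  simpa only [h_expand, LinearIsometryEquiv.norm_map, norm_zero] using h_sum.norm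

theorem tendsto_gaussWeight_projField
    (hπ : ∀ ξ η : H, Tendsto (fun g : Γ => inner ℝ (π g ξ) η) cofinite (𝓝 0)) :
    Tendsto (fun g => (gaussWeight (projField π K ζ) g : ℝ)) cofinite (𝓝 1) := by
  change Tendsto (fun g => Real.exp (-‖projField π K ζ g‖ ^ 2)) cofinite (𝓝 1)
  simpa using ((tendsto_norm_projField K ζ hπ).pow 2).neg.rexp

variable {X ι : Type*} [MeasurableSpace X] (μ : Measure X) [IsProbabilityMeasure μ]
  [MulAction Γ X] [MeasurableConstSMul Γ X] [SMulInvariantMeasure Γ X μ]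
  (e : HilbertBasis ι ℝ H)

theorem norm_starProjection_diagOmega_sq_le {ρ : ℝ} {f : Space Γ μ ι}
    (hf : f ∈ vecSpan μ e π Kᗮ)
    (hρ : ∀ g, f g ≠ 0 → 1 - ρ ≤ gaussWeight (projField π K ζ) g) :
    ‖(vecSpan μ e π Kᗮ)ᗮ.starProjection (diagOmega μ e (fun _ => ζ) f)‖ ^ 2 ≤
      2 * ρ * ‖f‖ ^ 2 := by
  let θ : Γ → H := (fun _ => ζ) - projField π K ζ
  have h_mem : diagOmega μ e θ f ∈ vecSpan μ e π Kᗮ := by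
    refine diagOmega_mem_vecSpan μ e (fun g => ?_) hf
    change π g (ζ - projField π K ζ g) ∈ _
    rw [map_sub, projField, apply_inv_apply]
    exact K.sub_starProjection_mem_orthogonal _
  have h_zero : (vecSpan μ e π Kᗮ)ᗮ.starProjection (diagOmega μ e θ f) = 0 :=
    (Submodule.starProjection_apply_eq_zero_iff _).2 (Submodule.le_orthogonal_orthogonal _ h_mem)
  have h_inner : inner ℂ (diagOmega μ e θ f) (diagOmega μ e (fun _ => ζ) f) =
      inner ℂ f (multiplier (gaussWeight (projField π K ζ)) f) := by
    rw [← ContinuousLinearMap.adjoint_inner_right, ← ContinuousLinearMap.star_eq_adjoint,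
      star_diagOmega, ← mul_apply_eq_comp, diagOmega_mul, neg_sub, sub_add_cancel]
    refine inner_diagOmega μ e (fun g ξ hξ => ?_) hf hf
    rw [projField, apply_inv_apply]
    exact hξ _ (K.starProjection_apply_mem _)
  calc ‖(vecSpan μ e π Kᗮ)ᗮ.starProjection (diagOmega μ e (fun _ => ζ) f)‖ ^ 2
      = ‖(vecSpan μ e π Kᗮ)ᗮ.starProjection
          (diagOmega μ e θ f - diagOmega μ e (fun _ => ζ) f)‖ ^ 2 := by
        rw [map_sub, h_zero, zero_sub, norm_neg]
    _ ≤ ‖diagOmega μ e θ f - diagOmega μ e (fun _ => ζ) f‖ ^ 2 := by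
        gcongr
        exact Submodule.norm_starProjection_apply_le _ _
    _ = 2 * ‖f‖ ^ 2 - 2 * (inner ℂ f (multiplier (gaussWeight (projField π K ζ)) f)).re := by
        rw [norm_sub_sq (𝕜 := ℂ), h_inner, norm_diagOmega_apply, norm_diagOmega_apply]
        change _ - 2 * Complex.re _ + _ = _
        ring
    _ ≤ 2 * ρ * ‖f‖ ^ 2 := by linarith [le_re_inner_multiplier hρ]

/-- The corner from `vecSpan μ e π Kᗮ` to its orthogonal complement of right multiplication by `T`,
restricted to the fibres outside `F`. -/
def corner (T : Space Γ μ ι →L[ℂ] Space Γ μ ι) (F : Finset Γ) : Space Γ μ ι →L[ℂ] Space Γ μ ι :=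
  (vecSpan μ e π Kᗮ)ᗮ.starProjection ∘L rightMul (algMtilde μ e π) (vacuum μ) T ∘L
    fibreRestrict (F : Set Γ)ᶜ ∘L (vecSpan μ e π Kᗮ).starProjection

theorem tendsto_corner_opD
    (hπ : ∀ ξ η : H, Tendsto (fun g : Γ => inner ℝ (π g ξ) η) cofinite (𝓝 0)) :
    Tendsto (corner (π := π) K μ e (opD μ e π ζ)) atTop (𝓝 0) := by
  rw [Metric.tendsto_nhds]
  intro ε hε
  have h_finite : {g | ¬ 1 - ε ^ 2 / 8 ≤ gaussWeight (projField π K ζ) g}.Finite :=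
    (tendsto_gaussWeight_projField K ζ hπ).eventually_const_le (by nlinarith)
  filter_upwards [eventually_ge_atTop h_finite.toFinset] with F hF
  rw [dist_zero_right]
  refine (ContinuousLinearMap.opNorm_le_bound _ (half_pos hε).le fun f => ?_).trans_lt
    (half_lt_self hε)
  set k := fibreRestrict (F : Set Γ)ᶜ ((vecSpan μ e π Kᗮ).starProjection f)
  have hk : k ∈ vecSpan μ e π Kᗮ :=
    fibreRestrict_mem_vecSpan μ e _ (Submodule.starProjection_apply_mem _ f)
  have hk_norm : ‖k‖ ≤ ‖f‖ :=
    (norm_multiplier_apply_le _ _).trans (Submodule.norm_starProjection_apply_le _ f)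
  have hk_weight : ∀ g, k g ≠ 0 → 1 - ε ^ 2 / 8 ≤ gaussWeight (projField π K ζ) g := by
    intro g hg
    by_contra h
    refine hg (fibreRestrict_apply_of_notMem _ (Set.notMem_compl_iff.2 ?_))
    exact hF (h_finite.mem_toFinset.2 h)
  refine le_of_sq_le_sq ?_ (by positivity)
  calc ‖corner K μ e (opD μ e π ζ) F f‖ ^ 2
      = ‖(vecSpan μ e π Kᗮ)ᗮ.starProjection (diagOmega μ e (fun _ => ζ) k)‖ ^ 2 := by
        rw [← rightMul_opD_apply μ e ζ (vecSpan_mono μ e le_top hk)]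
        rfl
    _ ≤ 2 * (ε ^ 2 / 8) * ‖k‖ ^ 2 := norm_starProjection_diagOmega_sq_le K ζ μ e hk hk_weight
    _ ≤ 2 * (ε ^ 2 / 8) * ‖f‖ ^ 2 := by gcongr
    _ = (ε / 2 * ‖f‖) ^ 2 := by ring

theorem norm_starProjection_rightMul_le {Q : Space Γ μ ι →L[ℂ] Space Γ μ ι} (hQ : Q ∈ algM Γ μ ι)
    (V : Submodule ℝ H) (f : Space Γ μ ι) :
    ‖(vecSpan μ e π V)ᗮ.starProjection (rightMul (algMtilde μ e π) (vacuum μ) Q f)‖ ≤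
      ‖Q‖ * ‖(vecSpan μ e π V)ᗮ.starProjection f‖ :=
  norm_starProjection_orthogonal_map_le (fun _ => rightMul_mem_vecSpan μ e hQ)
    ((isTraceVector_vacuum μ e π).norm_rightMul_apply_le (algM_le μ e hQ)) f

theorem tendsto_corner
    (hπ : ∀ ξ η : H, Tendsto (fun g : Γ => inner ℝ (π g ξ) η) cofinite (𝓝 0))
    {T : Space Γ μ ι →L[ℂ] Space Γ μ ι} (hT : T ∈ genSpan μ e π ⊤) :
    Tendsto (corner (π := π) K μ e T) atTop (𝓝 0) := by
  have hΩ := isTraceVector_vacuum μ e π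
  induction hT using Submodule.span_induction with
  | mem T hT =>
    obtain ⟨ξ, -, a, g, rfl⟩ := hT
    have hQ : opA μ a * u μ g ∈ algM Γ μ ι :=
      mul_mem (subset_vnGen _ (Or.inl ⟨a, rfl⟩)) (subset_vnGen _ (Or.inr ⟨g, rfl⟩))
    refine squeeze_zero_norm
      (a := fun F => ‖opA μ a * u (ι := ι) μ g‖ * ‖corner K μ e (opD μ e π ξ) F‖)
      (fun F => ContinuousLinearMap.opNorm_le_bound _ (by positivity) fun f => ?_)
      (by simpa using (tendsto_corner_opD K ξ μ e hπ).norm.const_mul _)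
    rw [corner, gen, mul_assoc, hΩ.rightMul_mul (opD_mem_algMtilde μ e ξ) (algM_le μ e hQ)]
    refine (norm_starProjection_rightMul_le μ e hQ _ _).trans ?_
    rw [mul_assoc]
    gcongr
    exact ContinuousLinearMap.le_opNorm (corner K μ e (opD μ e π ξ) F) f
  | zero =>
    have h_rightMul : rightMul (algMtilde μ e π) (vacuum μ) 0 = 0 := by
      simpa only [zero_smul] using hΩ.rightMul_smul 0 (zero_mem (algMtilde μ e π))
    have h_corner : corner (π := π) K μ e 0 = fun _ => 0 := funext fun F => by
      rw [corner, h_rightMul, ContinuousLinearMap.zero_comp, ContinuousLinearMap.comp_zero]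
    rw [h_corner]
    exact tendsto_const_nhds
  | add S T hS hT ihS ihT =>
    have h_corner : corner (π := π) K μ e (S + T) =
        fun F => corner K μ e S F + corner K μ e T F := funext fun F => by
      rw [corner, hΩ.rightMul_add (mem_algMtilde_of_mem_genSpan μ e π hS)
        (mem_algMtilde_of_mem_genSpan μ e π hT), ContinuousLinearMap.add_comp,
        ContinuousLinearMap.comp_add]
      rfl
    simpa only [h_corner, add_zero] using ihS.add ihT
  | smul r T hT ih =>
    have h_corner : corner (π := π) K μ e (r • T) =
        fun F => r • corner K μ e T F := funext fun F => by
      rw [corner, hΩ.rightMul_smul r (mem_algMtilde_of_mem_genSpan μ e π hT),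
        ContinuousLinearMap.smul_comp, ContinuousLinearMap.comp_smul]
      rfl
    simpa only [h_corner, smul_zero] using ih.const_smul r

theorem exists_finset_norm_starProjection_rightMul_le
    (hπ : ∀ ξ η : H, Tendsto (fun g : Γ => inner ℝ (π g ξ) η) cofinite (𝓝 0))
    {T : Space Γ μ ι →L[ℂ] Space Γ μ ι} (hT : T ∈ genSpan μ e π ⊤) {ε : ℝ} (hε : 0 < ε) :
    ∃ F : Finset Γ, ∀ f ∈ vecSpan μ e π Kᗮ,
      ‖(vecSpan μ e π Kᗮ)ᗮ.starProjection (rightMul (algMtilde μ e π) (vacuum μ) T f)‖ ≤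
        ‖T‖ * ‖fibreRestrict F f‖ + ε * ‖f‖ := by
  obtain ⟨F, hF⟩ := ((Metric.tendsto_nhds.1 (tendsto_corner K μ e hπ hT)) ε hε).exists
  rw [dist_zero_right] at hF
  refine ⟨F, fun f hf => ?_⟩
  have h_corner : (vecSpan μ e π Kᗮ)ᗮ.starProjection (rightMul (algMtilde μ e π) (vacuum μ) T
      (fibreRestrict (F : Set Γ)ᶜ f)) = corner (π := π) K μ e T F f := by
    rw [corner]
    simp only [ContinuousLinearMap.comp_apply, Submodule.starProjection_eq_self_iff.2 hf]
  conv_lhs => rw [← fibreRestrict_add_fibreRestrict_compl F f]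
  rw [map_add, map_add, h_corner]
  refine (norm_add_le _ _).trans (add_le_add ?_ ?_)
  · exact (Submodule.norm_starProjection_apply_le _ _).trans
      ((isTraceVector_vacuum μ e π).norm_rightMul_apply_le
        (mem_algMtilde_of_mem_genSpan μ e π hT) _)
  · exact (ContinuousLinearMap.le_opNorm _ f).trans (by gcongr)

section Sequence

variable {α : Type*} {l : Filter α}
  {v : α → Space Γ μ ι →L[ℂ] Space Γ μ ι} (hvM : ∀ n, v n ∈ algM Γ μ ι) (hv_norm : ∀ n, ‖v n‖ ≤ 1)
  (hv_zero : ∀ g, Tendsto (fun n => ‖v n (vacuum μ) g‖) l (𝓝 0))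

include hvM hv_norm hv_zero

theorem tendsto_norm_starProjection_apply_genSpan
    (hπ : ∀ ξ η : H, Tendsto (fun g : Γ => inner ℝ (π g ξ) η) cofinite (𝓝 0))
    {T : Space Γ μ ι →L[ℂ] Space Γ μ ι} (hT : T ∈ genSpan μ e π ⊤) :
    Tendsto (fun n => ‖(vecSpan μ e π Kᗮ)ᗮ.starProjection (v n (T (vacuum μ)))‖) l (𝓝 0) := by
  have hΩ := isTraceVector_vacuum μ e π
  rw [Metric.tendsto_nhds]
  intro ε hε
  obtain ⟨F, hF⟩ := exists_finset_norm_starProjection_rightMul_le K μ e hπ hT (half_pos hε)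
  have h_fibres : Tendsto (fun n => ‖T‖ * ‖fibreRestrict F (v n (vacuum μ))‖) l (𝓝 0) := by
    simpa using (tendsto_norm_fibreRestrict hv_zero F).const_mul ‖T‖
  filter_upwards [h_fibres.eventually_lt_const (half_pos hε)] with n hn
  rw [dist_zero_right, norm_norm, ← hΩ.rightMul_apply (algM_le μ e (hvM n))
    (mem_algMtilde_of_mem_genSpan μ e π hT)]
  have h_vec : v n (vacuum μ) ∈ vecSpan μ e π Kᗮ :=
    vecSpan_mono μ e bot_le (apply_vacuum_mem_vecSpan_bot μ e π (hvM n))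
  have h_norm : ‖v n (vacuum μ)‖ ≤ 1 := by
    simpa only [norm_vacuum, mul_one] using (v n).le_of_opNorm_le (hv_norm n) (vacuum μ)
  calc _ ≤ ‖T‖ * ‖fibreRestrict F (v n (vacuum μ))‖ + ε / 2 * ‖v n (vacuum μ)‖ := hF _ h_vec
    _ < ε / 2 + ε / 2 * 1 := add_lt_add_of_lt_of_le hn (by gcongr)
    _ = ε := by ring

theorem tendsto_norm_starProjection_apply
    (hπ : ∀ ξ η : H, Tendsto (fun g : Γ => inner ℝ (π g ξ) η) cofinite (𝓝 0))
    {T : Space Γ μ ι →L[ℂ] Space Γ μ ι} (hT : T ∈ algMtilde μ e π) :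
    Tendsto (fun n => ‖(vecSpan μ e π Kᗮ)ᗮ.starProjection (v n (T (vacuum μ)))‖) l (𝓝 0) := by
  rw [Metric.tendsto_nhds]
  intro ε hε
  obtain ⟨c, hc, hTc⟩ := exists_forall_norm_sub_lt_of_mem_bicommutant _
    (mem_bicommutant_of_mem_algMtilde μ e π hT) ![vacuum μ] (half_pos hε)
  filter_upwards [(tendsto_norm_starProjection_apply_genSpan K μ e hvM hv_norm hv_zero hπ
    hc).eventually_lt_const (half_pos hε)] with n hn
  rw [dist_zero_right, norm_norm]
  calc ‖(vecSpan μ e π Kᗮ)ᗮ.starProjection (v n (T (vacuum μ)))‖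
      = ‖(vecSpan μ e π Kᗮ)ᗮ.starProjection (v n (T (vacuum μ) - c (vacuum μ))) +
          (vecSpan μ e π Kᗮ)ᗮ.starProjection (v n (c (vacuum μ)))‖ := by
        rw [← map_add, ← map_add, sub_add_cancel]
    _ ≤ ‖v n (T (vacuum μ) - c (vacuum μ))‖ +
          ‖(vecSpan μ e π Kᗮ)ᗮ.starProjection (v n (c (vacuum μ)))‖ :=
        (norm_add_le _ _).trans
          (add_le_add_left (Submodule.norm_starProjection_apply_le _ _) _)
    _ < ε / 2 + ε / 2 := by
        refine add_lt_add (((v n).le_of_opNorm_le (hv_norm n) _).trans_lt ?_) hn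
        rw [one_mul]
        exact hTc 0
    _ = ε := add_halves ε

theorem tendsto_norm_starProjection_conj
    (hπ : ∀ ξ η : H, Tendsto (fun g : Γ => inner ℝ (π g ξ) η) cofinite (𝓝 0))
    {T : Space Γ μ ι →L[ℂ] Space Γ μ ι} (hT : T ∈ algMtilde μ e π) :
    Tendsto (fun n => ‖(vecSpan μ e π Kᗮ)ᗮ.starProjection ((v n * T * star (v n)) (vacuum μ))‖)
      l (𝓝 0) := by
  refine squeeze_zero (fun n => norm_nonneg _) (fun n => ?_)
    (tendsto_norm_starProjection_apply K μ e hvM hv_norm hv_zero hπ hT)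
  have h_right : (v n * T * star (v n)) (vacuum μ) =
      rightMul (algMtilde μ e π) (vacuum μ) (star (v n)) ((v n * T) (vacuum μ)) :=
    ((isTraceVector_vacuum μ e π).rightMul_apply (mul_mem (algM_le μ e (hvM n)) hT)
      (algM_le μ e (star_mem (hvM n)))).symm
  rw [h_right]
  refine (norm_starProjection_rightMul_le μ e (star_mem (hvM n)) _ _).trans ?_
  exact mul_le_of_le_one_left (norm_nonneg _) ((norm_star (v n)).trans_le (hv_norm n))

end Sequence

end Mixing

section Exp

theorem hasDerivAt_exp_smul_mul_exp {A : Type*} [NormedRing A] [NormedAlgebra ℝ A]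
    [CompleteSpace A] (x y : A) (s : ℝ) :
    HasDerivAt (fun s : ℝ => NormedSpace.exp (s • x) * NormedSpace.exp ((1 - s) • y))
      (NormedSpace.exp (s • x) * ((x - y) * NormedSpace.exp ((1 - s) • y))) s := by
  have hy := (hasDerivAt_exp_smul_const' (𝕂 := ℝ) y (1 - s)).scomp s
    ((hasDerivAt_id s).const_sub 1)
  refine ((hasDerivAt_exp_smul_const (𝕂 := ℝ) x s).mul hy).congr_deriv ?_
  simp only [Function.comp_apply, neg_smul, one_smul, mul_neg, mul_assoc, sub_eq_add_neg,
    add_mul, mul_add, neg_mul]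

theorem exp_mem_closure {A : Type*} [NormedRing A] [NormedAlgebra ℂ A] [StarRing A]
    [StarModule ℂ A] [CompleteSpace A] (𝒜 : StarSubalgebra ℂ A) {x : A} (hx : x ∈ 𝒜) :
    NormedSpace.exp x ∈ closure (𝒜 : Set A) :=
  mem_closure_of_tendsto (NormedSpace.exp_series_hasSum_exp' (𝕂 := ℂ) x)
    (Eventually.of_forall fun _ =>
      sum_mem fun n _ => SMulMemClass.smul_mem _ (pow_mem hx n))

theorem intertwines_of_intertwines_exp {A : Type*} [NormedRing A] [NormedAlgebra ℝ A]
    [CompleteSpace A] {a a' w x : A}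
    (h : ∀ s : ℝ, a * NormedSpace.exp (s • x) * a' * w = w * NormedSpace.exp (s • x)) :
    a * x * a' * w = w * x := by
  have h_exp : HasDerivAt (fun s : ℝ => NormedSpace.exp (s • x)) x 0 := by
    simpa using hasDerivAt_exp_smul_const (𝕂 := ℝ) x (0 : ℝ)
  have h_left : HasDerivAt (fun s : ℝ => a * NormedSpace.exp (s • x) * a' * w)
      (a * x * a' * w) 0 := ((h_exp.const_mul a).mul_const a').mul_const w
  simp_rw [h] at h_left
  exact h_left.unique (h_exp.const_mul w)

variable {E : Type*} [NormedAddCommGroup E] [InnerProductSpace ℂ E] [CompleteSpace E]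

theorem exp_mem {N : VonNeumannAlgebra E} {x : E →L[ℂ] E} (hx : x ∈ N) :
    NormedSpace.exp x ∈ N :=
  mem_iff_commute_commutant.2 fun z hz =>
    Commute.exp_right (show Commute z x from mem_iff_commute_commutant.1 hx z hz)

theorem exp_I_smul_mem_unitary {h : E →L[ℂ] E} (hh : IsSelfAdjoint h) :
    NormedSpace.exp (Complex.I • h) ∈ unitary (E →L[ℂ] E) :=
  selfAdjoint.expUnitary_coe ⟨h, hh⟩ ▸ (selfAdjoint.expUnitary ⟨h, hh⟩).2

theorem norm_le_one_of_mem_unitary {x : E →L[ℂ] E} (hx : x ∈ unitary (E →L[ℂ] E)) : ‖x‖ ≤ 1 :=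
  x.opNorm_le_bound zero_le_one fun f => by
    rw [one_mul, norm_apply_of_star_mul_self_eq_one (Unitary.star_mul_self_of_mem hx)]

theorem norm_exp_smul_le_one {h : E →L[ℂ] E} (hh : IsSelfAdjoint h) (s : ℝ) :
    ‖NormedSpace.exp (s • Complex.I • h)‖ ≤ 1 := by
  rw [smul_comm]
  exact norm_le_one_of_mem_unitary (exp_I_smul_mem_unitary ((IsSelfAdjoint.all s).smul hh))

theorem norm_exp_sub_exp_apply_le {h k : E →L[ℂ] E} (hh : IsSelfAdjoint h) (f : E) {C : ℝ}
    (hC : ∀ s : ℝ, ‖(h - k) (NormedSpace.exp (s • Complex.I • k) f)‖ ≤ C) :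
    ‖NormedSpace.exp (Complex.I • h) f - NormedSpace.exp (Complex.I • k) f‖ ≤ C := by
  let evalAt : (E →L[ℂ] E) →L[ℝ] E := (ContinuousLinearMap.apply ℂ E f).restrictScalars ℝ
  have h_deriv := fun s : ℝ => evalAt.hasFDerivAt.comp_hasDerivAt s
    (hasDerivAt_exp_smul_mul_exp (Complex.I • h) (Complex.I • k) s)
  have h_bound : ∀ s : ℝ, ‖evalAt (NormedSpace.exp (s • Complex.I • h) *
      ((Complex.I • h - Complex.I • k) * NormedSpace.exp ((1 - s) • Complex.I • k)))‖ ≤ C := by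
    intro s
    refine ((NormedSpace.exp (s • Complex.I • h)).le_of_opNorm_le
      (norm_exp_smul_le_one hh s) _).trans ?_
    rw [one_mul, ← smul_sub]
    change ‖Complex.I • (h - k) (NormedSpace.exp ((1 - s) • Complex.I • k) f)‖ ≤ C
    rw [norm_smul, Complex.norm_I, one_mul]
    exact hC (1 - s)
  simpa [evalAt] using norm_image_sub_le_of_norm_deriv_le_segment_01'
    (fun s _ => (h_deriv s).hasDerivWithinAt) (fun s _ => h_bound s)

theorem IsTraceVector.norm_exp_sub_exp_apply_le {N : VonNeumannAlgebra E} {Ω : E}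
    (hΩ : IsTraceVector N Ω) {h k : E →L[ℂ] E} (hh : h ∈ N) (hk : k ∈ N)
    (hh_sa : IsSelfAdjoint h) (hk_sa : IsSelfAdjoint k) :
    ‖NormedSpace.exp (Complex.I • h) Ω - NormedSpace.exp (Complex.I • k) Ω‖ ≤ ‖h Ω - k Ω‖ := by
  refine GaussianDeformation.norm_exp_sub_exp_apply_le hh_sa _ fun s => ?_
  have h_exp : NormedSpace.exp (s • Complex.I • k) ∈ N := by
    rw [← Complex.coe_smul]
    exact exp_mem (SMulMemClass.smul_mem _ (SMulMemClass.smul_mem _ hk))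
  refine (hΩ.norm_apply_apply_le (sub_mem hh hk) h_exp).trans ?_
  exact mul_le_of_le_one_left (norm_nonneg _) (norm_exp_smul_le_one hk_sa s)

theorem IsTraceVector.exists_isSelfAdjoint_approx {N : VonNeumannAlgebra E} {Ω : E}
    (hΩ : IsTraceVector N Ω) (𝒜 : StarSubalgebra ℂ (E →L[ℂ] E)) (h𝒜 : ∀ x ∈ 𝒜, x ∈ N)
    {h : E →L[ℂ] E} (hhN : h ∈ N) (hh : h ∈ Set.centralizer (Set.centralizer (𝒜 : Set (E →L[ℂ] E))))
    (hh_sa : IsSelfAdjoint h) {ε : ℝ} (hε : 0 < ε) :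
    ∃ k ∈ 𝒜, IsSelfAdjoint k ∧ ‖h Ω - k Ω‖ < ε := by
  obtain ⟨c, hc, hhc⟩ := exists_forall_norm_sub_lt_of_mem_bicommutant 𝒜 hh ![Ω] hε
  refine ⟨(2⁻¹ : ℂ) • (c + star c), SMulMemClass.smul_mem _ (add_mem hc (star_mem hc)), ?_, ?_⟩
  · rw [IsSelfAdjoint, star_smul, star_add, star_star, add_comm]
    simp
  · have h_avg : h Ω - ((2⁻¹ : ℂ) • (c + star c)) Ω =
        (2⁻¹ : ℂ) • ((h - c) Ω + star (h - c) Ω) := by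
      rw [star_sub, hh_sa.star_eq, smul_apply, add_apply, sub_apply, sub_apply]
      module
    calc _ = 2⁻¹ * ‖(h - c) Ω + star (h - c) Ω‖ := by rw [h_avg, norm_smul]; norm_num
      _ ≤ 2⁻¹ * (‖(h - c) Ω‖ + ‖star (h - c) Ω‖) := by gcongr; exact norm_add_le _ _
      _ = ‖(h - c) Ω‖ := by rw [hΩ.norm_star_apply (sub_mem hhN (h𝒜 c hc))]; ring
      _ < ε := hhc 0

/-- A substitute for Kaplansky's density theorem: the exponential keeps the norm under control. -/
theorem IsTraceVector.exists_approx_exp {N : VonNeumannAlgebra E} {Ω : E}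
    (hΩ : IsTraceVector N Ω) (𝒜 : StarSubalgebra ℂ (E →L[ℂ] E)) (h𝒜 : ∀ x ∈ 𝒜, x ∈ N)
    {h : E →L[ℂ] E} (hhN : h ∈ N) (hh : h ∈ Set.centralizer (Set.centralizer (𝒜 : Set (E →L[ℂ] E))))
    (hh_sa : IsSelfAdjoint h) {ε : ℝ} (hε : 0 < ε) :
    ∃ y ∈ 𝒜, ‖y‖ ≤ 2 ∧ ‖NormedSpace.exp (Complex.I • h) Ω - y Ω‖ < ε := by
  obtain ⟨k, hk, hk_sa, hhk⟩ := hΩ.exists_isSelfAdjoint_approx 𝒜 h𝒜 hhN hh hh_sa (half_pos hε)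
  have hδ : 0 < min (ε / (2 * (‖Ω‖ + 1))) 1 := by positivity
  obtain ⟨y, hy, hky⟩ := Metric.mem_closure_iff.1 (exp_mem_closure 𝒜
    (SMulMemClass.smul_mem Complex.I hk)) _ hδ
  rw [dist_eq_norm, lt_min_iff] at hky
  refine ⟨y, hy, ?_, ?_⟩
  · have h_triangle := norm_sub_norm_le y (NormedSpace.exp (Complex.I • k))
    rw [norm_sub_rev] at h_triangle
    linarith [norm_le_one_of_mem_unitary (exp_I_smul_mem_unitary hk_sa), hky.2]
  · have h_apply : ‖NormedSpace.exp (Complex.I • k) Ω - y Ω‖ ≤ ε / 2 :=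
      calc _ ≤ ε / (2 * (‖Ω‖ + 1)) * ‖Ω‖ :=
            (NormedSpace.exp (Complex.I • k) - y).le_of_opNorm_le hky.1.le Ω
        _ = ε / 2 * (‖Ω‖ / (‖Ω‖ + 1)) := by field_simp
        _ ≤ ε / 2 := mul_le_of_le_one_right (half_pos hε).le
            (div_le_one_of_le₀ (by linarith) (by positivity))
    calc _ ≤ _ := norm_sub_le_norm_sub_add_norm_sub _ (NormedSpace.exp (Complex.I • k) Ω) _
      _ < ε := by linarith [hΩ.norm_exp_sub_exp_apply_le hhN (h𝒜 k hk) hh_sa hk_sa]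

end Exp

theorem exists_norm_minimal {F : Type*} [NormedAddCommGroup F] [InnerProductSpace ℝ F]
    [CompleteSpace F] {K : Set F} (h_ne : K.Nonempty) (h_closed : IsClosed K)
    (h_convex : Convex ℝ K) : ∃ f ∈ K, ∀ k ∈ K, ‖k‖ ≤ ‖f‖ → k = f := by
  obtain ⟨f, hf, h_min⟩ :=
    exists_norm_eq_iInf_of_complete_convex h_ne h_closed.isComplete h_convex 0
  refine ⟨f, hf, fun k hk hkf => ?_⟩
  have h_inner := (norm_eq_iInf_iff_real_inner_le_zero h_convex hf).1 h_min k hk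
  have h_sq := norm_add_sq_real f (k - f)
  rw [add_sub_cancel] at h_sq
  rw [zero_sub, inner_neg_left] at h_inner
  have h_norm : ‖k - f‖ ^ 2 ≤ 0 := by nlinarith [norm_nonneg k, norm_nonneg f]
  rwa [sq_nonpos_iff, norm_eq_zero, sub_eq_zero] at h_norm

section Intertwiner

variable {E : Type*} [NormedAddCommGroup E] [InnerProductSpace ℂ E]

theorem mul_mul_mem_convexHull {S : Set (E →L[ℂ] E)} {x y z : E →L[ℂ] E}
    (h : ∀ s ∈ S, x * s * y ∈ S) (hz : z ∈ convexHull ℝ S) : x * z * y ∈ convexHull ℝ S :=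
  convexHull_min (t := LinearMap.mulLeftRight ℝ (x, y) ⁻¹' convexHull ℝ S)
    (fun s hs => subset_convexHull ℝ S (h s hs))
    ((convex_convexHull ℝ S).linear_preimage _) hz

theorem le_re_inner_of_mem_closure_convexHull {Ω f : E} {S : Set (E →L[ℂ] E)} {δ : ℝ}
    (hS : ∀ s ∈ S, δ ≤ (inner ℂ Ω (s Ω)).re)
    (hf : f ∈ closure ((fun z : E →L[ℂ] E => z Ω) '' convexHull ℝ S)) :
    δ ≤ (inner ℂ Ω f).re := by
  have h_closed : IsClosed {f : E | δ ≤ (inner ℂ Ω f).re} :=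
    isClosed_le continuous_const (by fun_prop)
  refine closure_minimal ?_ h_closed hf
  rintro _ ⟨z, hz, rfl⟩
  let pairing : (E →L[ℂ] E) →ₗ[ℝ] ℝ :=
    Complex.reLm ∘ₗ ((innerSL ℂ Ω).comp (ContinuousLinearMap.apply ℂ E Ω)).restrictScalars ℝ
  exact convexHull_min (t := {z | δ ≤ pairing z}) hS
    (convex_halfSpace_ge pairing.isLinear δ) hz

variable [CompleteSpace E] {N : VonNeumannAlgebra E}

theorem mem_of_mem_convexHull {S : Set (E →L[ℂ] E)} (hS : ∀ s ∈ S, s ∈ N) {z : E →L[ℂ] E}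
    (hz : z ∈ convexHull ℝ S) : z ∈ N := by
  refine convexHull_min (t := (N : Set (E →L[ℂ] E))) hS (fun x hx y hy r s _ _ _ => ?_) hz
  rw [← Complex.coe_smul r, ← Complex.coe_smul s]
  exact add_mem (SMulMemClass.smul_mem (s := N) (r : ℂ) hx)
    (SMulMemClass.smul_mem (s := N) (s : ℂ) hy)

theorem norm_le_one_of_mem_convexHull {S : Set (E →L[ℂ] E)}
    (hS : ∀ s ∈ S, s ∈ unitary (E →L[ℂ] E)) {z : E →L[ℂ] E} (hz : z ∈ convexHull ℝ S) :
    ‖z‖ ≤ 1 := by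
  refine mem_closedBall_zero_iff.1 (convexHull_min (fun s hs => ?_) (convex_closedBall _ _) hz)
  exact mem_closedBall_zero_iff.2 (norm_le_one_of_mem_unitary (hS s hs))

theorem IsTraceVector.exists_mem_convexHull_invariant {Ω : E} (hΩ : IsTraceVector N Ω)
    {S : Set (E →L[ℂ] E)} (hS_ne : S.Nonempty) (hSN : ∀ s ∈ S, s ∈ N)
    (hS_unitary : ∀ s ∈ S, s ∈ unitary (E →L[ℂ] E)) :
    ∃ w ∈ N, w Ω ∈ closure ((fun z : E →L[ℂ] E => z Ω) '' convexHull ℝ S) ∧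
      ∀ x ∈ N, ∀ y ∈ N, ‖x‖ ≤ 1 → ‖y‖ ≤ 1 → (∀ s ∈ S, x * s * y ∈ S) → x * w * y = w := by
  let : InnerProductSpace ℝ E := InnerProductSpace.complexToReal
  let orbit : (E →L[ℂ] E) →ₗ[ℝ] E :=
    ((ContinuousLinearMap.apply ℂ E Ω).restrictScalars ℝ).toLinearMap
  obtain ⟨f, hf, h_min⟩ := exists_norm_minimal (K := closure (orbit '' convexHull ℝ S))
    (hS_ne.convexHull.image _).closure isClosed_closure
    ((convex_convexHull ℝ S).linear_image orbit).closure
  obtain ⟨p, hp, hpf⟩ := mem_closure_iff_seq_limit.1 hf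
  choose z hzS hz using hp
  obtain rfl : (fun n => z n Ω) = p := funext hz
  obtain ⟨w, hwN, hw⟩ := hΩ.exists_strong_limit (fun n => mem_of_mem_convexHull hSN (hzS n))
    (fun n => norm_le_one_of_mem_convexHull hS_unitary (hzS n)) hpf.cauchySeq
  obtain rfl : w Ω = f := tendsto_nhds_unique (hw Ω) hpf
  refine ⟨w, hwN, hf, fun x hx y hy hx_norm hy_norm h_inv => ?_⟩
  refine sub_eq_zero.1 (hΩ.eq_zero_of_apply_eq_zero
    (sub_mem (mul_mem (mul_mem hx hwN) hy) hwN) (sub_eq_zero.2 (h_min _ ?_ ?_)))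
  · exact mem_closure_of_tendsto ((x.continuous.tendsto _).comp (hw (y Ω)))
      (Eventually.of_forall fun n => ⟨_, mul_mul_mem_convexHull h_inv (hzS n), rfl⟩)
  · calc ‖x (w (y Ω))‖ ≤ 1 * ‖w (y Ω)‖ := x.le_of_opNorm_le hx_norm _
      _ ≤ ‖y‖ * ‖w Ω‖ := by rw [one_mul]; exact hΩ.norm_apply_apply_le hwN hy
      _ ≤ ‖w Ω‖ := mul_le_of_le_one_left (norm_nonneg _) hy_norm

/-- The element of minimal norm in the closed convex hull of the operators `V x V* x*`, `x ∈ G`,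
is fixed by `w ↦ V x V* w x*`. -/
theorem IsTraceVector.exists_intertwiner {Ω : E} (hΩ : IsTraceVector N Ω) {V : E →L[ℂ] E}
    (hV : V ∈ unitary (E →L[ℂ] E)) (hVΩ : star V Ω = Ω) {G : Submonoid (E →L[ℂ] E)}
    (hGN : ∀ x ∈ G, x ∈ N) (hVGN : ∀ x ∈ G, V * x * star V ∈ N)
    (hG : ∀ x ∈ G, x ∈ unitary (E →L[ℂ] E)) {δ : ℝ} (hδ : 0 < δ)
    (h_lower : ∀ x ∈ G, δ ≤ (inner ℂ (x Ω) (V (x Ω))).re) :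
    ∃ w ∈ N, w ≠ 0 ∧ ∀ x ∈ G, V * x * star V * w = w * x := by
  have h_conj_unitary : ∀ x ∈ G, V * x * star V ∈ unitary (E →L[ℂ] E) := fun x hx =>
    mul_mem (mul_mem hV (hG x hx)) (Unitary.star_mem hV)
  obtain ⟨w, hwN, hw_mem, hw⟩ := hΩ.exists_mem_convexHull_invariant
    (S := (fun x => V * x * star V * star x) '' G) ⟨_, 1, one_mem G, rfl⟩
    (by rintro _ ⟨x, hx, rfl⟩; exact mul_mem (hVGN x hx) (star_mem (hGN x hx)))
    (by rintro _ ⟨x, hx, rfl⟩; exact mul_mem (h_conj_unitary x hx) (Unitary.star_mem (hG x hx)))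
  refine ⟨w, hwN, ?_, fun x hx => ?_⟩
  · rintro rfl
    refine hδ.not_ge ((le_re_inner_of_mem_closure_convexHull ?_ hw_mem).trans_eq (by simp))
    rintro _ ⟨x, hx, rfl⟩
    have h_trace := hΩ.inner_apply_apply (one_mem N) (hVGN x hx) (hGN x hx)
    simp only [one_apply_eq_self, mul_apply_eq_comp, hVΩ] at h_trace
    exact (h_lower x hx).trans_eq congr(Complex.re $h_trace)
  · have h_fixed : V * x * star V * w * star x = w := by
      refine hw _ (hVGN x hx) _ (star_mem (hGN x hx))
        (norm_le_one_of_mem_unitary (h_conj_unitary x hx))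
        (norm_le_one_of_mem_unitary (Unitary.star_mem (hG x hx))) ?_
      rintro _ ⟨y, hy, rfl⟩
      refine ⟨x * y, mul_mem hx hy, ?_⟩
      have h_cancel : star V * (V * (y * (star V * (star y * star x)))) =
          y * (star V * (star y * star x)) := by
        rw [← mul_assoc, Unitary.star_mul_self_of_mem hV, one_mul]
      simp only [star_mul, mul_assoc, h_cancel]
    calc V * x * star V * w = V * x * star V * w * star x * x := by
          rw [mul_assoc _ (star x), Unitary.star_mul_self_of_mem (hG x hx), mul_one]
      _ = w * x := by rw [h_fixed]

end Intertwiner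

theorem Cocycle.map_one {Γ H : Type*} [Group Γ] [NormedAddCommGroup H] [InnerProductSpace ℝ H]
    {π : Γ →* (H ≃ₗᵢ[ℝ] H)} (b : Cocycle π) : b.toFun 1 = 0 := by
  have h := b.map_mul 1 1
  rw [_root_.map_one, mul_one] at h
  exact left_eq_add.1 h

section Compression

variable {Γ X ι H : Type*} [MeasurableSpace X] (μ : Measure X) [IsProbabilityMeasure μ]
  [Group Γ] [MulAction Γ X] [MeasurableConstSMul Γ X] [SMulInvariantMeasure Γ X μ]
  [NormedAddCommGroup H] [InnerProductSpace ℝ H]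
  (e : HilbertBasis ι ℝ H) {π : Γ →* (H ≃ₗᵢ[ℝ] H)} (b : Cocycle π) (t : ℝ)

omit [MulAction Γ X] [MeasurableConstSMul Γ X] [SMulInvariantMeasure Γ X μ] in
theorem implOp_mem_unitary : implOp μ e b t ∈ unitary (Space Γ μ ι →L[ℂ] Space Γ μ ι) := by
  rw [Unitary.mem_iff, star_implOp]
  exact ⟨implOp_neg_mul μ e b t, implOp_mul_neg μ e b t⟩

theorem implOp_gen (ξ : H) (a : Lp ℂ ∞ μ) (g : Γ) :
    implOp μ e b t (gen μ e π ξ a g (vacuum μ)) =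
      gen μ e π (t • b.toFun g + ξ) a g (vacuum μ) := by
  rw [implOp, diagOmega_gen, map_smul, apply_inv_apply]

theorem implOp_vacuum : implOp μ e b t (vacuum μ) = vacuum μ := by
  have h := implOp_gen μ e b t 0 (oneLinf μ) 1
  rwa [b.map_one, smul_zero, zero_add, gen_one] at h

theorem star_implOp_vacuum : star (implOp μ e b t) (vacuum μ) = vacuum μ := by
  rw [star_implOp, implOp_vacuum]

theorem implOp_conj_vacuum (x : Space Γ μ ι →L[ℂ] Space Γ μ ι) :
    (implOp μ e b t * x * star (implOp μ e b t)) (vacuum μ) = implOp μ e b t (x (vacuum μ)) :=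
  congr(implOp μ e b t (x $(star_implOp_vacuum μ e b t)))

theorem implOp_conj_gen (ξ : H) (a : Lp ℂ ∞ μ) (g : Γ) :
    implOp μ e b t * gen μ e π ξ a g * star (implOp μ e b t) =
      gen μ e π (t • b.toFun g + ξ) a g := by
  have h_DA := implOp_conj_of_mem_algDA μ e b t
    (mul_mem (opD_mem_algDA μ e (π := π) ξ) (opA_mem_algDA μ e a))
  have h_cancel : implOp μ e b (-t) * (implOp μ e b t * (u μ g * implOp μ e b (-t))) =
      u μ g * implOp μ e b (-t) := by
    rw [← mul_assoc, implOp_neg_mul, one_mul]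
  calc implOp μ e b t * gen μ e π ξ a g * star (implOp μ e b t)
      = (implOp μ e b t * (opD μ e π ξ * opA μ a) * star (implOp μ e b t)) *
          (implOp μ e b t * u μ g * star (implOp μ e b t)) := by
        simp only [gen, mul_assoc, star_implOp, h_cancel]
    _ = opD μ e π ξ * opA μ a * opD μ e π (t • b.toFun g) * u μ g := by
        rw [h_DA, implOp_conj_u, mul_assoc _ (opD μ e π (t • b.toFun g))]
    _ = gen μ e π (t • b.toFun g + ξ) a g := by
        rw [mul_assoc (opD μ e π ξ), ← opD_comm_opA, ← mul_assoc, opD_mul, add_comm, gen]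

theorem implOp_conj_mem_genSpan {V : Submodule ℝ H} {x : Space Γ μ ι →L[ℂ] Space Γ μ ι}
    (hx : x ∈ genSpan μ e π V) :
    implOp μ e b t * x * star (implOp μ e b t) ∈ genSpan μ e π ⊤ := by
  refine genSpan_le μ e (L := (genSpan μ e π ⊤).comap (LinearMap.mulLeftRight ℂ
    (implOp μ e b t, star (implOp μ e b t)))) (fun ξ _ a g => ?_) hx
  rw [Submodule.mem_comap, LinearMap.mulLeftRight_apply, implOp_conj_gen]
  exact gen_mem_genSpan μ e Submodule.mem_top a g

/-- The weight `g ↦ exp (-‖t b(g)‖²)`, so that `⟨u_g Ω, α_t(u_g) Ω⟩` is its value at `g`. -/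
def implWeight : Γ → unitInterval :=
  gaussWeight fun g => t • π g⁻¹ (b.toFun g)

theorem coe_implWeight (g : Γ) : (implWeight b t g : ℝ) = Real.exp (-‖t • b.toFun g‖ ^ 2) := by
  rw [implWeight, coe_gaussWeight, ← map_smul, LinearIsometryEquiv.norm_map]

theorem inner_fibreRestrict_implOp {F : Set Γ} {V : Submodule ℝ H}
    (h : ∀ g ∈ F, ∀ ξ ∈ V, inner ℝ (b.toFun g) ξ = 0) {f f' : Space Γ μ ι}
    (hf : f ∈ vecSpan μ e π V) (hf' : f' ∈ vecSpan μ e π V) :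
    inner ℂ (fibreRestrict F f) (implOp μ e b t f') =
      inner ℂ (fibreRestrict F f) (multiplier (implWeight b t) f') := by
  refine inner_fibreRestrict_diagOmega μ e (fun g hg ξ hξ => ?_) hf hf'
  rw [map_smul, apply_inv_apply, inner_smul_left, h g hg ξ hξ, mul_zero]

theorem inner_implOp {f f' : Space Γ μ ι} (hf : f ∈ vecSpan μ e π ⊥)
    (hf' : f' ∈ vecSpan μ e π ⊥) :
    inner ℂ f (implOp μ e b t f') = inner ℂ f (multiplier (implWeight b t) f') :=
  inner_diagOmega μ e (fun g ξ hξ => by rw [(Submodule.mem_bot ℝ).1 hξ, inner_zero_right]) hf hf'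

theorem inner_opD_left {ζ : H} {V : Submodule ℝ H} (hζ : ∀ ξ ∈ V, inner ℝ ζ ξ = 0)
    {f k : Space Γ μ ι} (hf : f ∈ vecSpan μ e π V) (hk : k ∈ vecSpan μ e π V) :
    inner ℂ (opD μ e π ζ f) k = Real.exp (-‖ζ‖ ^ 2) * inner ℂ f k := by
  have h_weight : multiplier (gaussWeight fun g => π g⁻¹ ζ) f =
      (Real.exp (-‖ζ‖ ^ 2) : ℂ) • f := by
    ext1
    funext g
    rw [multiplier_apply, coe_gaussWeight, LinearIsometryEquiv.norm_map]
    rfl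
  rw [← inner_conj_symm, opD, inner_diagOmega μ e (fun g ξ hξ => by
    rw [apply_inv_apply, hζ ξ hξ]) hk hf, h_weight, inner_conj_symm, inner_smul_left,
    Complex.conj_ofReal]

theorem gen_apply_mem_vecSpan {V V' : Submodule ℝ H} {g : Γ} (h : ∀ ξ ∈ V, π g ξ ∈ V')
    (a : Lp ℂ ∞ μ) {f : Space Γ μ ι} (hf : f ∈ vecSpan μ e π V) :
    gen μ e π 0 a g f ∈ vecSpan μ e π V' := by
  refine apply_mem_of_gen μ e (isClosed_vecSpan μ e π V') _ (fun ξ hξ a' g' => ?_) hf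
  rw [← mul_apply_eq_comp, gen_mul, zero_add]
  exact gen_vacuum_mem_vecSpan μ e (h ξ hξ) _ _

theorem inner_implOp_conj_gen {V : Submodule ℝ H} {g : Γ}
    (hg : ∀ ξ ∈ V, inner ℝ (b.toFun g) ξ = 0)
    (hg' : ∀ ξ ∈ V, inner ℝ (π g⁻¹ (b.toFun g)) ξ = 0) (a : Lp ℂ ∞ μ) {f k : Space Γ μ ι}
    (hf : f ∈ vecSpan μ e π V) (hk : k ∈ vecSpan μ e π V) :
    inner ℂ ((implOp μ e b t * gen μ e π 0 a g * star (implOp μ e b t)) f) k =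
      (implWeight b t g : ℝ) * inner ℂ (gen μ e π 0 a g f) k := by
  let V' : Submodule ℝ H := (Submodule.span ℝ {b.toFun g})ᗮ
  have h_mem {ξ : H} : ξ ∈ V' ↔ inner ℝ (b.toFun g) ξ = 0 :=
    Submodule.mem_orthogonal_singleton_iff_inner_right
  have h_gen : gen μ e π 0 a g f ∈ vecSpan μ e π V' := by
    refine gen_apply_mem_vecSpan μ e (fun ξ hξ => h_mem.2 ?_) a hf
    rw [← hg' ξ hξ, ← (π g).inner_map_map (π g⁻¹ _), apply_inv_apply]
  have h_factor : gen μ e π (t • b.toFun g) a g = opD μ e π (t • b.toFun g) * gen μ e π 0 a g := by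
    rw [gen, gen, opD_zero, one_mul, mul_assoc]
  rw [implOp_conj_gen, add_zero, h_factor, coe_implWeight]
  refine inner_opD_left μ e (fun ξ hξ => ?_) h_gen (vecSpan_mono μ e (fun ξ hξ => ?_) hk)
  · rw [inner_smul_left, h_mem.1 hξ, mul_zero]
  · exact h_mem.2 (hg ξ hξ)

theorem exists_compression {x : Space Γ μ ι →L[ℂ] Space Γ μ ι} (hx : x ∈ genSpan μ e π ⊥) :
    ∃ K : Submodule ℝ H, FiniteDimensional ℝ K ∧ ∃ y ∈ genSpan μ e π ⊥,
      y (vacuum μ) = multiplier (implWeight b t) (x (vacuum μ)) ∧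
      ∀ f ∈ vecSpan μ e π Kᗮ, ∀ k ∈ vecSpan μ e π Kᗮ,
        inner ℂ ((implOp μ e b t * x * star (implOp μ e b t)) f) k = inner ℂ (y f) k := by
  refine Submodule.span_induction ?_ ?_ ?_ ?_ hx
  · rintro _ ⟨ξ, hξ, a, g, rfl⟩
    obtain rfl := (Submodule.mem_bot ℝ).1 hξ
    have h_orth : ∀ η ∈ ({b.toFun g, π g⁻¹ (b.toFun g)} : Set H),
        ∀ ζ ∈ (Submodule.span ℝ {b.toFun g, π g⁻¹ (b.toFun g)})ᗮ, inner ℝ η ζ = 0 :=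
      fun η hη ζ hζ => (Submodule.mem_orthogonal _ _).1 hζ η (Submodule.subset_span hη)
    refine ⟨_, FiniteDimensional.span_of_finite ℝ (Set.toFinite {b.toFun g, π g⁻¹ (b.toFun g)}),
      ((implWeight b t g : ℝ) : ℂ) • gen μ e π 0 a g,
      Submodule.smul_mem _ _ (gen_mem_genSpan μ e (zero_mem _) a g), ?_, fun f hf k hk => ?_⟩
    · rw [multiplier_gen, smul_apply]
    · rw [smul_apply, inner_smul_left, Complex.conj_ofReal]
      exact inner_implOp_conj_gen μ e b t (h_orth _ (by simp)) (h_orth _ (by simp)) a hf hk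
  · exact ⟨⊥, inferInstance, 0, zero_mem _, by simp, fun f _ k _ => by simp⟩
  · rintro x x' _ _ ⟨K, hK, y, hy, hyΩ, h⟩ ⟨K', hK', y', hy', hyΩ', h'⟩
    refine ⟨K ⊔ K', inferInstance, y + y', add_mem hy hy', ?_, fun f hf k hk => ?_⟩
    · rw [add_apply, add_apply, map_add, hyΩ, hyΩ']
    · have h_le := vecSpan_mono μ e (π := π) (Submodule.orthogonal_le (le_sup_left : K ≤ K ⊔ K'))
      have h_le' := vecSpan_mono μ e (π := π) (Submodule.orthogonal_le (le_sup_right : K' ≤ K ⊔ K'))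
      rw [mul_add, add_mul, add_apply, add_apply, inner_add_left, inner_add_left,
        h f (h_le hf) k (h_le hk), h' f (h_le' hf) k (h_le' hk)]
  · rintro r x _ ⟨K, hK, y, hy, hyΩ, h⟩
    refine ⟨K, hK, r • y, Submodule.smul_mem _ _ hy, ?_, fun f hf k hk => ?_⟩
    · rw [smul_apply, smul_apply, map_smul, hyΩ]
    · rw [mul_smul_comm, smul_mul_assoc, smul_apply, smul_apply, inner_smul_left,
        inner_smul_left, h f hf k hk]

end Compression

theorem one_sub_sub_mul_norm_le_norm_inner {E : Type*} [NormedAddCommGroup E]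
    [InnerProductSpace ℂ E] {f p k : E} (hf : ‖f‖ = 1) :
    1 - ‖f - k‖ - ‖f - p‖ * ‖k‖ ≤ ‖inner ℂ p k‖ := by
  have h_expand : (1 : ℂ) = inner ℂ f (f - k) + inner ℂ (f - p) k + inner ℂ p k := by
    rw [inner_sub_right, inner_sub_left, inner_self_eq_norm_sq_to_K, hf]
    norm_num
  have h_norm := norm_add₃_le (a := inner ℂ f (f - k)) (b := inner ℂ (f - p) k)
    (c := inner ℂ p k)
  rw [← h_expand, norm_one] at h_norm
  have h_left := norm_inner_le_norm (𝕜 := ℂ) f (f - k)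
  have h_right := norm_inner_le_norm (𝕜 := ℂ) (f - p) k
  rw [hf, one_mul] at h_left
  linarith

section TraceVector

variable {E : Type*} [NormedAddCommGroup E] [InnerProductSpace ℂ E] [CompleteSpace E]
  {N : VonNeumannAlgebra E} {Ω : E} (hΩ : IsTraceVector N Ω)
include hΩ

theorem IsTraceVector.norm_apply_apply_sub_le {x x' y y' : E →L[ℂ] E} (hx : x ∈ N) (hx' : x' ∈ N)
    (hy' : y' ∈ N) (hx_norm : ‖x‖ ≤ 1) (hy'_norm : ‖y'‖ ≤ 1) :
    ‖x (y Ω) - x' (y' Ω)‖ ≤ ‖x Ω - x' Ω‖ + ‖y Ω - y' Ω‖ :=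
  calc ‖x (y Ω) - x' (y' Ω)‖ = ‖(x - x') (y' Ω) + x (y Ω - y' Ω)‖ := by
        rw [sub_apply, map_sub, add_comm, sub_add_sub_cancel]
    _ ≤ ‖y'‖ * ‖(x - x') Ω‖ + ‖x‖ * ‖y Ω - y' Ω‖ :=
        norm_add_le_of_le (hΩ.norm_apply_apply_le (sub_mem hx hx') hy') (x.le_opNorm _)
    _ ≤ ‖x Ω - x' Ω‖ + ‖y Ω - y' Ω‖ :=
        add_le_add (mul_le_of_le_one_left (norm_nonneg _) hy'_norm)
          (mul_le_of_le_one_left (norm_nonneg _) hx_norm)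

theorem IsTraceVector.norm_conj_apply_sub_le {v v' x : E →L[ℂ] E} (hv : v ∈ N) (hv' : v' ∈ N)
    (hx : x ∈ N) (hv_norm : ‖v‖ ≤ 1) (hv'_norm : ‖v'‖ ≤ 1) (hx_norm : ‖x‖ ≤ 1) :
    ‖(v * x * star v) Ω - (v' * x * star v') Ω‖ ≤ 2 * ‖v Ω - v' Ω‖ := by
  have h_left : ‖(v * x) Ω - (v' * x) Ω‖ ≤ ‖v Ω - v' Ω‖ := by
    have h := hΩ.norm_apply_apply_sub_le (y := x) hv hv' hx hv_norm hx_norm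
    rwa [sub_self, norm_zero, add_zero] at h
  have h_right : ‖star v Ω - star v' Ω‖ = ‖v Ω - v' Ω‖ := by
    rw [← sub_apply, ← star_sub, hΩ.norm_star_apply (sub_mem hv hv'), sub_apply]
  calc ‖(v * x * star v) Ω - (v' * x * star v') Ω‖
      ≤ ‖(v * x) Ω - (v' * x) Ω‖ + ‖star v Ω - star v' Ω‖ :=
        hΩ.norm_apply_apply_sub_le (mul_mem hv hx) (mul_mem hv' hx) (star_mem hv')
          ((norm_mul_le _ _).trans (mul_le_one₀ hv_norm (norm_nonneg _) hx_norm))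
          ((norm_star v').trans_le hv'_norm)
    _ ≤ 2 * ‖v Ω - v' Ω‖ := by linarith

theorem IsTraceVector.inner_conj_apply {v x y : E →L[ℂ] E} (hv : v ∈ N) (hx : x ∈ N) (hy : y ∈ N)
    (hvv : star v * v = 1) :
    inner ℂ ((v * x * star v) Ω) ((v * y * star v) Ω) = inner ℂ (x Ω) (y Ω) :=
  calc inner ℂ ((v * x * star v) Ω) ((v * y * star v) Ω)
      = inner ℂ (v (x (star v Ω))) (v (y (star v Ω))) := rfl
    _ = inner ℂ (x (star v Ω)) ((star v * v) (y (star v Ω))) := by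
        rw [← ContinuousLinearMap.adjoint_inner_right]
        rfl
    _ = inner ℂ (x (star v Ω)) ((y * star v) Ω) := by rw [hvv]; rfl
    _ = inner ℂ (x Ω) ((y * (star v * v)) Ω) := by
        rw [hΩ.inner_apply_apply hx (mul_mem hy (star_mem hv)) (star_mem hv), star_star]
        rfl
    _ = inner ℂ (x Ω) (y Ω) := by rw [hvv, mul_one]

theorem IsTraceVector.norm_apply_le_of_approx {x y : E →L[ℂ] E} (hx : x ∈ N) (hy : y ∈ N)
    (hx_norm : ‖x‖ ≤ 1) (ξ : E) : ‖y ξ‖ ≤ ‖y Ω‖ + ‖y‖ * ‖x Ω - ξ‖ :=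
  calc ‖y ξ‖ = ‖y (x Ω) - y (x Ω - ξ)‖ := by rw [← map_sub, sub_sub_cancel]
    _ ≤ ‖y (x Ω)‖ + ‖y (x Ω - ξ)‖ := norm_sub_le _ _
    _ ≤ ‖y Ω‖ + ‖y‖ * ‖x Ω - ξ‖ :=
        add_le_add ((hΩ.norm_apply_apply_le hy hx).trans
          (mul_le_of_le_one_left (norm_nonneg _) hx_norm)) (y.le_opNorm _)

theorem IsTraceVector.norm_apply_sub_starProjection_rightMul_le (L : Submodule ℂ E)
    [L.HasOrthogonalProjection] {x T : E →L[ℂ] E} (hx : x ∈ N) (hT : T ∈ N) (ξ : E) :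
    ‖x (T Ω) - L.starProjection (rightMul N Ω T ξ)‖ ≤
      ‖T‖ * ‖x Ω - ξ‖ + ‖Lᗮ.starProjection (rightMul N Ω T ξ)‖ := by
  have h_split : x (T Ω) - L.starProjection (rightMul N Ω T ξ) =
      rightMul N Ω T (x Ω - ξ) + Lᗮ.starProjection (rightMul N Ω T ξ) := by
    rw [← hΩ.rightMul_apply hx hT, map_sub, Submodule.starProjection_orthogonal_val]
    abel
  rw [h_split]
  exact norm_add_le_of_le (hΩ.norm_rightMul_apply_le hT _) le_rfl

/-- The numerical core of the lower bound: the unit vector `f` cannot at the same time be close to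
`T ξ`, whose component in `L` is small, and to the component in `L` of `R_T ξ`. -/
theorem IsTraceVector.one_le_of_compression (L : Submodule ℂ E) [L.HasOrthogonalProjection]
    {x T y : E →L[ℂ] E} (hx : x ∈ N) (hT : T ∈ N) (hT_norm : ‖T‖ ≤ 2) {f ξ : E}
    (h_inner : ∀ k ∈ L, inner ℂ (T ξ) k = inner ℂ (y ξ) k) (hf : ‖f‖ = 1) {r δ ρ σ : ℝ}
    (hf_left : ‖f - T (x Ω)‖ ≤ r) (hf_right : ‖f - x (T Ω)‖ ≤ r) (hδ : ‖x Ω - ξ‖ ≤ δ)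
    (hρ : ‖Lᗮ.starProjection (rightMul N Ω T ξ)‖ ≤ ρ) (hσ : ‖y ξ‖ ≤ σ) :
    1 ≤ r + 2 * δ + ρ + (r + 2 * δ + σ) * (1 + (r + 2 * δ + ρ)) := by
  set k := L.starProjection (rightMul N Ω T ξ)
  have hTδ : ‖T‖ * ‖x Ω - ξ‖ ≤ 2 * δ := mul_le_mul hT_norm hδ (norm_nonneg _) zero_le_two
  have h_fk : ‖f - k‖ ≤ r + 2 * δ + ρ := by
    have h := hΩ.norm_apply_sub_starProjection_rightMul_le L hx hT ξ
    linarith [norm_sub_le_norm_sub_add_norm_sub f (x (T Ω)) k]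
  have h_fT : ‖f - T ξ‖ ≤ r + 2 * δ := by
    have h := T.le_opNorm (x Ω - ξ)
    rw [map_sub] at h
    linarith [norm_sub_le_norm_sub_add_norm_sub f (T (x Ω)) (T ξ)]
  have h_k : ‖k‖ ≤ 1 + (r + 2 * δ + ρ) := by
    linarith [norm_le_norm_add_norm_sub f k]
  have h_pair : ‖inner ℂ (T ξ) k‖ ≤ σ * ‖k‖ := by
    rw [h_inner k (L.starProjection_apply_mem _)]
    exact (norm_inner_le_norm _ _).trans (mul_le_mul_of_nonneg_right hσ (norm_nonneg _))
  have h_lower := one_sub_sub_mul_norm_le_norm_inner (p := T ξ) (k := k) hf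
  have h_upper := mul_le_mul h_fT h_k (norm_nonneg _) ((norm_nonneg _).trans h_fT)
  have hσ_upper := mul_le_mul_of_nonneg_left h_k ((norm_nonneg _).trans hσ)
  linarith

end TraceVector

section LowerBound

variable {Γ X ι H : Type*} [MeasurableSpace X] (μ : Measure X) [IsProbabilityMeasure μ]
  [Group Γ] [MulAction Γ X] [MeasurableConstSMul Γ X] [SMulInvariantMeasure Γ X μ]
  [NormedAddCommGroup H] [InnerProductSpace ℝ H]
  (e : HilbertBasis ι ℝ H) {π : Γ →* (H ≃ₗᵢ[ℝ] H)} (b : Cocycle π) (t : ℝ)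

theorem norm_fibreRestrict_le {F : Set Γ} {V : Submodule ℝ H}
    (hF : ∀ g ∈ F, ∀ ξ ∈ V, inner ℝ (b.toFun g) ξ = 0) {f q : Space Γ μ ι}
    (hf : f ∈ vecSpan μ e π V) (hq : q ∈ vecSpan μ e π ⊥) :
    ‖fibreRestrict F f‖ ≤ ‖f - implOp μ e b t q‖ + ‖multiplier (implWeight b t) q‖ := by
  set p := fibreRestrict F f with hp
  have h_self : inner ℂ p p = inner ℂ p f := by
    have h_idem : fibreRestrict F p = p := by
      ext1
      funext g
      by_cases hg : g ∈ F
      · exact fibreRestrict_apply_of_mem p hg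
      · rw [fibreRestrict_apply_of_notMem p hg, hp, fibreRestrict_apply_of_notMem f hg]
    nth_rw 2 [hp]
    rw [fibreRestrict, ← inner_multiplier_left, ← fibreRestrict, h_idem]
  have h_impl : inner ℂ p (implOp μ e b t q) = inner ℂ p (multiplier (implWeight b t) q) :=
    inner_fibreRestrict_implOp μ e b t hF hf (vecSpan_mono μ e bot_le hq)
  have h_sq : ‖p‖ * ‖p‖ ≤ ‖p‖ * (‖f - implOp μ e b t q‖ + ‖multiplier (implWeight b t) q‖) :=
    calc ‖p‖ * ‖p‖ = ‖inner ℂ p p‖ := by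
          rw [← inner_self_re_eq_norm, inner_self_eq_norm_mul_norm]
      _ = ‖inner ℂ p (f - implOp μ e b t q) + inner ℂ p (multiplier (implWeight b t) q)‖ := by
          rw [h_self, ← h_impl, ← inner_add_right, sub_add_cancel]
      _ ≤ ‖p‖ * ‖f - implOp μ e b t q‖ + ‖p‖ * ‖multiplier (implWeight b t) q‖ :=
          norm_add_le_of_le (norm_inner_le_norm _ _) (norm_inner_le_norm _ _)
      _ = _ := (mul_add _ _ _).symm
  rcases (norm_nonneg p).eq_or_lt with h | h
  · rw [← h]
    positivity
  · exact le_of_mul_le_mul_left h_sq h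

omit [MulAction Γ X] [MeasurableConstSMul Γ X] [SMulInvariantMeasure Γ X μ] in
theorem implOp_conj_mul (x y : Space Γ μ ι →L[ℂ] Space Γ μ ι) :
    implOp μ e b t * (x * y) * star (implOp μ e b t) =
      implOp μ e b t * x * star (implOp μ e b t) * (implOp μ e b t * y * star (implOp μ e b t)) :=
  map_mul (Unitary.conjStarAlgAut ℂ _ ⟨_, implOp_mem_unitary μ e b t⟩) x y

omit [MulAction Γ X] [MeasurableConstSMul Γ X] [SMulInvariantMeasure Γ X μ] in
theorem implOp_conj_star (x : Space Γ μ ι →L[ℂ] Space Γ μ ι) :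
    implOp μ e b t * star x * star (implOp μ e b t) =
      star (implOp μ e b t * x * star (implOp μ e b t)) :=
  map_star (Unitary.conjStarAlgAut ℂ _ ⟨_, implOp_mem_unitary μ e b t⟩) x

omit [MulAction Γ X] [MeasurableConstSMul Γ X] [SMulInvariantMeasure Γ X μ] in
theorem implOp_conj_mem_unitary {x : Space Γ μ ι →L[ℂ] Space Γ μ ι} (hx : x ∈ unitary _) :
    implOp μ e b t * x * star (implOp μ e b t) ∈ unitary (Space Γ μ ι →L[ℂ] Space Γ μ ι) :=
  mul_mem (mul_mem (implOp_mem_unitary μ e b t) hx)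
    (Unitary.star_mem (implOp_mem_unitary μ e b t))

theorem norm_implOp_conj_sub_apply (x y : Space Γ μ ι →L[ℂ] Space Γ μ ι) :
    ‖(implOp μ e b t * x * star (implOp μ e b t)) (vacuum μ) -
        (implOp μ e b t * y * star (implOp μ e b t)) (vacuum μ)‖ =
      ‖x (vacuum μ) - y (vacuum μ)‖ := by
  rw [implOp_conj_vacuum, implOp_conj_vacuum, ← map_sub,
    ContinuousLinearMap.norm_map_of_mem_unitary (implOp_mem_unitary μ e b t)]

theorem norm_implOp_conj_conj_sub_le {v x : Space Γ μ ι →L[ℂ] Space Γ μ ι}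
    (hv : v ∈ algMtilde μ e π) (hv_unitary : v ∈ unitary _) (hx : x ∈ algMtilde μ e π)
    (hx_unitary : x ∈ unitary _) :
    ‖(implOp μ e b t * (v * x * star v) * star (implOp μ e b t)) (vacuum μ) -
        (v * (implOp μ e b t * x * star (implOp μ e b t)) * star v) (vacuum μ)‖ ≤
      2 * ‖implOp μ e b t (v (vacuum μ)) - v (vacuum μ)‖ := by
  rw [implOp_conj_mul, implOp_conj_mul, implOp_conj_star, ← implOp_conj_vacuum μ e b t v]
  exact (isTraceVector_vacuum μ e π).norm_conj_apply_sub_le (implOp_conj_mem μ e b t hv) hv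
    (implOp_conj_mem μ e b t hx)
    (norm_le_one_of_mem_unitary (implOp_conj_mem_unitary μ e b t hv_unitary))
    (norm_le_one_of_mem_unitary hv_unitary)
    (norm_le_one_of_mem_unitary (implOp_conj_mem_unitary μ e b t hx_unitary))

omit [MulAction Γ X] [MeasurableConstSMul Γ X] [SMulInvariantMeasure Γ X μ] in
theorem norm_apply_vacuum_of_mem_unitary {x : Space Γ μ ι →L[ℂ] Space Γ μ ι}
    (hx : x ∈ unitary _) : ‖x (vacuum μ)‖ = 1 := by
  rw [ContinuousLinearMap.norm_map_of_mem_unitary hx, norm_vacuum]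

theorem re_inner_implOp_conj_le {v x : Space Γ μ ι →L[ℂ] Space Γ μ ι}
    (hv : v ∈ algMtilde μ e π) (hv_unitary : v ∈ unitary _) (hx : x ∈ algMtilde μ e π)
    (hx_unitary : x ∈ unitary _) :
    (inner ℂ ((v * x * star v) (vacuum μ))
        (implOp μ e b t ((v * x * star v) (vacuum μ)))).re ≤
      (inner ℂ (x (vacuum μ)) (implOp μ e b t (x (vacuum μ)))).re +
        2 * ‖implOp μ e b t (v (vacuum μ)) - v (vacuum μ)‖ := by
  set q := (v * x * star v) (vacuum μ)
  set q' := (v * (implOp μ e b t * x * star (implOp μ e b t)) * star v) (vacuum μ)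
  have h_unit : ‖q‖ = 1 := norm_apply_vacuum_of_mem_unitary μ
    (mul_mem (mul_mem hv_unitary hx_unitary) (Unitary.star_mem hv_unitary))
  have h_trace : inner ℂ q q' = inner ℂ (x (vacuum μ)) (implOp μ e b t (x (vacuum μ))) := by
    rw [← implOp_conj_vacuum]
    exact (isTraceVector_vacuum μ e π).inner_conj_apply hv hx (implOp_conj_mem μ e b t hx)
      (Unitary.star_mul_self_of_mem hv_unitary)
  have h_close : ‖implOp μ e b t q - q'‖ ≤
      2 * ‖implOp μ e b t (v (vacuum μ)) - v (vacuum μ)‖ := by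
    rw [← implOp_conj_vacuum]
    exact norm_implOp_conj_conj_sub_le μ e b t hv hv_unitary hx hx_unitary
  have h_diff := (Complex.re_le_norm _).trans (norm_inner_le_norm q (implOp μ e b t q - q'))
  rw [inner_sub_right, Complex.sub_re, h_trace, h_unit, one_mul] at h_diff
  linarith

/-- Take `f = α_t(x v x v*) Ω`, and use that `α_t(v x v*) ≈ v α_t(x) v*`. -/
theorem exists_norm_eq_one_of_commute {v x x₀ : Space Γ μ ι →L[ℂ] Space Γ μ ι}
    (hv : v ∈ algMtilde μ e π) (hv_unitary : v ∈ unitary _) (hx : x ∈ algMtilde μ e π)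
    (hx_unitary : x ∈ unitary _) (hx₀ : x₀ ∈ algMtilde μ e π)
    (h_comm : Commute x (v * x * star v)) {r : ℝ}
    (hr : ‖x (vacuum μ) - x₀ (vacuum μ)‖ +
      2 * ‖implOp μ e b t (v (vacuum μ)) - v (vacuum μ)‖ ≤ r) :
    ∃ f : Space Γ μ ι, ‖f‖ = 1 ∧
      ‖f - (implOp μ e b t * x₀ * star (implOp μ e b t))
        ((v * (implOp μ e b t * x * star (implOp μ e b t)) * star v) (vacuum μ))‖ ≤ r ∧
      ‖f - (v * (implOp μ e b t * x * star (implOp μ e b t)) * star v)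
        ((implOp μ e b t * x₀ * star (implOp μ e b t)) (vacuum μ))‖ ≤ r := by
  have hΩ := isTraceVector_vacuum μ e π
  have h_star := Unitary.star_mem hv_unitary
  have h_dist := norm_implOp_conj_sub_apply μ e b t x x₀
  have h_conj := norm_implOp_conj_conj_sub_le μ e b t hv hv_unitary hx hx_unitary
  have h_conj_mul := implOp_conj_mul μ e b t
  set W := implOp μ e b t
  have hU : W * x * star W ∈ algMtilde μ e π := implOp_conj_mem μ e b t hx
  have hU_unitary : W * x * star W ∈ unitary _ := implOp_conj_mem_unitary μ e b t hx_unitary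
  have hU₁ : W * (v * x * star v) * star W ∈ algMtilde μ e π :=
    implOp_conj_mem μ e b t (mul_mem (mul_mem hv hx) (star_mem hv))
  have hη : v * (W * x * star W) * star v ∈ algMtilde μ e π :=
    mul_mem (mul_mem hv hU) (star_mem hv)
  have hη_unitary := mul_mem (mul_mem hv_unitary hU_unitary) h_star
  refine ⟨(W * (x * (v * x * star v)) * star W) (vacuum μ), norm_apply_vacuum_of_mem_unitary μ
    (implOp_conj_mem_unitary μ e b t
      (mul_mem hx_unitary (mul_mem (mul_mem hv_unitary hx_unitary) h_star))), ?_, ?_⟩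
  · rw [h_conj_mul]
    exact ((hΩ.norm_apply_apply_sub_le hU (implOp_conj_mem μ e b t hx₀) hη
      (norm_le_one_of_mem_unitary hU_unitary) (norm_le_one_of_mem_unitary hη_unitary)).trans
        (add_le_add h_dist.le h_conj)).trans hr
  · rw [h_comm.eq, h_conj_mul, norm_sub_rev]
    rw [← norm_sub_rev] at h_conj h_dist
    exact ((hΩ.norm_apply_apply_sub_le hη hU₁ hU (norm_le_one_of_mem_unitary hη_unitary)
      (norm_le_one_of_mem_unitary hU_unitary)).trans (add_le_add h_conj h_dist.le)).trans
        (by rwa [add_comm])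

theorem norm_multiplier_implWeight_le {f : Space Γ μ ι} (hf : f ∈ vecSpan μ e π ⊥) {c : ℝ}
    (hc : 0 ≤ c) (h : (inner ℂ f (implOp μ e b t f)).re ≤ c ^ 2) :
    ‖multiplier (implWeight b t) f‖ ≤ c := by
  rw [inner_implOp μ e b t hf hf] at h
  exact le_of_sq_le_sq ((norm_multiplier_apply_sq_le _ f).trans h) hc

theorem norm_fibreRestrict_le_of_re_inner_lt {v x : Space Γ μ ι →L[ℂ] Space Γ μ ι}
    (hv : v ∈ algM Γ μ ι) (hv_unitary : v ∈ unitary _)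
    (hv_impl : ‖implOp μ e b t (v (vacuum μ)) - v (vacuum μ)‖ ≤ 1 / 200)
    (hx : x ∈ algM Γ μ ι) (hx_unitary : x ∈ unitary _)
    (h_lt : (inner ℂ (x (vacuum μ)) (implOp μ e b t (x (vacuum μ)))).re < 1 / 1000)
    {F : Set Γ} {V : Submodule ℝ H} (hF : ∀ g ∈ F, ∀ ξ ∈ V, inner ℝ (b.toFun g) ξ = 0)
    {f : Space Γ μ ι} (hf : f ∈ vecSpan μ e π V) :
    ‖fibreRestrict F f‖ ≤ ‖(v * (implOp μ e b t * x * star (implOp μ e b t)) * star v)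
      (vacuum μ) - f‖ + 12 / 100 := by
  have hv' := algM_le μ e (π := π) hv
  have hx' := algM_le μ e (π := π) hx
  have hq := apply_vacuum_mem_vecSpan_bot μ e π (mul_mem (mul_mem hv hx) (star_mem hv))
  have h_conj := norm_implOp_conj_conj_sub_le μ e b t hv' hv_unitary hx' hx_unitary
  rw [implOp_conj_vacuum] at h_conj
  set q := (v * x * star v) (vacuum μ)
  set η := (v * (implOp μ e b t * x * star (implOp μ e b t)) * star v) (vacuum μ)
  have h_multiplier : ‖multiplier (implWeight b t) q‖ ≤ 11 / 100 := by
    have h_re := re_inner_implOp_conj_le μ e b t hv' hv_unitary hx' hx_unitary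
    exact norm_multiplier_implWeight_le μ e b t hq (by norm_num) (by linarith)
  have h_dist := norm_sub_le_norm_sub_add_norm_sub (implOp μ e b t q) η f
  rw [norm_sub_rev _ f] at h_dist
  linarith [norm_fibreRestrict_le μ e b t hF hf hq]

theorem exists_finiteDimensional_orthogonal_eq_zero (K₀ : Submodule ℝ H)
    [FiniteDimensional ℝ K₀] (F : Finset Γ) :
    ∃ K : Submodule ℝ H, FiniteDimensional ℝ K ∧ K₀ ≤ K ∧
      ∀ g ∈ (F : Set Γ), ∀ ξ ∈ Kᗮ, inner ℝ (b.toFun g) ξ = 0 := by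
  have := FiniteDimensional.span_of_finite ℝ (F.finite_toSet.image b.toFun)
  exact ⟨K₀ ⊔ Submodule.span ℝ (b.toFun '' F), inferInstance, le_sup_left, fun g hg ξ hξ =>
    (Submodule.mem_orthogonal _ _).1 hξ _
      (Submodule.mem_sup_right (Submodule.subset_span ⟨g, hg, rfl⟩))⟩

omit [MulAction Γ X] [MeasurableConstSMul Γ X] [SMulInvariantMeasure Γ X μ] in
theorem norm_implOp_conj (x : Space Γ μ ι →L[ℂ] Space Γ μ ι) :
    ‖implOp μ e b t * x * star (implOp μ e b t)‖ = ‖x‖ := by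
  rw [CStarRing.norm_mul_mem_unitary _ (Unitary.star_mem (implOp_mem_unitary μ e b t)),
    CStarRing.norm_mem_unitary_mul _ (implOp_mem_unitary μ e b t)]

theorem norm_multiplier_implWeight_le_of_re_inner_lt {x x₀ : Space Γ μ ι →L[ℂ] Space Γ μ ι}
    (hx : x ∈ algM Γ μ ι)
    (h_lt : (inner ℂ (x (vacuum μ)) (implOp μ e b t (x (vacuum μ)))).re < 1 / 1000)
    (hxx₀ : ‖x (vacuum μ) - x₀ (vacuum μ)‖ ≤ 1 / 1000) :
    ‖multiplier (implWeight b t) (x₀ (vacuum μ))‖ ≤ 33 / 1000 := by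
  have h_x : ‖multiplier (implWeight b t) (x (vacuum μ))‖ ≤ 32 / 1000 :=
    norm_multiplier_implWeight_le μ e b t (apply_vacuum_mem_vecSpan_bot μ e π hx) (by norm_num)
      (by linarith)
  have h_diff := norm_multiplier_apply_le (implWeight b t) (x (vacuum μ) - x₀ (vacuum μ))
  rw [map_sub] at h_diff
  linarith [norm_le_norm_add_norm_sub (multiplier (implWeight b t) (x (vacuum μ)))
    (multiplier (implWeight b t) (x₀ (vacuum μ)))]

theorem exists_mem_vecSpan_norm_conj_sub_le (K : Submodule ℝ H) [FiniteDimensional ℝ K]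
    (hπ : ∀ ξ η : H, Tendsto (fun g : Γ => inner ℝ (π g ξ) η) cofinite (𝓝 0))
    {α : Type*} {l : Filter α} [l.NeBot] {v : α → Space Γ μ ι →L[ℂ] Space Γ μ ι}
    (hv : ∀ n, v n ∈ algM Γ μ ι) (hv_norm : ∀ n, ‖v n‖ ≤ 1)
    (hv_zero : ∀ g, Tendsto (fun n => ‖v n (vacuum μ) g‖) l (𝓝 0))
    {T : Space Γ μ ι →L[ℂ] Space Γ μ ι} (hT : T ∈ algMtilde μ e π) {ε : ℝ} (hε : 0 < ε) :
    ∃ n, ∃ ξ ∈ vecSpan μ e π Kᗮ, ‖ξ‖ ≤ ‖(v n * T * star (v n)) (vacuum μ)‖ ∧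
      ‖(v n * T * star (v n)) (vacuum μ) - ξ‖ ≤ ε := by
  obtain ⟨n, hn⟩ := ((tendsto_norm_starProjection_conj K μ e hv hv_norm hv_zero hπ
    hT).eventually_lt_const hε).exists
  rw [Submodule.starProjection_orthogonal_val] at hn
  exact ⟨n, _, Submodule.starProjection_apply_mem _ _, Submodule.norm_starProjection_apply_le _ _,
    hn.le⟩

theorem le_re_inner_implOp
    (hπ : ∀ ξ η : H, Tendsto (fun g : Γ => inner ℝ (π g ξ) η) cofinite (𝓝 0))
    {α : Type*} {l : Filter α} [l.NeBot] {v : α → Space Γ μ ι →L[ℂ] Space Γ μ ι}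
    (hv : ∀ n, v n ∈ algM Γ μ ι) (hv_unitary : ∀ n, v n ∈ unitary _)
    (hv_zero : ∀ g, Tendsto (fun n => ‖v n (vacuum μ) g‖) l (𝓝 0))
    (hv_impl : ∀ n, ‖implOp μ e b t (v n (vacuum μ)) - v n (vacuum μ)‖ ≤ 1 / 200)
    {x x₀ : Space Γ μ ι →L[ℂ] Space Γ μ ι} (hx : x ∈ algM Γ μ ι) (hx_unitary : x ∈ unitary _)
    (hx₀ : x₀ ∈ genSpan μ e π ⊥) (hx₀_norm : ‖x₀‖ ≤ 2)
    (hxx₀ : ‖x (vacuum μ) - x₀ (vacuum μ)‖ ≤ 1 / 1000)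
    (h_comm : ∀ n, Commute x (v n * x * star (v n))) :
    1 / 1000 ≤ (inner ℂ (x (vacuum μ)) (implOp μ e b t (x (vacuum μ)))).re := by
  by_contra! h_lt
  have hΩ := isTraceVector_vacuum μ e π
  have hx' := algM_le μ e (π := π) hx
  have hx₀' := mem_algMtilde_of_mem_genSpan μ e π hx₀
  have hU := implOp_conj_mem μ e b t hx'
  obtain ⟨K₀, _, y, hy, hy_vacuum, h_inner⟩ := exists_compression μ e b t hx₀
  obtain ⟨F, hF⟩ := exists_finset_norm_starProjection_rightMul_le K₀ μ e hπ
    (implOp_conj_mem_genSpan μ e b t hx₀) (ε := 1 / 1000) (by norm_num)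
  obtain ⟨K, _, hK, hF_orth⟩ := exists_finiteDimensional_orthogonal_eq_zero b K₀ F
  obtain ⟨n, ξ, hξ, hξ_norm, h_dist⟩ := exists_mem_vecSpan_norm_conj_sub_le μ e K hπ hv
    (fun n => norm_le_one_of_mem_unitary (hv_unitary n)) hv_zero hU
    (show 0 < 1 / 1000 / (‖y‖ + 1) by positivity)
  obtain ⟨f, hf, hf_left, hf_right⟩ := exists_norm_eq_one_of_commute μ e b t
    (algM_le μ e (hv n)) (hv_unitary n) hx' hx_unitary hx₀' (h_comm n) (r := 11 / 1000)
    (by linarith [hv_impl n])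
  have h_restrict := norm_fibreRestrict_le_of_re_inner_lt μ e b t (hv n) (hv_unitary n)
    (hv_impl n) hx hx_unitary h_lt hF_orth hξ
  have hη := mul_mem (mul_mem (algM_le μ e (hv n)) hU) (star_mem (algM_le μ e (hv n)))
  have hη_unitary := mul_mem (mul_mem (hv_unitary n)
    (implOp_conj_mem_unitary μ e b t hx_unitary)) (Unitary.star_mem (hv_unitary n))
  set η := v n * (implOp μ e b t * x * star (implOp μ e b t)) * star (v n)
  have hξ₀ := vecSpan_mono μ e (Submodule.orthogonal_le hK) hξ
  have hδy : ‖y‖ * ‖η (vacuum μ) - ξ‖ + ‖η (vacuum μ) - ξ‖ ≤ 1 / 1000 := by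
    rw [le_div_iff₀ (by positivity)] at h_dist
    linarith
  have hδ : ‖η (vacuum μ) - ξ‖ ≤ 1 / 1000 := le_of_add_le_of_nonneg_right hδy (by positivity)
  have hσ : ‖y ξ‖ ≤ 34 / 1000 := by
    have h_y := hΩ.norm_apply_le_of_approx hη (mem_algMtilde_of_mem_genSpan μ e π hy)
      (norm_le_one_of_mem_unitary hη_unitary) ξ
    have h_vacuum := norm_multiplier_implWeight_le_of_re_inner_lt μ e b t hx h_lt hxx₀
    rw [hy_vacuum] at h_y
    linarith [norm_nonneg (η (vacuum μ) - ξ)]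
  have hρ := hF ξ hξ₀
  rw [norm_apply_vacuum_of_mem_unitary μ hη_unitary] at hξ_norm
  rw [norm_implOp_conj] at hρ
  have h_false := hΩ.one_le_of_compression (vecSpan μ e π K₀ᗮ) hη
    (implOp_conj_mem μ e b t hx₀') (by rwa [norm_implOp_conj]) (h_inner ξ hξ₀) hf hf_left hf_right
    hδ (ρ := 243 / 1000) (hρ.trans (by nlinarith [norm_nonneg (fibreRestrict (F : Set Γ) ξ)])) hσ
  norm_num at h_false

end LowerBound

section Normalizer

variable {E : Type*} [NormedAddCommGroup E] [InnerProductSpace ℂ E] [CompleteSpace E]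

theorem conj_mem_of_mem_normalizer {N B : VonNeumannAlgebra E} {v x : E →L[ℂ] E}
    (hv : v ∈ normalizer N B) (hx : x ∈ B) : v * x * star v ∈ B := by
  obtain ⟨_, hv_unitary, h_image⟩ := hv
  obtain ⟨y, hy, rfl⟩ := h_image.symm.subset hx
  have h_cancel : v * (star v * y * v) * star v = y := by
    calc v * (star v * y * v) * star v = v * star v * y * (v * star v) := by simp only [mul_assoc]
      _ = y := by rw [Unitary.mul_star_self_of_mem hv_unitary, one_mul, mul_one]
  exact h_cancel.symm ▸ hy

/-- The unitaries `exp(ih)` with `h = h* ∈ B`, which form a group since `B` is abelian; its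
submonoid structure is all that the averaging argument uses. -/
def expSubmonoid (B : VonNeumannAlgebra E) (hB : ∀ x ∈ B, ∀ y ∈ B, x * y = y * x) :
    Submonoid (E →L[ℂ] E) where
  carrier := {x | ∃ h ∈ B, IsSelfAdjoint h ∧ NormedSpace.exp (Complex.I • h) = x}
  one_mem' := ⟨0, zero_mem B, IsSelfAdjoint.zero _, by rw [smul_zero, NormedSpace.exp_zero]⟩
  mul_mem' := by
    rintro _ _ ⟨h, hh, hh_sa, rfl⟩ ⟨k, hk, hk_sa, rfl⟩
    exact ⟨h + k, add_mem hh hk, hh_sa.add hk_sa,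
      congrArg Subtype.val (Commute.expUnitary_add (a := ⟨h, hh_sa⟩) (b := ⟨k, hk_sa⟩)
        (hB h hh k hk))⟩

variable {B : VonNeumannAlgebra E} {hB : ∀ x ∈ B, ∀ y ∈ B, x * y = y * x}

theorem mem_of_mem_expSubmonoid {x : E →L[ℂ] E} (hx : x ∈ expSubmonoid B hB) : x ∈ B := by
  obtain ⟨h, hh, _, rfl⟩ := hx
  exact exp_mem (SMulMemClass.smul_mem _ hh)

theorem mem_unitary_of_mem_expSubmonoid {x : E →L[ℂ] E} (hx : x ∈ expSubmonoid B hB) :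
    x ∈ unitary (E →L[ℂ] E) := by
  obtain ⟨h, _, hh_sa, rfl⟩ := hx
  exact exp_I_smul_mem_unitary hh_sa

theorem intertwines_of_intertwines_expSubmonoid {a a' w : E →L[ℂ] E}
    (h : ∀ x ∈ expSubmonoid B hB, a * x * a' * w = w * x) {x : E →L[ℂ] E} (hx : x ∈ B) :
    a * x * a' * w = w * x := by
  have h_selfAdjoint : ∀ k ∈ B, IsSelfAdjoint k → a * k * a' * w = w * k := by
    intro k hk hk_sa
    have h_I : a * (Complex.I • k) * a' * w = w * (Complex.I • k) := by
      refine intertwines_of_intertwines_exp fun s => h _ ⟨s • k, ?_, ?_, by rw [smul_comm]⟩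
      · rw [← Complex.coe_smul]
        exact SMulMemClass.smul_mem _ hk
      · exact (IsSelfAdjoint.all s).smul hk_sa
    simp only [mul_smul_comm, smul_mul_assoc] at h_I
    exact smul_right_injective _ Complex.I_ne_zero h_I
  have h_add := h_selfAdjoint (x + star x) (add_mem hx (star_mem hx)) (.add_star_self x)
  have h_sub := h_selfAdjoint (Complex.I • (x - star x))
    (SMulMemClass.smul_mem _ (sub_mem hx (star_mem hx))) (by
      rw [IsSelfAdjoint, star_smul, star_sub, star_star, Complex.star_def, Complex.conj_I, neg_smul,
        ← smul_neg, neg_sub])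
  simp only [mul_smul_comm, smul_mul_assoc] at h_sub
  replace h_sub := smul_right_injective (E →L[ℂ] E) Complex.I_ne_zero h_sub
  have h_split : x = (2⁻¹ : ℂ) • (x + star x) + (2⁻¹ : ℂ) • (x - star x) := by module
  rw [h_split]
  simp only [mul_add, add_mul, mul_smul_comm, smul_mul_assoc] at h_add h_sub ⊢
  rw [h_add, h_sub]

end Normalizer

section Main

variable {Γ : Type*} [Group Γ] {X : Type*} [MeasurableSpace X] (μ : Measure X)
  [IsProbabilityMeasure μ] [MulAction Γ X] [MeasurableConstSMul Γ X] [SMulInvariantMeasure Γ X μ]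
  {H : Type*} [NormedAddCommGroup H] [InnerProductSpace ℝ H]
  {ι : Type*} (e : HilbertBasis ι ℝ H) {π : Γ →* (H ≃ₗᵢ[ℝ] H)} (b : Cocycle π) (t : ℝ)

theorem norm2_deformation_sub (x : algMtilde μ e π) :
    norm2 μ (deformation μ e b t x - x : algMtilde μ e π).1 =
      ‖implOp μ e b t (x.1 (vacuum μ)) - x.1 (vacuum μ)‖ := by
  rw [norm2_eq, ← implOp_conj_vacuum]
  rfl

variable (π) in
theorem exists_mem_genSpan_approx_of_mem_expSubmonoid {B : VonNeumannAlgebra (Space Γ μ ι)}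
    (hBM : B ≤ algM Γ μ ι) {hB : ∀ x ∈ B, ∀ y ∈ B, x * y = y * x}
    {x : Space Γ μ ι →L[ℂ] Space Γ μ ι} (hx : x ∈ expSubmonoid B hB) {ε : ℝ} (hε : 0 < ε) :
    ∃ x₀ ∈ genSpan μ e π ⊥, ‖x₀‖ ≤ 2 ∧ ‖x (vacuum μ) - x₀ (vacuum μ)‖ < ε := by
  obtain ⟨h, hh, hh_sa, rfl⟩ := hx
  exact (isTraceVector_vacuum μ e π).exists_approx_exp (genAlg μ e π ⊥ (map_mem_bot π))
    (fun _ => mem_algMtilde_of_mem_genSpan μ e π) (algM_le μ e (hBM hh))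
    (mem_bicommutant_of_mem_algM μ e π (hBM hh)) hh_sa hε

theorem exists_intertwiner_of_le_re_inner {B : VonNeumannAlgebra (Space Γ μ ι)}
    (hBM : B ≤ algM Γ μ ι) (hB : ∀ x ∈ B, ∀ y ∈ B, x * y = y * x) {δ : ℝ} (hδ : 0 < δ)
    (h_lower : ∀ x ∈ expSubmonoid B hB,
      δ ≤ (inner ℂ (x (vacuum μ)) (implOp μ e b t (x (vacuum μ)))).re) :
    ∃ w : algMtilde μ e π, w ≠ 0 ∧ IsStarProjection (star w * w) ∧
      ∀ x : algMtilde μ e π, x.1 ∈ B → deformation μ e b t x * w = w * x := by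
  have h_mem : ∀ x ∈ expSubmonoid B hB, x ∈ algMtilde μ e π := fun x hx =>
    algM_le μ e (hBM (mem_of_mem_expSubmonoid hx))
  obtain ⟨w, hw_mem, hw_ne, hw⟩ := (isTraceVector_vacuum μ e π).exists_intertwiner
    (implOp_mem_unitary μ e b t) (star_implOp_vacuum μ e b t) h_mem
    (fun x hx => implOp_conj_mem μ e b t (h_mem x hx))
    (fun x => mem_unitary_of_mem_expSubmonoid) hδ h_lower
  have hwB : ∀ x ∈ B, implOp μ e b t * x * star (implOp μ e b t) * w = w * x := fun x =>
    intertwines_of_intertwines_expSubmonoid hw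
  have h_projection := isStarProjection_star_polarPart_mul_self w
  refine ⟨⟨polarPart w, polarPart_mem hw_mem⟩,
    fun h => polarPart_ne_zero hw_ne (congrArg Subtype.val h),
    ⟨Subtype.ext h_projection.1, Subtype.ext h_projection.2⟩, fun x hx => Subtype.ext ?_⟩
  exact polarPart_intertwines (hwB x hx)
    (congr($(implOp_conj_star μ e b t x.1) * w).symm.trans (hwB _ (star_mem hx)))

end Main

end GaussianDeformation

end

theorem theorem5p1_general
    {Γ : Type*} [Group Γ] {X : Type*} [MeasurableSpace X]
    (μ : Measure X) [IsProbabilityMeasure μ]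
    [MulAction Γ X] [MeasurableConstSMul Γ X] [SMulInvariantMeasure Γ X μ]
    {H : Type*} [NormedAddCommGroup H] [InnerProductSpace ℝ H]
    {ι : Type*} (e : HilbertBasis ι ℝ H)
    (π : Γ →* (H ≃ₗᵢ[ℝ] H))
    (hπ : ∀ ξ η : H, Tendsto (fun g : Γ => inner ℝ (π g ξ) η) cofinite (𝓝 0))
    (b : Cocycle π)
    (B : VonNeumannAlgebra (Space Γ μ ι)) (hBM : B ≤ algM Γ μ ι)
    (hB : ∀ x ∈ B, ∀ y ∈ B, x * y = y * x)
    (t : ℝ) {α : Type*} {l : Filter α} [l.NeBot]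
    (v : α → algMtilde μ e π)
    (hv : ∀ n, (v n : Space Γ μ ι →L[ℂ] Space Γ μ ι) ∈ normalizer (algM Γ μ ι) B)
    (ha : ∀ n, norm2 μ (deformation μ e b t (v n) - v n : algMtilde μ e π).1 ≤ 1 / 200)
    (hb : ∀ g : Γ, Tendsto (fun n => ‖fourierCoefficient μ (v n).1 g‖) l (𝓝 0)) :
    ∃ w : algMtilde μ e π, w ≠ 0 ∧ IsStarProjection (star w * w) ∧
      ∀ x : algMtilde μ e π, (x : Space Γ μ ι →L[ℂ] Space Γ μ ι) ∈ B →
        deformation μ e b t x * w = w * x := by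
  have v_mem : ∀ n, (v n).1 ∈ algM Γ μ ι := fun n => (hv n).1
  have v_zero : ∀ g, Tendsto (fun n => ‖(v n).1 (vacuum μ) g‖) l (𝓝 0) := fun g =>
    squeeze_zero (fun _ => norm_nonneg _)
      (fun n => norm_apply_le_norm_fourierCoefficient μ e π (v_mem n) g) (hb g)
  refine exists_intertwiner_of_le_re_inner μ e b t hBM hB (δ := 1 / 1000) (by norm_num) ?_
  intro x hx
  have hxB : x ∈ B := mem_of_mem_expSubmonoid hx
  obtain ⟨x₀, hx₀, hx₀_norm, hxx₀⟩ :=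
    exists_mem_genSpan_approx_of_mem_expSubmonoid μ e π hBM hx (ε := 1 / 1000) (by norm_num)
  exact le_re_inner_implOp μ e b t hπ v_mem (fun n => (hv n).2.1) v_zero
    (fun n => (norm2_deformation_sub μ e b t (v n)).symm.trans_le (ha n)) (hBM hxB)
    (mem_unitary_of_mem_expSubmonoid hx) hx₀ hx₀_norm hxx₀.le
    (fun n => hB x hxB _ (conj_mem_of_mem_normalizer (hv n) hxB))

theorem theorem5p1
    {Γ : Type*} [Group Γ] [Countable Γ]
    {X : Type*} [MeasurableSpace X] [StandardBorelSpace X]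
    (μ : Measure X) [IsProbabilityMeasure μ]
    [MulAction Γ X] [MeasurableConstSMul Γ X] [SMulInvariantMeasure Γ X μ]
    {H : Type*} [NormedAddCommGroup H] [InnerProductSpace ℝ H] [CompleteSpace H]
    {ι : Type*} (e : HilbertBasis ι ℝ H)
    (π : Γ →* (H ≃ₗᵢ[ℝ] H))
    (hπ : ∀ ξ η : H, Tendsto (fun g : Γ => inner ℝ (π g ξ) η) cofinite (𝓝 0))
    (b : Cocycle π)
    (B : VonNeumannAlgebra (Space Γ μ ι)) (hBM : B ≤ algM Γ μ ι)
    (hB : ∀ x ∈ B, ∀ y ∈ B, x * y = y * x)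
    (t : ℝ) (ht : 0 < t)
    (v : ℕ → algMtilde μ e π)
    (hv : ∀ n, (v n : Space Γ μ ι →L[ℂ] Space Γ μ ι) ∈ normalizer (algM Γ μ ι) B)
    (ha : ∀ n, norm2 μ (deformation μ e b t (v n) - v n : algMtilde μ e π).1 < 1 / 200)
    (hb : ∀ g : Γ, Tendsto (fun n => ‖fourierCoefficient μ (v n).1 g‖) atTop (𝓝 0)) :
    ∃ w : algMtilde μ e π, w ≠ 0 ∧ IsStarProjection (star w * w) ∧
      ∀ x : algMtilde μ e π, (x : Space Γ μ ι →L[ℂ] Space Γ μ ι) ∈ B →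
        deformation μ e b t x * w = w * x := by
  exact theorem5p1_general μ e π hπ b B hBM hB t v hv (fun n => (ha n).le) hb
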